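/- \textbf{Setting.} Let $s_1,\dots,s_N\in\mathbb R^2$ be fixed tag positions in a rigid body's local frame, two of which are linearly independent (i.e. not collinear with the origin), and let $a_1,a_2,\dots\in\mathbb R^2$ be a deterministic sequence of known anchor positions. The true pose is $R^o\in SO(2)$, $t^o\in\mathbb R^2$. The range measurements are $$d_{im}=\|a_m-R^os_i-t^o\|+r_{im},\qquad 1\le i\le N,\ m\ge 1,$$ where the $r_{im}$ are independent, $r_{im}\sim\mathcal N(0,\sigma_{im}^2)$, with known standard deviations satisfying $0<\underline\sigma\le\sigma_{im}\le\overline\sigma<\infty$ for constants $\underline\sigma,\overline\sigma$. Assume that the empirical distributions $\frac1M\sum_{m\le M}\delta_{a_m}$ converge weakly to a probability measure $\mu$ on $\mathbb R^2$, that $\mu(\mathcal L)\neq1$ for every line $\mathcal L$, and that $\mu(\{R^os_i+t^o\})=0$ for every $i$ (no positive limiting fraction of the anchors sits at the true position of a tag). With the first $M$ anchors there are $n=NM$ measurements; all limits are for $M\to\infty$ with $N$ fixed. Let $(\hat R_{\rm ML},\hat t_{\rm ML})$ be, almost surely, any global minimizer over $SO(2)\times\mathbb R^2$ of $$\sum_{i=1}^N\sum_{m=1}^M\frac{(d_{im}-\|a_m-Rs_i-t\|)^2}{\sigma_{im}^2}.$$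 Let $(\hat R,\hat t)\in\mathbb R^{2\times2}\times\mathbb R^2$ be random with $\hat R-R^o=O_p(1/\sqrt n)$ and $\hat t-t^o=O_p(1/\sqrt n)$ entrywise. Write $R(\theta)$ for the rotation by the angle $\theta$, and choose $\hat\theta$ such that, almost surely, $R(\hat\theta)$ is a nearest point to $\hat R$ in $SO(2)$ in Frobenius norm (so $R(\hat\theta)=\hat R$ if $\hat R\in SO(2)$). Put $f_{im}=a_m-R(\hat\theta)s_i-\hat t$, let $\mathbf f=(\|f_{im}\|)$ and $\mathbf d=(d_{im})$, let $J_0\in\mathbb R^{n\times3}$ be the Jacobian of $(\theta,t)\mapsto(\|a_m-R(\hat\theta+\theta)s_i-t\|)_{i,m}$ at $(0,\hat t)$ (a row with $f_{im}=0$ is taken to be zero), and let $\Sigma_n={\rm diag}(\sigma_{im}^2)$. The Gauss--Newton estimates are $$\hat R_{\rm GN}=R(\hat\theta+\hat\theta_{\rm GN}),\qquad (\hat\theta_{\rm GN},\hat t_{\rm GN})=(0,\hat t)+(J_0^\top\Sigma_n^{-1}J_0)^{-1}J_0^\top\Sigma_n^{-1}(\mathbf d-\mathbf f),$$ where the inverse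 is read as $0$ if it does not exist. \textbf{Theorem 1.} The probability that $J_0^\top\Sigma_n^{-1}J_0$ is singular tends to $0$, and, entrywise, $$\hat R_{\rm GN}-\hat R_{\rm ML}=o_p(1/\sqrt n),\qquad \hat t_{\rm GN}-\hat t_{\rm ML}=o_p(1/\sqrt n).$$ In particular $\hat R_{\rm GN}-\hat R_{\rm ML}\to0$ and $\hat t_{\rm GN}-\hat t_{\rm ML}\to0$ in probability. -/

import Mathlib

open MeasureTheory ProbabilityTheory Filter Topology
open scoped Matrix ENNReal

noncomputable section

/-- The Euclidean plane. -/
abbrev Plane : Type := EuclideanSpace ℝ (Fin 2)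

/-- The planar rotation matrix with angle `θ`. -/
def rot (θ : ℝ) : Matrix (Fin 2) (Fin 2) ℝ :=
  !![Real.cos θ, -Real.sin θ; Real.sin θ, Real.cos θ]

/-- The special orthogonal group `SO(2)`, as a set of matrices. -/
def SO2 : Set (Matrix (Fin 2) (Fin 2) ℝ) :=
  {R | R ∈ Matrix.specialOrthogonalGroup (Fin 2) ℝ}

/-- The global coordinates `R s + t` of a tag with local coordinates `s`, for the pose `(R, t)`. -/
def tagPosition (R : Matrix (Fin 2) (Fin 2) ℝ) (t s : Plane) : Plane :=
  WithLp.toLp 2 (R *ᵥ s.ofLp) + t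

/-- The range measurement `d = ‖a - R s - t‖ + r` between each tag and each anchor. -/
def rangeMeasurement {N : ℕ} {Ω : Type*} (a : ℕ → Plane) (s : Fin N → Plane)
    (R : Matrix (Fin 2) (Fin 2) ℝ) (t : Plane) (r : Fin N → ℕ → Ω → ℝ)
    (ω : Ω) (i : Fin N) (m : ℕ) : ℝ :=
  ‖a m - tagPosition R t (s i)‖ + r i m ω

/-- The empirical distribution of the first `M + 1` points of a sequence. -/
def empiricalMeasure (a : ℕ → Plane) (M : ℕ) : Measure Plane :=
  ((M + 1 : ℕ) : ℝ≥0∞)⁻¹ • ∑ m ∈ Finset.range (M + 1), Measure.dirac (a m)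

theorem isProbabilityMeasure_empiricalMeasure (a : ℕ → Plane) (M : ℕ) :
    IsProbabilityMeasure (empiricalMeasure a M) := by
  constructor
  simp only [empiricalMeasure, Measure.smul_apply, Measure.finsetSum_apply, measure_univ,
    Finset.sum_const, Finset.card_range, smul_eq_mul, nsmul_eq_mul, mul_one]
  exact ENNReal.inv_mul_cancel (by simp) (by simp)

/-- The empirical distribution of the first `M + 1` points, as a probability measure. -/
def empirical (a : ℕ → Plane) (M : ℕ) : ProbabilityMeasure Plane :=
  ⟨empiricalMeasure a M, isProbabilityMeasure_empiricalMeasure a M⟩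

/-- The weighted least squares objective of the maximum likelihood problem built on the first
`M` anchors, with measurements `d` and noise standard deviations `σ`. -/
def mlObjective {N : ℕ} (a : ℕ → Plane) (s : Fin N → Plane) (σ d : Fin N → ℕ → ℝ) (M : ℕ)
    (x : Matrix (Fin 2) (Fin 2) ℝ × Plane) : ℝ :=
  ∑ i, ∑ m ∈ Finset.range M, (d i m - ‖a m - tagPosition x.1 x.2 (s i)‖) ^ 2 / σ i m ^ 2

/-- `(R, t)` is a (global) solution of the maximum likelihood problem over `SO(2) × ℝ²`. -/
def IsMLEstimate {N : ℕ} (a : ℕ → Plane) (s : Fin N → Plane) (σ d : Fin N → ℕ → ℝ) (M : ℕ)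
    (R : Matrix (Fin 2) (Fin 2) ℝ) (t : Plane) : Prop :=
  R ∈ SO2 ∧ IsMinOn (mlObjective a s σ d M) (SO2 ×ˢ Set.univ) (R, t)

/-- The square of the Frobenius norm. -/
def frobeniusSq (X : Matrix (Fin 2) (Fin 2) ℝ) : ℝ := ∑ i, ∑ j, X i j ^ 2

/-- `W` is a projection of `X` onto `SO(2)`, that is, a nearest point in Frobenius norm. -/
def IsSO2Projection (X W : Matrix (Fin 2) (Fin 2) ℝ) : Prop :=
  W ∈ SO2 ∧ IsMinOn (fun V => frobeniusSq (X - V)) SO2 W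

/-- The vector of predicted ranges for the pose `(rot θ, t)`. -/
def predictedRange {N : ℕ} (a : ℕ → Plane) (s : Fin N → Plane) (M : ℕ) (θ : ℝ) (t : Plane) :
    Fin N × Fin M → ℝ :=
  fun p => ‖a p.2 - tagPosition (rot θ) t (s p.1)‖

/-- The Jacobian of the predicted ranges with respect to `(θ, t)`. With
`f = a - rot θ s - t`, a row is `-(⟪f, rot θ Ψ s⟫, f 0, f 1) / ‖f‖`, where `Ψ` is the derivative
of `rot` at `0`; the row is zero if `f = 0`. -/
def rangeJacobian {N : ℕ} (a : ℕ → Plane) (s : Fin N → Plane) (M : ℕ) (θ : ℝ) (t : Plane) :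
    Matrix (Fin N × Fin M) (Fin 3) ℝ :=
  Matrix.of fun p =>
    let f : Plane := a p.2 - tagPosition (rot θ) t (s p.1)
    let w : Plane := WithLp.toLp 2 ((rot θ * !![0, -1; 1, 0]) *ᵥ (s p.1).ofLp)
    ![-inner ℝ f w / ‖f‖, -f 0 / ‖f‖, -f 1 / ‖f‖]

/-- The covariance matrix of the noise in the first `M` anchors' measurements. -/
def noiseCov {N : ℕ} (σ : Fin N → ℕ → ℝ) (M : ℕ) :
    Matrix (Fin N × Fin M) (Fin N × Fin M) ℝ :=
  Matrix.diagonal fun p => σ p.1 p.2 ^ 2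

/-- The normal matrix `Jᵀ Σ⁻¹ J` of the Gauss-Newton step at the pose `(rot θ, t)`. -/
def gnNormalMatrix {N : ℕ} (a : ℕ → Plane) (s : Fin N → Plane) (σ : Fin N → ℕ → ℝ) (M : ℕ)
    (θ : ℝ) (t : Plane) : Matrix (Fin 3) (Fin 3) ℝ :=
  (rangeJacobian a s M θ t)ᵀ * (noiseCov σ M)⁻¹ * rangeJacobian a s M θ t

/-- One Gauss-Newton step on the problem
`min over (θ', t') of ∑ (d - ‖a - rot (θ + θ') s - t'‖)² / σ²`, started from `(0, t)`:
`(0, t) + (Jᵀ Σ⁻¹ J)⁻¹ Jᵀ Σ⁻¹ (d - f)`. -/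
def gnStep {N : ℕ} (a : ℕ → Plane) (s : Fin N → Plane) (σ d : Fin N → ℕ → ℝ) (M : ℕ)
    (θ : ℝ) (t : Plane) : Fin 3 → ℝ :=
  ![0, t 0, t 1] + (gnNormalMatrix a s σ M θ t)⁻¹ *ᵥ
    ((rangeJacobian a s M θ t)ᵀ *ᵥ ((noiseCov σ M)⁻¹ *ᵥ
      ((fun p : Fin N × Fin M => d p.1 p.2) - predictedRange a s M θ t)))

/-- The rotation obtained from one Gauss-Newton step. -/
def gnRotation {N : ℕ} (a : ℕ → Plane) (s : Fin N → Plane) (σ d : Fin N → ℕ → ℝ) (M : ℕ)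
    (θ : ℝ) (t : Plane) : Matrix (Fin 2) (Fin 2) ℝ :=
  rot (θ + gnStep a s σ d M θ t 0)

/-- The translation obtained from one Gauss-Newton step. -/
def gnTranslation {N : ℕ} (a : ℕ → Plane) (s : Fin N → Plane) (σ d : Fin N → ℕ → ℝ) (M : ℕ)
    (θ : ℝ) (t : Plane) : Plane :=
  !₂[gnStep a s σ d M θ t 1, gnStep a s σ d M θ t 2]

/-- `X k = O_p(b k)`: the ratios `X k / b k` are stochastically bounded. -/
def IsBigOp {Ω : Type*} [MeasurableSpace Ω] (P : Measure Ω) (X : ℕ → Ω → ℝ) (b : ℕ → ℝ) : Prop :=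
  ∀ ε : ℝ≥0∞, 0 < ε → ∃ C : ℝ, ∀ᶠ k in atTop, P {ω | C < |X k ω / b k|} ≤ ε

/-- `X k = o_p(b k)`: the ratios `X k / b k` converge to zero in probability. -/
def IsLittleOp {Ω : Type*} [MeasurableSpace Ω] (P : Measure Ω) (X : ℕ → Ω → ℝ) (b : ℕ → ℝ) :
    Prop :=
  TendstoInMeasure P (fun k ω => X k ω / b k) atTop fun _ => 0

/-- The rate `1 / √n`, where `n = N M` is the number of measurements with `M` anchors. -/
def rootRate (N M : ℕ) : ℝ := 1 / Real.sqrt ((N * M : ℕ) : ℝ)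

end

/-! Write `T = √M`. Near the true pose, at scale `1 / T`, the least squares cost differs from the
quadratic cost linearized at the initial pose only by `o_p(1)`. The maximum likelihood estimate
minimizes the first and the Gauss-Newton step solves the normal equations of the second. The
quadratic has curvature of order `T ^ 2`, so an `o_p(1)` discrepancy between the two costs separates
the two solutions by only `o_p(1 / T)`.

The delicate point is that the distance is not differentiable at the anchor, and anchors may lie
arbitrarily close to the true tag positions, so Taylor expansion to second order is not available.
Everything is instead expressed by the score `∑ ε m • unitVec (a m - p)` with `ε m = r m / σ m ^ 2`,
the gradient of the noise term up to sign. Two facts about it are needed: it is `O_p(T)` uniformly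
in `p`, and its oscillation over a ball of radius `O(1 / T)` around the true tag position is
`o_p(T)`.

Both come from one integral formula: a unit vector is, up to a factor 4, the integral over
directions `φ` of `dirVec φ` times the sign of its inner product with `dirVec φ`
(`integral_sign_inner_dirVec`). In a fixed direction the score thus becomes a signed sum of
independent variables cut at the coordinate of `p`, and Doob's inequality along the order of the
anchors controls all cuts at once (`exists_lower_sum_sq_envelope`). For the oscillation, only the
anchors in a thin slab around the true position contribute; the expected contribution is of order `∑
κ / (κ + ‖a m - p₀‖)`, which is a small fraction of `M` because the limit measure has no atom at
`p₀`. Only independence, zero means and bounded variances of the noise enter.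

Identifiability comes from three non-collinear points in the support of the limit measure: a
positive fraction of bounded anchors stays away from any line, uniformly in the line. This yields a
quadratic lower bound on the squared range differences for every position, near or far, so root-n
consistency of the maximum likelihood estimate follows without a separate consistency argument, and
it yields the curvature of the linearized problem. Two distinct tags turn tag displacements back
into pose displacements.

The comparison itself is deterministic (`exists_gn_sub_ml_bound`); the probabilistic part only shows
that its hypotheses hold outside an event of small probability. -/

section MaximalInequality

/-! ### Doob's inequality along a given order -/

variable {Ω ι : Type*} [MeasurableSpace Ω] {P : Measure Ω}

/-- Martingale orthogonality: a function of the variables in `B` is independent of the new, centred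
one. -/
theorem integral_mul_eq_zero_of_past (ε : ι → Ω → ℝ) (hm : ∀ i, Measurable (ε i))
    (hind : iIndepFun ε P) (h0 : ∀ i, ∫ ω, ε i ω ∂P = 0) (B : Finset ι) {a : ι} (ha : a ∉ B)
    {W : Ω → ℝ} (hW : Measurable[⨆ i ∈ B, MeasurableSpace.comap (ε i) inferInstance] W) :
    ∫ ω, W ω * ε a ω ∂P = 0 := by
  have hle : ∀ i, MeasurableSpace.comap (ε i) inferInstance ≤ ‹MeasurableSpace Ω› :=
    fun i => (hm i).comap_le
  have h1 := indep_iSup_of_disjoint hle hind (S := (B : Set ι)) (T := {a}) (by simpa using ha)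
  have h2 : IndepFun W (ε a) P := by
    rw [IndepFun_iff_Indep]
    refine indep_of_indep_of_le_left (indep_of_indep_of_le_right h1 ?_) ?_
    · simp
    · simpa using hW.comap_le
  have hWm : Measurable W := hW.mono (by simpa using fun i _ => hle i) le_rfl
  rw [h2.integral_fun_mul_eq_mul_integral hWm.aestronglyMeasurable
    (hm a).aestronglyMeasurable, h0 a, mul_zero]

/-- A pathwise form of Doob's maximal inequality, for the partial sums of independent centred
variables along the order induced by `x`. -/
theorem exists_lower_sum_envelope (x : ι → ℝ) (ε : ι → Ω → ℝ) (hm : ∀ i, Measurable (ε i))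
    (hind : iIndepFun ε P) (h2 : ∀ i, MemLp (ε i) 2 P) (h0 : ∀ i, ∫ ω, ε i ω ∂P = 0)
    (B : Finset ι) :
    ∃ W : Ω → ℝ, Measurable[⨆ i ∈ B, MeasurableSpace.comap (ε i) inferInstance] W ∧
      MemLp W 2 P ∧ (∀ ω, 0 ≤ W ω) ∧
      (∀ A ⊆ B, (∀ i ∈ A, ∀ j ∈ B, x j ≤ x i → j ∈ A) → ∀ ω, ∑ i ∈ A, ε i ω ≤ W ω) ∧
      ∫ ω, W ω ^ 2 ∂P ≤ 2 * ∫ ω, W ω * ∑ i ∈ B, ε i ω ∂P := by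
  classical
  induction B using Finset.induction_on_max_value x with
  | empty =>
    refine ⟨fun _ => 0, measurable_const, by simp, by simp, ?_, by simp⟩
    intro A hA _ ω
    simp [Finset.subset_empty.1 hA]
  | insert a B haB hmax ih =>
    obtain ⟨W, hWm, hW2, hW0, hWA, hWS⟩ := ih
    have hle : ∀ i, MeasurableSpace.comap (ε i) inferInstance ≤ ‹MeasurableSpace Ω› :=
      fun i => (hm i).comap_le
    have hS2 : ∀ C : Finset ι, MemLp (fun ω => ∑ i ∈ C, ε i ω) 2 P :=
      fun C => memLp_finsetSum C fun i _ => h2 i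
    have hmono : (⨆ i ∈ B, MeasurableSpace.comap (ε i) inferInstance) ≤
        ⨆ i ∈ insert a B, MeasurableSpace.comap (ε i) (inferInstance : MeasurableSpace ℝ) :=
      biSup_mono fun i hi => Finset.mem_insert_of_mem hi
    have hSm : Measurable[⨆ i ∈ insert a B, MeasurableSpace.comap (ε i) inferInstance]
        (fun ω => ∑ i ∈ insert a B, ε i ω) := by
      refine Finset.measurable_fun_sum _ fun i hi => ?_
      exact (comap_measurable (ε i)).mono
        (le_iSup₂ (f := fun i (_ : i ∈ insert a B) => MeasurableSpace.comap (ε i) inferInstance)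
          i hi) le_rfl
    have hmax2 : MemLp (fun ω => max (W ω) (∑ i ∈ insert a B, ε i ω)) 2 P :=
      hW2.sup (hS2 _)
    -- The envelope is a running maximum. As `a` has the largest value of `x`, a lower set
    -- containing `a` is all of `insert a B`; any other one is a lower set of `B`.
    refine ⟨fun ω => max (W ω) (∑ i ∈ insert a B, ε i ω), (hWm.mono hmono le_rfl).max hSm,
      hmax2, fun ω => le_max_of_le_left (hW0 ω), ?_, ?_⟩
    · intro A hA hlow ω
      by_cases haA : a ∈ A
      · have : A = insert a B := by
          refine hA.antisymm fun j hj => hlow a haA j hj ?_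
          rcases Finset.mem_insert.1 hj with rfl | hj
          · exact le_rfl
          · exact hmax j hj
        rw [this]; exact le_max_right _ _
      · refine le_max_of_le_left (hWA A ?_ ?_ ω)
        · intro i hi
          rcases Finset.mem_insert.1 (hA hi) with rfl | h
          · exact absurd hi haA
          · exact h
        · exact fun i hi j hj => hlow i hi j (Finset.mem_insert_of_mem hj)
    · have hz := integral_mul_eq_zero_of_past ε hm hind h0 B haB hWm
      have i1 : Integrable (fun ω => W ω * ∑ i ∈ B, ε i ω) P := hW2.integrable_mul (hS2 B)
      have i2 : Integrable (fun ω => W ω * ε a ω) P := hW2.integrable_mul (h2 a)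
      have i3 := hmax2.integrable_sq
      have i4 := hW2.integrable_sq
      have i5 : Integrable (fun ω => max (W ω) (∑ i ∈ insert a B, ε i ω) *
          ∑ i ∈ insert a B, ε i ω) P := hmax2.integrable_mul (hS2 _)
      have i34 : Integrable (fun ω => max (W ω) (∑ i ∈ insert a B, ε i ω) ^ 2 - W ω ^ 2) P :=
        i3.sub i4
      have i134 : Integrable (fun ω => max (W ω) (∑ i ∈ insert a B, ε i ω) ^ 2 - W ω ^ 2
          + 2 * (W ω * ∑ i ∈ B, ε i ω)) P := i34.add (i1.const_mul 2)
      -- With `V = max W S'` and `S' = S + ε a`, the pointwise inequality is `V ^ 2 - W ^ 2 + 2 * W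
      -- * S' ≤ 2 * V * S'`: an equality if `V = W`, and `0 ≤ (S' - W) ^ 2` if `V = S'`. The cross
      -- term `W * ε a` then integrates to zero.
      have key : ∫ ω, (max (W ω) (∑ i ∈ insert a B, ε i ω) ^ 2 - W ω ^ 2
            + 2 * (W ω * ∑ i ∈ B, ε i ω) + 2 * (W ω * ε a ω)) ∂P ≤
          ∫ ω, 2 * (max (W ω) (∑ i ∈ insert a B, ε i ω) * ∑ i ∈ insert a B, ε i ω) ∂P := by
        refine integral_mono (i134.add (i2.const_mul 2))
          (i5.const_mul 2) fun ω => ?_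
        simp only [Finset.sum_insert haB]
        set S := ∑ i ∈ B, ε i ω
        rcases le_total (W ω) (ε a ω + S) with h | h
        · rw [max_eq_right h]; nlinarith [sq_nonneg (ε a ω + S - W ω)]
        · rw [max_eq_left h]; nlinarith
      rw [integral_add i134 (i2.const_mul 2),
        integral_add i34 (i1.const_mul 2), integral_sub i3 i4, integral_const_mul,
        integral_const_mul, integral_const_mul, hz] at key
      linarith

variable [IsProbabilityMeasure P]

theorem integral_sum_sq_of_iIndepFun (ε : ι → Ω → ℝ)
    (hind : iIndepFun ε P) (h2 : ∀ i, MemLp (ε i) 2 P) (h0 : ∀ i, ∫ ω, ε i ω ∂P = 0)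
    (B : Finset ι) :
    ∫ ω, (∑ i ∈ B, ε i ω) ^ 2 ∂P = ∑ i ∈ B, ∫ ω, ε i ω ^ 2 ∂P := by
  have h := IndepFun.variance_sum (μ := P) (X := ε) (s := B) (fun i _ => h2 i)
    (fun i _ j _ hij => hind.indepFun hij)
  have hS2 : MemLp (∑ i ∈ B, ε i) 2 P := by
    have := memLp_finsetSum B fun i (_ : i ∈ B) => h2 i
    convert this using 1
    ext ω; simp
  rw [variance_of_integral_eq_zero hS2.aestronglyMeasurable.aemeasurable] at h
  · simp only [Finset.sum_apply] at h
    rw [h]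
    refine Finset.sum_congr rfl fun i _ => ?_
    rw [variance_of_integral_eq_zero (h2 i).aestronglyMeasurable.aemeasurable (h0 i)]
  · simp only [Finset.sum_apply]
    rw [integral_finsetSum _ fun i _ => (h2 i).integrable one_le_two]
    simp [h0]

/-- The one-sided envelopes of `ε` and `-ε` together control the squares; each contributes Doob's
constant 4, whence 8. -/
theorem exists_lower_sum_sq_envelope (x : ι → ℝ) (ε : ι → Ω → ℝ) (hm : ∀ i, Measurable (ε i))
    (hind : iIndepFun ε P) (h2 : ∀ i, MemLp (ε i) 2 P) (h0 : ∀ i, ∫ ω, ε i ω ∂P = 0)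
    (B : Finset ι) :
    ∃ W : Ω → ℝ, 
      (∀ A ⊆ B, (∀ i ∈ A, ∀ j ∈ B, x j ≤ x i → j ∈ A) → ∀ ω, (∑ i ∈ A, ε i ω) ^ 2 ≤ W ω) ∧
      ∫⁻ ω, ENNReal.ofReal (W ω) ∂P ≤ ENNReal.ofReal (8 * ∑ i ∈ B, ∫ ω, ε i ω ^ 2 ∂P) := by
  have main : ∀ δ : ι → Ω → ℝ, (∀ i, Measurable (δ i)) → iIndepFun δ P →
      (∀ i, MemLp (δ i) 2 P) → (∀ i, ∫ ω, δ i ω ∂P = 0) → 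
      (∃ W : Ω → ℝ, MemLp W 2 P ∧ (∀ ω, 0 ≤ W ω) ∧
      (∀ A ⊆ B, (∀ i ∈ A, ∀ j ∈ B, x j ≤ x i → j ∈ A) → ∀ ω, ∑ i ∈ A, δ i ω ≤ W ω) ∧
      ∫ ω, W ω ^ 2 ∂P ≤ 4 * ∑ i ∈ B, ∫ ω, δ i ω ^ 2 ∂P) := by
    intro δ dm dind d2 d0
    obtain ⟨W, -, hW2, hW0, hWA, hWS⟩ := exists_lower_sum_envelope x δ dm dind d2 d0 B
    refine ⟨W, hW2, hW0, hWA, ?_⟩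
    rw [← integral_sum_sq_of_iIndepFun δ dind d2 d0]
    have hS2 : MemLp (fun ω => ∑ i ∈ B, δ i ω) 2 P := memLp_finsetSum B fun i _ => d2 i
    -- Young's inequality, weighted so that half of the integral of `W ^ 2` is absorbed on the left.
    have key : ∫ ω, 2 * (W ω * ∑ i ∈ B, δ i ω) ∂P ≤
        ∫ ω, (2⁻¹ * W ω ^ 2 + 2 * (∑ i ∈ B, δ i ω) ^ 2) ∂P := by
      refine integral_mono ((hW2.integrable_mul hS2).const_mul 2)
        ((hW2.integrable_sq.const_mul _).add (hS2.integrable_sq.const_mul 2)) fun ω => ?_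
      dsimp only
      nlinarith [sq_nonneg (W ω - 2 * ∑ i ∈ B, δ i ω)]
    rw [integral_add (hW2.integrable_sq.const_mul _) (hS2.integrable_sq.const_mul 2),
      integral_const_mul, integral_const_mul, integral_const_mul] at key
    linarith
  obtain ⟨W, hW2, hW0, hWA, hWS⟩ := main ε hm hind h2 h0
  obtain ⟨V, hV2, hV0, hVA, hVS⟩ := main (fun i ω => - ε i ω) (fun i => (hm i).neg)
    (hind.comp (fun _ y => -y) fun _ => measurable_neg) (fun i => (h2 i).neg)
    (fun i => by rw [integral_neg, h0 i, neg_zero])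
  refine ⟨fun ω => W ω ^ 2 + V ω ^ 2, fun A hA hlow ω => ?_, ?_⟩
  · have h1 := hWA A hA hlow ω
    have h3 := hVA A hA hlow ω
    simp only [Finset.sum_neg_distrib] at h3
    have := hW0 ω
    have := hV0 ω
    rcases le_total 0 (∑ i ∈ A, ε i ω) with h | h
    · nlinarith [sq_nonneg (V ω)]
    · nlinarith [sq_nonneg (W ω)]
  · have h4 : Integrable (fun ω => W ω ^ 2 + V ω ^ 2) P := hW2.integrable_sq.add hV2.integrable_sq
    rw [← ofReal_integral_eq_lintegral_ofReal h4
      (ae_of_all _ fun ω => add_nonneg (sq_nonneg _) (sq_nonneg _)),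
      integral_add hW2.integrable_sq hV2.integrable_sq]
    refine ENNReal.ofReal_le_ofReal ?_
    simp only [neg_sq] at hVS
    linarith

end MaximalInequality

/-! ### Unit vectors as integrals of half-plane signs -/

noncomputable section

/-- The unit vector in the direction of `v`, and `0` if `v = 0`. -/
def unitVec (v : Plane) : Plane := ‖v‖⁻¹ • v

/-- The unit vector with polar angle `φ`. -/
def dirVec (φ : ℝ) : Plane := !₂[Real.cos φ, Real.sin φ]

theorem inner_plane (v w : Plane) : inner ℝ v w = v 0 * w 0 + v 1 * w 1 := by
  simp [PiLp.inner_apply, Fin.sum_univ_two, mul_comm]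

theorem norm_sq_plane (v : Plane) : ‖v‖ ^ 2 = v 0 ^ 2 + v 1 ^ 2 := by
  simp [EuclideanSpace.real_norm_sq_eq, Fin.sum_univ_two]

theorem norm_dirVec (φ : ℝ) : ‖dirVec φ‖ = 1 := by
  have h : ‖dirVec φ‖ ^ 2 = 1 := by
    rw [norm_sq_plane]
    simp [dirVec]
  nlinarith [norm_nonneg (dirVec φ)]

theorem continuous_dirVec : Continuous dirVec := by
  unfold dirVec
  fun_prop

theorem exists_polar (v : Plane) : ∃ α, v = ‖v‖ • dirVec α := by
  refine ⟨Complex.arg ⟨v 0, v 1⟩, ?_⟩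
  have hn : ‖(⟨v 0, v 1⟩ : ℂ)‖ = ‖v‖ := by
    rw [← sq_eq_sq₀ (norm_nonneg _) (norm_nonneg _), norm_sq_plane, Complex.sq_norm,
      Complex.normSq_apply]
    ring
  have hc := Complex.norm_mul_cos_arg ⟨v 0, v 1⟩
  have hs := Complex.norm_mul_sin_arg ⟨v 0, v 1⟩
  rw [hn] at hc hs
  ext k
  fin_cases k
  · simpa [dirVec] using hc.symm
  · simpa [dirVec] using hs.symm

theorem inner_dirVec_dirVec (α φ : ℝ) : inner ℝ (dirVec α) (dirVec φ) = Real.cos (φ - α) := by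
  rw [inner_plane, Real.cos_sub]
  simp [dirVec]
  ring

theorem norm_unitVec_le (v : Plane) : ‖unitVec v‖ ≤ 1 := by
  rw [unitVec, norm_smul, norm_inv, norm_norm]
  exact inv_mul_le_one

theorem norm_smul_unitVec (v : Plane) : ‖v‖ • unitVec v = v := by
  rcases eq_or_ne v 0 with rfl | h
  · simp
  · rw [unitVec, smul_smul, mul_inv_cancel₀ (norm_ne_zero_iff.2 h), one_smul]

theorem measurable_realSign : Measurable Real.sign := by
  unfold Real.sign
  exact Measurable.ite measurableSet_Iio measurable_const
    (Measurable.ite measurableSet_Ioi measurable_const measurable_const)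

theorem abs_realSign_le (x : ℝ) : |Real.sign x| ≤ 1 := by
  rcases Real.sign_apply_eq x with h | h | h <;> simp [h]

theorem realSign_mul_of_pos {r : ℝ} (hr : 0 < r) (x : ℝ) : Real.sign (r * x) = Real.sign x := by
  rcases lt_trichotomy x 0 with h | rfl | h
  · rw [Real.sign_of_neg h, Real.sign_of_neg (mul_neg_of_pos_of_neg hr h)]
  · simp
  · rw [Real.sign_of_pos h, Real.sign_of_pos (mul_pos hr h)]

theorem measurable_unitVec : Measurable unitVec :=
  measurable_norm.inv.smul measurable_id

theorem integral_sign_cos_mul (g : ℝ → ℝ) (hg : Continuous g) :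
    ∫ φ in (-(Real.pi / 2))..(-(Real.pi / 2) + 2 * Real.pi), Real.sign (Real.cos φ) * g φ =
      (∫ φ in (-(Real.pi / 2))..(Real.pi / 2), g φ) -
        ∫ φ in (Real.pi / 2)..(-(Real.pi / 2) + 2 * Real.pi), g φ := by
  have hpi := Real.pi_pos
  have hi : ∀ a b, IntervalIntegrable (fun φ => Real.sign (Real.cos φ) * g φ) volume a b := by
    intro a b
    rw [intervalIntegrable_iff]
    refine (intervalIntegrable_iff.1 (hg.intervalIntegrable a b)).bdd_mul (c := 1) ?_ ?_
    · exact (measurable_realSign.comp Real.measurable_cos).aestronglyMeasurable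
    · exact ae_of_all _ fun φ => abs_realSign_le _
  rw [← intervalIntegral.integral_add_adjacent_intervals (hi _ (Real.pi / 2)) (hi _ _),
    sub_eq_add_neg, ← intervalIntegral.integral_neg]
  congr 1
  · refine intervalIntegral.integral_congr_Ioo_of_le (by linarith) fun φ hφ => ?_
    rw [Real.sign_of_pos (Real.cos_pos_of_mem_Ioo hφ), one_mul]
  · refine intervalIntegral.integral_congr_Ioo_of_le (by linarith) fun φ hφ => ?_
    rw [Real.sign_of_neg (Real.cos_neg_of_pi_div_two_lt_of_lt hφ.1 (by linarith [hφ.2]))]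
    ring

/-- A vector is recovered, up to its length, from the signs of its inner products with the unit
vectors. -/
theorem integral_sign_inner_dirVec (v w : Plane) :
    ∫ φ in (-(Real.pi / 2))..(-(Real.pi / 2) + 2 * Real.pi),
      Real.sign (inner ℝ v (dirVec φ)) * inner ℝ (dirVec φ) w = 4 * inner ℝ (unitVec v) w := by
  rcases eq_or_ne v 0 with rfl | hv
  · simp [unitVec]
  obtain ⟨α, hα⟩ := exists_polar v
  have hpos : 0 < ‖v‖ := norm_pos_iff.2 hv
  have hu : unitVec v = dirVec α := by
    rw [unitVec]
    nth_rw 2 [hα]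
    rw [smul_smul, inv_mul_cancel₀ hpos.ne', one_smul]
  -- The integrand in the frame where `v` has angle zero; by periodicity the interval of integration
  -- need not move with `α`.
  set G : ℝ → ℝ := fun φ => Real.sign (Real.cos φ) * inner ℝ (dirVec (φ + α)) w with hG
  have hper : Function.Periodic G (2 * Real.pi) := by
    intro φ
    have : φ + 2 * Real.pi + α = φ + α + 2 * Real.pi := by ring
    simp only [hG, Real.cos_add_two_pi, dirVec, this, Real.sin_add_two_pi]
  have h1 : ∀ φ, Real.sign (inner ℝ v (dirVec φ)) * inner ℝ (dirVec φ) w = G (φ - α) := by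
    intro φ
    rw [hα, real_inner_smul_left, inner_dirVec_dirVec, realSign_mul_of_pos hpos]
    simp [hG]
  simp only [h1]
  rw [intervalIntegral.integral_comp_sub_right, show -(Real.pi / 2) + 2 * Real.pi - α =
    -(Real.pi / 2) - α + 2 * Real.pi by ring, hper.intervalIntegral_add_eq _ (-(Real.pi / 2)), hG,
    integral_sign_cos_mul (fun φ => inner ℝ (dirVec (φ + α)) w)
      ((continuous_dirVec.comp (continuous_id.add continuous_const)).inner continuous_const), hu]
  -- The sine part integrates to zero over either half circle. The cosine part gives 2 and -2, and
  -- the minus sign between the halves makes 4.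
  have h2 : ∀ φ, inner ℝ (dirVec (φ + α)) w = inner ℝ (dirVec α) w * Real.cos φ +
      (w 1 * Real.cos α - w 0 * Real.sin α) * Real.sin φ := by
    intro φ
    rw [inner_plane, inner_plane]
    simp only [dirVec, PiLp.toLp_apply, Matrix.cons_val_zero, Matrix.cons_val_one, Real.cos_add,
      Real.sin_add]
    ring
  simp only [h2]
  rw [intervalIntegral.integral_add, intervalIntegral.integral_add]
  · simp only [intervalIntegral.integral_const_mul, integral_cos, integral_sin]
    have e1 : Real.sin (-(Real.pi / 2) + 2 * Real.pi) = -1 := by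
      rw [Real.sin_add_two_pi]; simp
    have e2 : Real.cos (-(Real.pi / 2) + 2 * Real.pi) = 0 := by
      rw [Real.cos_add_two_pi]; simp
    rw [e1, e2]
    simp
    ring
  all_goals exact Continuous.intervalIntegrable (by fun_prop) _ _

/-! ### Thin slabs of directions and the variation of unit vectors -/

/-- The angles of the unit vectors, as an interval of length `2π`. -/
def angles : Set ℝ := Set.Ioc (-(Real.pi / 2)) (-(Real.pi / 2) + 2 * Real.pi)

theorem volume_angles : volume angles = ENNReal.ofReal (2 * Real.pi) := by
  simp [angles]

/-- As `|cos|` has period `π`, half a circle suffices. There the cosine dominates the tent `1 - 2 *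
|φ| / π`, so small values occur only within `π * τ / 2` of the two ends. -/
theorem setIntegral_abs_cos_le {τ : ℝ} (hτ : 0 ≤ τ) (α : ℝ) :
    ∫ φ in angles, Set.indicator {φ | |Real.cos (φ - α)| ≤ τ} (fun _ => (1 : ℝ)) φ
      ≤ 2 * Real.pi * τ := by
  have hpi := Real.pi_pos
  set f : ℝ → ℝ := Set.indicator {φ | |Real.cos φ| ≤ τ} (fun _ => (1 : ℝ)) with hf
  have hms : MeasurableSet {φ | |Real.cos φ| ≤ τ} :=
    measurableSet_le (Real.measurable_cos.abs) measurable_const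
  have hper : Function.Periodic f Real.pi := by
    intro φ
    simp [hf, Set.indicator_apply, Real.cos_add_pi]
  have hper2 : Function.Periodic f (2 * Real.pi) := hper.nat_mul 2
  have hshift : ∀ φ, Set.indicator {φ | |Real.cos (φ - α)| ≤ τ} (fun _ => (1 : ℝ)) φ =
      f (φ - α) := fun φ => rfl
  simp only [hshift]
  have hint : ∀ a b, IntervalIntegrable f volume a b := by
    intro a b
    rw [intervalIntegrable_iff]
    exact (integrableOn_const (by simp)).indicator hms
  rw [angles, ← intervalIntegral.integral_of_le (by linarith),
    intervalIntegral.integral_comp_sub_right, show -(Real.pi / 2) + 2 * Real.pi - α =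
    -(Real.pi / 2) - α + 2 * Real.pi by ring, hper2.intervalIntegral_add_eq _ (-(Real.pi / 2)),
    ← intervalIntegral.integral_add_adjacent_intervals (hint _ (Real.pi / 2)) (hint _ _)]
  have e1 : -(Real.pi / 2) + 2 * Real.pi = Real.pi / 2 + Real.pi := by ring
  have e2 : Real.pi / 2 = -(Real.pi / 2) + Real.pi := by ring
  rw [e1, hper.intervalIntegral_add_eq (Real.pi / 2) (-(Real.pi / 2)), ← e2]
  have main : ∫ φ in (-(Real.pi / 2))..(Real.pi / 2), f φ ≤ Real.pi * τ := by
    rw [intervalIntegral.integral_of_le (by linarith), hf, setIntegral_indicator hms,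
      setIntegral_const, smul_eq_mul, mul_one]
    have hsub : Set.Ioc (-(Real.pi / 2)) (Real.pi / 2) ∩ {φ | |Real.cos φ| ≤ τ} ⊆
        Set.Icc (-(Real.pi / 2)) (-(Real.pi / 2) + Real.pi / 2 * τ) ∪
        Set.Icc (Real.pi / 2 - Real.pi / 2 * τ) (Real.pi / 2) := by
      rintro φ ⟨⟨h1, h2⟩, h3⟩
      have h4 := Real.one_sub_mul_le_cos (abs_nonneg φ) (abs_le.2 ⟨h1.le, h2⟩)
      rw [Real.cos_abs] at h4
      have h5 := (abs_le.1 (show |Real.cos φ| ≤ τ from h3)).2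
      have h6 : Real.pi / 2 - Real.pi / 2 * τ ≤ |φ| := by
        have h7 : 1 - τ ≤ 2 / Real.pi * |φ| := by linarith
        have h8 : Real.pi / 2 * (2 / Real.pi * |φ|) = |φ| := by field_simp
        nlinarith [mul_le_mul_of_nonneg_left h7 (show 0 ≤ Real.pi / 2 by linarith)]
      rcases abs_cases φ with ⟨h, _⟩ | ⟨h, _⟩
      · right; exact ⟨by linarith, h2⟩
      · left; exact ⟨h1.le, by linarith⟩
    calc volume.real (Set.Ioc (-(Real.pi / 2)) (Real.pi / 2) ∩ {φ | |Real.cos φ| ≤ τ})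
        ≤ volume.real (Set.Icc (-(Real.pi / 2)) (-(Real.pi / 2) + Real.pi / 2 * τ) ∪
            Set.Icc (Real.pi / 2 - Real.pi / 2 * τ) (Real.pi / 2)) :=
          measureReal_mono hsub
            ((measure_union_lt_top measure_Icc_lt_top measure_Icc_lt_top).ne)
      _ ≤ _ := measureReal_union_le _ _
      _ = Real.pi * τ := by
        rw [Real.volume_real_Icc_of_le (by nlinarith), Real.volume_real_Icc_of_le (by nlinarith)]
        ring
  linarith

/-- The ratio `κ / (κ + ‖v‖)` stands for `min 1 (κ / ‖v‖)`, to which it is comparable within a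
factor 2. Being bounded and continuous in `v`, it can be averaged over anchors and passed to the
weak limit. -/
theorem volume_abs_inner_dirVec_le (v : Plane) {κ : ℝ} (hκ : 0 < κ) :
    volume ({φ | |inner ℝ v (dirVec φ)| ≤ κ} ∩ angles) ≤
      ENNReal.ofReal (4 * Real.pi * (κ / (κ + ‖v‖))) := by
  have hpi := Real.pi_pos
  rcases le_or_gt ‖v‖ κ with h | h
  · refine (measure_mono Set.inter_subset_right).trans ?_
    rw [volume_angles]
    refine ENNReal.ofReal_le_ofReal ?_
    have : 1 / 2 ≤ κ / (κ + ‖v‖) := by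
      rw [div_le_div_iff₀ (by norm_num) (by positivity)]; linarith
    nlinarith
  · obtain ⟨α, hα⟩ := exists_polar v
    have hv : 0 < ‖v‖ := hκ.trans h
    have hset : {φ | |inner ℝ v (dirVec φ)| ≤ κ} = {φ | |Real.cos (φ - α)| ≤ κ / ‖v‖} := by
      ext φ
      simp only [Set.mem_ofPred_eq]
      rw [hα, real_inner_smul_left, inner_dirVec_dirVec, abs_mul, abs_norm, ← hα,
        le_div_iff₀ hv, mul_comm]
    have hms : MeasurableSet {φ | |Real.cos (φ - α)| ≤ κ / ‖v‖} :=
      measurableSet_le (by fun_prop) measurable_const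
    rw [hset, ← ofReal_measureReal (h := ne_top_of_le_ne_top (by rw [volume_angles]; exact ENNReal.ofReal_ne_top)
      (measure_mono Set.inter_subset_right))]
    refine ENNReal.ofReal_le_ofReal ?_
    have h1 := setIntegral_abs_cos_le (τ := κ / ‖v‖) (by positivity) α
    rw [setIntegral_indicator hms, setIntegral_const, smul_eq_mul, mul_one, Set.inter_comm] at h1
    refine h1.trans ?_
    have : κ / ‖v‖ ≤ 2 * (κ / (κ + ‖v‖)) := by
      rw [← mul_div_assoc, div_le_div_iff₀ hv (by positivity)]; nlinarith
    nlinarith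

theorem norm_unitVec_sub_unitVec_le (v h : Plane) {κ : ℝ} (hκ : 0 < κ) (hh : ‖h‖ ≤ κ) :
    ‖unitVec (v - h) - unitVec v‖ ≤ 4 * (κ / (κ + ‖v‖)) := by
  rcases le_or_gt ‖v‖ κ with hv | hv
  · have : 1 / 2 ≤ κ / (κ + ‖v‖) := by
      rw [div_le_div_iff₀ (by norm_num) (by positivity)]; linarith
    linarith [norm_sub_le (unitVec (v - h)) (unitVec v), norm_unitVec_le (v - h),
      norm_unitVec_le v]
  · have hv0 : 0 < ‖v‖ := hκ.trans hv
    have e : ‖v‖ • (unitVec (v - h) - unitVec v) =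
        (‖v‖ - ‖v - h‖) • unitVec (v - h) - h := by
      rw [smul_sub, norm_smul_unitVec, sub_smul, norm_smul_unitVec]; abel
    have h1 : ‖v‖ * ‖unitVec (v - h) - unitVec v‖ ≤ 2 * κ := by
      rw [show ‖v‖ * ‖unitVec (v - h) - unitVec v‖ = ‖‖v‖ • (unitVec (v - h) - unitVec v)‖ by
        rw [norm_smul, norm_norm], e]
      refine (norm_sub_le _ _).trans ?_
      rw [norm_smul, Real.norm_eq_abs]
      have h2 : |‖v‖ - ‖v - h‖| ≤ ‖h‖ := by
        have := abs_norm_sub_norm_le v (v - h)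
        simpa using this
      have h3 := norm_unitVec_le (v - h)
      nlinarith [abs_nonneg (‖v‖ - ‖v - h‖), norm_nonneg (unitVec (v - h))]
    have h4 : ‖unitVec (v - h) - unitVec v‖ ≤ 2 * κ / ‖v‖ := by
      rw [le_div_iff₀ hv0]; linarith
    refine h4.trans ?_
    rw [← mul_div_assoc, div_le_div_iff₀ hv0 (by positivity)]
    nlinarith

/-- The segment from `p` to `q` meets `a` at most once if `q ≠ p`, and elsewhere the norm is
differentiable; the fundamental theorem of calculus tolerates a countable exceptional set. -/
theorem norm_sub_norm_eq_integral (a p q : Plane) :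
    ‖a - q‖ - ‖a - p‖ =
      ∫ t in (0 : ℝ)..1, -inner ℝ (unitVec (a - (p + t • (q - p)))) (q - p) := by
  rcases eq_or_ne q p with rfl | hqp
  · simp
  have hcont : Continuous fun t : ℝ => ‖a - (p + t • (q - p))‖ := by fun_prop
  rw [integral_eq_of_hasDerivAt_off_countable_of_le (fun t : ℝ => ‖a - (p + t • (q - p))‖)
    _ zero_le_one (s := {t | a - (p + t • (q - p)) = 0}) ?_ hcont.continuousOn ?_ ?_]
  · simp
  · refine Set.Subsingleton.countable fun t ht t' ht' => ?_
    simp only [Set.mem_ofPred_eq] at ht ht'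
    have : (t - t') • (q - p) = 0 := by
      rw [sub_smul, sub_eq_zero]
      have h := ht.trans ht'.symm
      simpa using h
    rcases smul_eq_zero.1 this with h | h
    · linarith
    · exact absurd (sub_eq_zero.1 h) hqp
  · rintro t ⟨-, ht⟩
    have hne : a - (p + t • (q - p)) ≠ 0 := ht
    have h1 : HasDerivAt (fun t : ℝ => a - (p + t • (q - p))) (-(q - p)) t := by
      have := (((hasDerivAt_id t).smul_const (q - p)).const_add p).const_sub a
      simpa using this
    have h2 := h1.norm_sq.sqrt (by positivity)
    simp only [Real.sqrt_sq (norm_nonneg _)] at h2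
    have h3 : HasDerivAt (fun t : ℝ => ‖a - (p + t • (q - p))‖)
        (-inner ℝ (unitVec (a - (p + t • (q - p)))) (q - p)) t := by
      convert h2 using 1
      rw [unitVec, real_inner_smul_left, inner_neg_right]
      field_simp
    exact h3
  · rw [intervalIntegrable_iff]
    refine Measure.integrableOn_of_bounded (M := ‖q - p‖) (by simp) ?_ ?_
    · refine Measurable.aestronglyMeasurable ?_
      have : Measurable fun t : ℝ => unitVec (a - (p + t • (q - p))) :=
        measurable_unitVec.comp (by fun_prop)
      exact (this.inner measurable_const).neg
    · refine ae_of_all _ fun t => ?_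
      rw [norm_neg]
      refine (norm_inner_le_norm _ _).trans ?_
      nlinarith [norm_unitVec_le (a - (p + t • (q - p))), norm_nonneg (q - p)]

theorem intervalIntegrable_inner_unitVec (a p q w : Plane) :
    IntervalIntegrable (fun t : ℝ => inner ℝ (unitVec (a - (p + t • (q - p)))) w) volume 0 1 := by
  rw [intervalIntegrable_iff]
  refine Measure.integrableOn_of_bounded (M := ‖w‖) (by simp) ?_ ?_
  · refine Measurable.aestronglyMeasurable ?_
    have : Measurable fun t : ℝ => unitVec (a - (p + t • (q - p))) :=
      measurable_unitVec.comp (by fun_prop)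
    exact this.inner measurable_const
  · refine ae_of_all _ fun t => ?_
    refine (norm_inner_le_norm _ _).trans ?_
    nlinarith [norm_unitVec_le (a - (p + t • (q - p))), norm_nonneg w]

/-! ### The score, bounded by one-dimensional cut sums -/

/-- The weighted sum of the unit vectors that point from `p` to the first `M` points of `a`. -/
def score (a : ℕ → Plane) (ε : ℕ → ℝ) (M : ℕ) (p : Plane) : Plane :=
  ∑ m ∈ Finset.range M, ε m • unitVec (a m - p)

/-- The sign of `x - c` is `1` minus the indicators of `x ≤ c` and `x < c`. Each of the three sums
is over a lower set, which is empty or cut at one of the points, so finitely many cuts control every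
real `c`. -/
theorem abs_sum_mul_sign_le (B : Finset ℕ) (x ε : ℕ → ℝ) {K : ℝ} (hK : 0 ≤ K)
    (h : ∀ k ∈ B, |∑ m ∈ B with x m ≤ x k, ε m| ≤ K) (c : ℝ) :
    |∑ m ∈ B, ε m * Real.sign (x m - c)| ≤ 3 * K := by
  have key : ∀ q : ℝ → Prop, [DecidablePred q] → (∀ y z, y ≤ z → q z → q y) →
      |∑ m ∈ B with q (x m), ε m| ≤ K := by
    intro q _ hq
    rcases (B.filter fun m => q (x m)).eq_empty_or_nonempty with he | hne
    · rw [he]; simpa using hK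
    · obtain ⟨k, hk, hmax⟩ := Finset.exists_max_image _ x hne
      rw [Finset.mem_filter] at hk
      have : (B.filter fun m => q (x m)) = B.filter fun m => x m ≤ x k := by
        ext m
        simp only [Finset.mem_filter, and_congr_right_iff]
        exact fun hm => ⟨fun h => hmax m (Finset.mem_filter.2 ⟨hm, h⟩), fun h => hq _ _ h hk.2⟩
      rw [this]
      exact h k hk.1
  have e : ∑ m ∈ B, ε m * Real.sign (x m - c) = (∑ m ∈ B with (fun _ => True) (x m), ε m) -
      (∑ m ∈ B with x m ≤ c, ε m) - ∑ m ∈ B with x m < c, ε m := by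
    simp only [Finset.sum_filter, ← Finset.sum_sub_distrib]
    refine Finset.sum_congr rfl fun m _ => ?_
    rcases lt_trichotomy (x m) c with h | h | h
    · rw [Real.sign_of_neg (by linarith)]; simp [h, h.le]
    · simp [h]
    · rw [Real.sign_of_pos (by linarith)]; simp [not_le.2 h, not_lt.2 h.le]
  rw [e]
  have h1 := key (fun _ => True) fun _ _ _ _ => trivial
  have h2 := key (fun y => y ≤ c) fun _ _ h h' => h.trans h'
  have h3 := key (fun y => y < c) fun _ _ h h' => h.trans_lt h'
  rw [abs_le] at *
  constructor <;> linarith [h1.1, h1.2, h2.1, h2.2, h3.1, h3.2]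

open Classical in
/-- The sum of the weights `ε m` with `φ ∈ S m` of the points that are not above the `k`-th one in
the direction `φ`. -/
def cutSum (a : ℕ → Plane) (S : ℕ → Set ℝ) (M : ℕ) (ε : ℕ → ℝ) (φ : ℝ) (k : ℕ) : ℝ :=
  ∑ m ∈ Finset.range M,
    if φ ∈ S m ∧ inner ℝ (a m) (dirVec φ) ≤ inner ℝ (a k) (dirVec φ) then ε m else 0

theorem cutSum_eq (a : ℕ → Plane) (S : ℕ → Set ℝ) (M : ℕ) (ε : ℕ → ℝ) (φ : ℝ) (k : ℕ)
    [DecidablePred fun m => φ ∈ S m] :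
    cutSum a S M ε φ k = ∑ m ∈ (Finset.range M).filter (fun m => φ ∈ S m) with
      inner ℝ (a m) (dirVec φ) ≤ inner ℝ (a k) (dirVec φ), ε m := by
  rw [cutSum, Finset.filter_filter, Finset.sum_filter]
  refine Finset.sum_congr rfl fun m _ => ?_
  congr

/-- The largest square of a partial sum of the weights `ε m` with `φ ∈ S m`, summed in the order
of the coordinates of the points in the direction `φ`. -/
def cutEnvelope (a : ℕ → Plane) (S : ℕ → Set ℝ) (M : ℕ) (ε : ℕ → ℝ) (φ : ℝ) : ℝ≥0∞ :=
  ⨆ k ∈ Finset.range M, ENNReal.ofReal (cutSum a S M ε φ k ^ 2)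

theorem cutEnvelope_ne_top (a : ℕ → Plane) (S : ℕ → Set ℝ) (M : ℕ) (ε : ℕ → ℝ) (φ : ℝ) :
    cutEnvelope a S M ε φ ≠ ∞ := by
  refine ne_top_of_le_ne_top (b := ∑ k ∈ Finset.range M, ENNReal.ofReal (cutSum a S M ε φ k ^ 2))
    (ENNReal.sum_ne_top.2 fun _ _ => ENNReal.ofReal_ne_top) (iSup₂_le fun k hk => ?_)
  exact Finset.single_le_sum (f := fun k => ENNReal.ofReal (cutSum a S M ε φ k ^ 2))
    (fun _ _ => zero_le) hk

theorem abs_sum_mul_sign_le_cutEnvelope (a : ℕ → Plane) (S : ℕ → Set ℝ) (M : ℕ) (ε : ℕ → ℝ)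
    (φ c : ℝ) [DecidablePred fun m => φ ∈ S m] :
    |∑ m ∈ Finset.range M with φ ∈ S m, ε m * Real.sign (inner ℝ (a m) (dirVec φ) - c)| ≤
      3 * √(cutEnvelope a S M ε φ).toReal := by
  refine abs_sum_mul_sign_le _ (fun m => inner ℝ (a m) (dirVec φ)) ε (Real.sqrt_nonneg _)
    (fun k hk => Real.abs_le_sqrt ?_) c
  rw [← ENNReal.ofReal_le_iff_le_toReal (cutEnvelope_ne_top a S M ε φ), ← cutSum_eq]
  exact le_iSup₂ (f := fun k (_ : k ∈ Finset.range M) =>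
    ENNReal.ofReal (cutSum a S M ε φ k ^ 2)) k (Finset.mem_filter.1 hk).1

/-- Take `w = z` and split `|G| * ‖z‖` by Young's inequality, so that the `‖z‖ ^ 2` part integrates
to exactly `‖z‖ ^ 2` and is absorbed. What remains is `3 * ‖z‖ ^ 2 ≤ 18 * π * ∫ F`, and `6 * π <
19`. The 36 is the square of `3 + 3`, from the difference of two signed sums. -/
theorem ofReal_norm_sq_le_lintegral (z : Plane) (G : ℝ → ℝ) (F : ℝ → ℝ≥0∞)
    (hG : ∀ w, 4 * inner ℝ z w = ∫ φ in angles, G φ * inner ℝ (dirVec φ) w)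
    (hGF : ∀ φ, ENNReal.ofReal (G φ ^ 2) ≤ 36 * F φ) :
    ENNReal.ofReal (‖z‖ ^ 2) ≤ 19 * ∫⁻ φ in angles, F φ := by
  have hpi := Real.pi_pos
  have h1 : ENNReal.ofReal (4 * ‖z‖ ^ 2) ≤
      ∫⁻ φ in angles, (ENNReal.ofReal (18 * Real.pi) * F φ
        + ENNReal.ofReal (‖z‖ ^ 2 / (2 * Real.pi))) := by
    rw [show 4 * ‖z‖ ^ 2 = ∫ φ in angles, G φ * inner ℝ (dirVec φ) z by
      rw [← real_inner_self_eq_norm_sq, hG]]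
    refine (ENNReal.ofReal_le_ofReal (le_abs_self _)).trans ?_
    rw [← Real.norm_eq_abs, ofReal_norm]
    refine (enorm_integral_le_lintegral_enorm _).trans (lintegral_mono fun φ => ?_)
    have h2 : ‖G φ * inner ℝ (dirVec φ) z‖ ≤
        (Real.pi / 2) * G φ ^ 2 + ‖z‖ ^ 2 / (2 * Real.pi) := by
      rw [norm_mul, Real.norm_eq_abs]
      have h3 : ‖inner ℝ (dirVec φ) z‖ ≤ ‖z‖ := by
        simpa [norm_dirVec] using norm_inner_le_norm (𝕜 := ℝ) (dirVec φ) z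
      have h4 : (Real.pi / 2) * G φ ^ 2 + ‖z‖ ^ 2 / (2 * Real.pi) - |G φ| * ‖z‖ =
          (Real.pi * |G φ| - ‖z‖) ^ 2 / (2 * Real.pi) := by
        rw [← sq_abs (G φ)]; field_simp; ring
      have h5 : 0 ≤ (Real.pi * |G φ| - ‖z‖) ^ 2 / (2 * Real.pi) := by positivity
      nlinarith [abs_nonneg (G φ)]
    rw [← ofReal_norm]
    refine (ENNReal.ofReal_le_ofReal h2).trans ?_
    rw [ENNReal.ofReal_add (by positivity) (by positivity), ENNReal.ofReal_mul (by positivity)]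
    refine add_le_add ((mul_le_mul_right (hGF φ) _).trans ?_) le_rfl
    rw [← mul_assoc, show (36 : ℝ≥0∞) = ENNReal.ofReal 36 by norm_num,
      ← ENNReal.ofReal_mul (by positivity)]
    exact mul_le_mul_left (ENNReal.ofReal_le_ofReal (by linarith)) _
  rw [lintegral_add_right _ measurable_const, lintegral_const_mul' _ _ ENNReal.ofReal_ne_top,
    setLIntegral_const, volume_angles, ← ENNReal.ofReal_mul (by positivity),
    div_mul_cancel₀ _ (by positivity)] at h1
  by_cases hF : ∫⁻ φ in angles, F φ = ∞
  · rw [hF]; simp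
  rw [← ENNReal.ofReal_toReal hF, ← ENNReal.ofReal_mul (by positivity),
    ← ENNReal.ofReal_add (by positivity) (by positivity), ENNReal.ofReal_le_ofReal_iff
      (by positivity)] at h1
  rw [← ENNReal.ofReal_toReal hF, show (19 : ℝ≥0∞) = ENNReal.ofReal 19 by norm_num,
    ← ENNReal.ofReal_mul (by positivity)]
  refine ENNReal.ofReal_le_ofReal ?_
  have := Real.pi_lt_d2
  nlinarith [ENNReal.toReal_nonneg (a := ∫⁻ φ in angles, F φ)]

theorem four_mul_inner_score (a : ℕ → Plane) (ε : ℕ → ℝ) (M : ℕ) (p w : Plane) :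
    4 * inner ℝ (score a ε M p) w = ∫ φ in angles,
      (∑ m ∈ Finset.range M, ε m * Real.sign (inner ℝ (a m) (dirVec φ) - inner ℝ p (dirVec φ)))
        * inner ℝ (dirVec φ) w := by
  have hpi := Real.pi_pos
  have hle : -(Real.pi / 2) ≤ -(Real.pi / 2) + 2 * Real.pi := by linarith
  simp only [score, sum_inner, Finset.mul_sum, Finset.sum_mul, ← inner_sub_left]
  rw [integral_finsetSum]
  · refine Finset.sum_congr rfl fun m _ => ?_
    rw [real_inner_smul_left, mul_left_comm, ← integral_sign_inner_dirVec,
      intervalIntegral.integral_of_le hle, ← integral_const_mul, angles]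
    simp only [mul_assoc]
  · intro m _
    have hd := continuous_dirVec
    refine Measure.integrableOn_of_bounded (M := |ε m| * ‖w‖) (by simp [volume_angles,
      ENNReal.mul_eq_top]) ?_ ?_
    · refine Measurable.aestronglyMeasurable ?_
      refine ((measurable_realSign.comp ?_).const_mul _).mul ?_
      · exact (Continuous.inner continuous_const hd).measurable
      · exact (Continuous.inner hd continuous_const).measurable
    · refine ae_of_all _ fun φ => ?_
      rw [norm_mul, norm_mul, Real.norm_eq_abs, Real.norm_eq_abs]
      have h3 : ‖inner ℝ (dirVec φ) w‖ ≤ ‖w‖ := by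
        simpa [norm_dirVec] using norm_inner_le_norm (𝕜 := ℝ) (dirVec φ) w
      have h4 := abs_realSign_le (inner ℝ (a m - p) (dirVec φ))
      have := mul_le_mul_of_nonneg_left h4 (abs_nonneg (ε m))
      have := mul_le_mul this h3 (norm_nonneg _) (by simp)
      simpa using this

theorem ofReal_sq_le_mul_cutEnvelope {x : ℝ} {F : ℝ≥0∞} (hF : F ≠ ∞)
    (h : |x| ≤ 6 * √F.toReal) : ENNReal.ofReal (x ^ 2) ≤ 36 * F := by
  rw [← ENNReal.ofReal_toReal hF, show (36 : ℝ≥0∞) = ENNReal.ofReal 36 by norm_num,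
    ← ENNReal.ofReal_mul (by positivity)]
  refine ENNReal.ofReal_le_ofReal ?_
  rw [← sq_abs]
  refine (pow_le_pow_left₀ (abs_nonneg _) h 2).trans ?_
  rw [mul_pow, Real.sq_sqrt ENNReal.toReal_nonneg]
  norm_num

/-- In each direction, moving `p` only moves the cut, and the envelope dominates all cuts. The bound
is therefore free of `p`: uniformity over the plane needs no chaining or covering. -/
theorem ofReal_norm_score_sq_le (a : ℕ → Plane) (ε : ℕ → ℝ) (M : ℕ) (p : Plane) :
    ENNReal.ofReal (‖score a ε M p‖ ^ 2) ≤
      19 * ∫⁻ φ in angles, cutEnvelope a (fun _ => Set.univ) M ε φ := by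
  refine ofReal_norm_sq_le_lintegral _ _ _ (four_mul_inner_score a ε M p) fun φ => ?_
  refine ofReal_sq_le_mul_cutEnvelope (cutEnvelope_ne_top _ _ _ _ _) ?_
  have := abs_sum_mul_sign_le_cutEnvelope a (fun _ => Set.univ) M ε φ (inner ℝ p (dirVec φ))
  simp only [Set.mem_univ, Finset.filter_true] at this
  refine this.trans ?_
  linarith [Real.sqrt_nonneg (cutEnvelope a (fun _ => Set.univ) M ε φ).toReal]

/-- The angles of the directions in which `v` is at most `κ` from the origin. -/
def slabAngles (v : Plane) (κ : ℝ) : Set ℝ := {φ | |inner ℝ v (dirVec φ)| ≤ κ}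

theorem sign_inner_sub_eq_of_notMem_slabAngles {a p₀ p : Plane} {κ φ : ℝ}
    (hp : ‖p - p₀‖ ≤ κ) (hφ : φ ∉ slabAngles (a - p₀) κ) :
    Real.sign (inner ℝ a (dirVec φ) - inner ℝ p (dirVec φ)) =
      Real.sign (inner ℝ (a - p₀) (dirVec φ)) := by
  have h1 : |inner ℝ (p - p₀) (dirVec φ)| ≤ κ := by
    have := norm_inner_le_norm (𝕜 := ℝ) (p - p₀) (dirVec φ)
    rw [norm_dirVec, mul_one] at this
    exact this.trans hp
  have h2 : κ < |inner ℝ (a - p₀) (dirVec φ)| := not_le.1 hφ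
  rw [show inner ℝ a (dirVec φ) - inner ℝ p (dirVec φ) =
    inner ℝ (a - p₀) (dirVec φ) - inner ℝ (p - p₀) (dirVec φ) by
      rw [← inner_sub_left, ← inner_sub_left]; congr 1; abel]
  rw [abs_le] at h1
  rcases lt_abs.1 h2 with h | h
  · rw [Real.sign_of_pos (by linarith), Real.sign_of_pos (by linarith)]
  · rw [Real.sign_of_neg (by linarith), Real.sign_of_neg (by linarith)]

/-- In direction `φ`, an anchor farther than `κ` from `p₀` lies on the same side of `p` and of `q`,
so its signs cancel. What survives is a pair of cut sums over the slab. -/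
theorem ofReal_norm_score_sub_score_sq_le (a : ℕ → Plane) (ε : ℕ → ℝ) (M : ℕ)
    {p₀ p q : Plane} {κ : ℝ} (hp : ‖p - p₀‖ ≤ κ) (hq : ‖q - p₀‖ ≤ κ) :
    ENNReal.ofReal (‖score a ε M p - score a ε M q‖ ^ 2) ≤
      19 * ∫⁻ φ in angles, cutEnvelope a (fun m => slabAngles (a m - p₀) κ) M ε φ := by
  classical
  set sg : Plane → ℕ → ℝ → ℝ := fun p m φ =>
    Real.sign (inner ℝ (a m) (dirVec φ) - inner ℝ p (dirVec φ))
  refine ofReal_norm_sq_le_lintegral _ (fun φ => ∑ m ∈ Finset.range M, ε m * sg p m φ -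
    ∑ m ∈ Finset.range M, ε m * sg q m φ) _ (fun w => ?_) fun φ => ?_
  · rw [inner_sub_left, mul_sub, four_mul_inner_score, four_mul_inner_score, ← integral_sub]
    · simp only [sub_mul, sg]
    all_goals
      have hd := continuous_dirVec
      refine Measure.integrableOn_of_bounded (M := (∑ m ∈ Finset.range M, |ε m|) * ‖w‖)
        (by simp [volume_angles, ENNReal.mul_eq_top]) ?_ ?_
      · refine Measurable.aestronglyMeasurable (Measurable.mul ?_ ?_)
        · refine Finset.measurable_fun_sum _ fun m _ => (measurable_realSign.comp ?_).const_mul _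
          exact ((Continuous.inner continuous_const hd).sub
            (Continuous.inner continuous_const hd)).measurable
        · exact (Continuous.inner hd continuous_const).measurable
      · refine ae_of_all _ fun φ => ?_
        rw [norm_mul]
        have h3 : ‖inner ℝ (dirVec φ) w‖ ≤ ‖w‖ := by
          simpa [norm_dirVec] using norm_inner_le_norm (𝕜 := ℝ) (dirVec φ) w
        refine mul_le_mul ((norm_sum_le _ _).trans (Finset.sum_le_sum fun m _ => ?_)) h3
          (norm_nonneg _) (Finset.sum_nonneg fun m _ => abs_nonneg _)
        rw [norm_mul, Real.norm_eq_abs, Real.norm_eq_abs]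
        exact mul_le_of_le_one_right (abs_nonneg _) (abs_realSign_le _)
  · refine ofReal_sq_le_mul_cutEnvelope (cutEnvelope_ne_top _ _ _ _ _) ?_
    set S : ℕ → Set ℝ := fun m => slabAngles (a m - p₀) κ
    have h1 := abs_sum_mul_sign_le_cutEnvelope a S M ε φ (inner ℝ p (dirVec φ))
    have h2 := abs_sum_mul_sign_le_cutEnvelope a S M ε φ (inner ℝ q (dirVec φ))
    have h3 : ∑ m ∈ Finset.range M, ε m * sg p m φ - ∑ m ∈ Finset.range M, ε m * sg q m φ =
        ∑ m ∈ Finset.range M with φ ∈ S m, ε m * sg p m φ -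
        ∑ m ∈ Finset.range M with φ ∈ S m, ε m * sg q m φ := by
      rw [← Finset.sum_sub_distrib, ← Finset.sum_sub_distrib]
      refine (Finset.sum_filter_of_ne fun m _ hne => ?_).symm
      by_contra hS
      refine hne ?_
      simp only [sg]
      rw [sign_inner_sub_eq_of_notMem_slabAngles hp hS,
        sign_inner_sub_eq_of_notMem_slabAngles hq hS, sub_self]
    rw [h3]
    refine (abs_sub _ _).trans ?_
    linarith

/-! ### Tail bounds for the score and its oscillation -/

section Probability

variable {Ω : Type*} [MeasurableSpace Ω] {P : Measure Ω} [IsProbabilityMeasure P]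

theorem measurable_cutEnvelope (a : ℕ → Plane) {S : ℕ → Set ℝ} (hS : ∀ m, MeasurableSet (S m))
    (M : ℕ) (ε : ℕ → Ω → ℝ) (hm : ∀ m, Measurable (ε m)) :
    Measurable fun z : Ω × ℝ => cutEnvelope a S M (fun m => ε m z.1) z.2 := by
  classical
  unfold cutEnvelope cutSum
  refine Measurable.iSup fun k => Measurable.iSup fun _ => ?_
  refine ENNReal.measurable_ofReal.comp (Measurable.pow_const ?_ 2)
  refine Finset.measurable_fun_sum _ fun m _ => Measurable.ite ?_ ?_ measurable_const
  · have hd := fun m => (Continuous.inner (𝕜 := ℝ) (continuous_const (y := a m))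
      continuous_dirVec).measurable
    exact (measurable_snd (hS m)).inter
      (measurableSet_le ((hd m).comp measurable_snd) ((hd k).comp measurable_snd))
  · exact (hm m).comp measurable_fst

/-- Tonelli: for fixed `φ` the maximal inequality bounds the expectation by the number of `m` with
`φ ∈ S m`, and integrating this count over `φ` gives the volumes. -/
theorem lintegral_cutEnvelope_le (a : ℕ → Plane) {S : ℕ → Set ℝ}
    (hS : ∀ m, MeasurableSet (S m)) (M : ℕ) (ε : ℕ → Ω → ℝ) (hm : ∀ m, Measurable (ε m))
    (hind : iIndepFun ε P) (h2 : ∀ m, MemLp (ε m) 2 P) (h0 : ∀ m, ∫ ω, ε m ω ∂P = 0)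
    {v : ℝ} (hv : ∀ m, ∫ ω, ε m ω ^ 2 ∂P ≤ v) :
    ∫⁻ ω, (∫⁻ φ in angles, cutEnvelope a S M (fun m => ε m ω) φ) ∂P ≤
      ENNReal.ofReal (8 * v) * ∑ m ∈ Finset.range M, volume (S m ∩ angles) := by
  classical
  have hv0 : 0 ≤ v := (integral_nonneg fun ω => sq_nonneg (ε 0 ω)).trans (hv 0)
  rw [lintegral_lintegral_swap (measurable_cutEnvelope a hS M ε hm).aemeasurable]
  have h : ∀ φ, ∫⁻ ω, cutEnvelope a S M (fun m => ε m ω) φ ∂P ≤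
      ENNReal.ofReal (8 * v) * ∑ m ∈ Finset.range M, (S m).indicator 1 φ := by
    intro φ
    obtain ⟨W, hW, hWint⟩ := exists_lower_sum_sq_envelope
      (fun m => inner ℝ (a m) (dirVec φ)) ε hm hind h2 h0
      ((Finset.range M).filter fun m => φ ∈ S m)
    calc ∫⁻ ω, cutEnvelope a S M (fun m => ε m ω) φ ∂P ≤ ∫⁻ ω, ENNReal.ofReal (W ω) ∂P := by
          refine lintegral_mono fun ω => iSup₂_le fun k _ => ENNReal.ofReal_le_ofReal ?_
          convert hW (((Finset.range M).filter fun m => φ ∈ S m).filter fun m =>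
            inner ℝ (a m) (dirVec φ) ≤ inner ℝ (a k) (dirVec φ)) (Finset.filter_subset _ _)
            (fun i hi j hj hij => ?_) ω using 2
          · rw [cutSum_eq]
          · rw [Finset.mem_filter] at hi ⊢
            exact ⟨hj, hij.trans hi.2⟩
      _ ≤ _ := hWint
      _ ≤ ENNReal.ofReal (8 * v * ((Finset.range M).filter fun m => φ ∈ S m).card) := by
          refine ENNReal.ofReal_le_ofReal ?_
          rw [mul_assoc]
          gcongr
          refine (Finset.sum_le_card_nsmul _ _ v fun m _ => hv m).trans ?_
          rw [nsmul_eq_mul, mul_comm]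
      _ = _ := by
          rw [ENNReal.ofReal_mul (by positivity), ENNReal.ofReal_natCast]
          congr 1
          simp [Set.indicator_apply]
  refine (lintegral_mono h).trans ?_
  rw [lintegral_const_mul' _ _ ENNReal.ofReal_ne_top, lintegral_finsetSum _ fun m _ =>
    measurable_one.indicator (hS m)]
  gcongr with m
  rw [lintegral_indicator_one (hS m), Measure.restrict_apply (hS m)]

/-- The scores at all points are bounded in probability, at the rate of a single one. -/
theorem measure_exists_norm_score_gt_le (a : ℕ → Plane) (M : ℕ) (ε : ℕ → Ω → ℝ)
    (hm : ∀ m, Measurable (ε m)) (hind : iIndepFun ε P) (h2 : ∀ m, MemLp (ε m) 2 P)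
    (h0 : ∀ m, ∫ ω, ε m ω ∂P = 0) {v : ℝ} (hv : ∀ m, ∫ ω, ε m ω ^ 2 ∂P ≤ v) {η : ℝ}
    (hη : 0 < η) :
    P {ω | ∃ p, η < ‖score a (fun m => ε m ω) M p‖} ≤
      ENNReal.ofReal (1000 * v * M / η ^ 2) := by
  have hv0 : 0 ≤ v := (integral_nonneg fun ω => sq_nonneg (ε 0 ω)).trans (hv 0)
  have hmeas := (measurable_cutEnvelope a (S := fun _ => Set.univ) (fun _ => MeasurableSet.univ)
    M ε hm).lintegral_prod_right' (ν := volume.restrict angles)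
  calc P {ω | ∃ p, η < ‖score a (fun m => ε m ω) M p‖}
      ≤ P {ω | ENNReal.ofReal (η ^ 2) ≤
        19 * ∫⁻ φ in angles, cutEnvelope a (fun _ => Set.univ) M (fun m => ε m ω) φ} := by
        -- The event, with its uncountable quantifier over `p`, need not be measurable. It is
        -- contained in a measurable event about the envelope, to which Markov's inequality applies.
        refine measure_mono ?_
        rintro ω ⟨p, hp⟩
        refine le_trans (ENNReal.ofReal_le_ofReal ?_)
          (ofReal_norm_score_sq_le a (fun m => ε m ω) M p)
        exact pow_le_pow_left₀ hη.le hp.le 2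
    _ ≤ (∫⁻ ω, (19 * ∫⁻ φ in angles,
        cutEnvelope a (fun _ => Set.univ) M (fun m => ε m ω) φ) ∂P)
          / ENNReal.ofReal (η ^ 2) :=
        meas_ge_le_lintegral_div (hmeas.const_mul 19).aemeasurable
          (by simp [hη.ne']) ENNReal.ofReal_ne_top
    _ ≤ ENNReal.ofReal (1000 * v * M) / ENNReal.ofReal (η ^ 2) := by
        refine ENNReal.div_le_div_right ?_ _
        rw [lintegral_const_mul' _ _ (by norm_num)]
        refine (mul_le_mul_right (lintegral_cutEnvelope_le a (fun _ => MeasurableSet.univ) M ε hm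
          hind h2 h0 hv) _).trans ?_
        simp only [Set.univ_inter, volume_angles, Finset.sum_const, Finset.card_range,
          nsmul_eq_mul]
        rw [show (19 : ℝ≥0∞) = ENNReal.ofReal 19 by norm_num, ← ENNReal.ofReal_natCast M,
          ← ENNReal.ofReal_mul (by positivity), ← ENNReal.ofReal_mul (by positivity),
          ← ENNReal.ofReal_mul (by positivity)]
        refine ENNReal.ofReal_le_ofReal ?_
        -- The constant is `19 * 8 * 2 * π < 1000`.
        have := Real.pi_lt_d2
        have hvM : 0 ≤ v * M := by positivity
        nlinarith
    _ = _ := by rw [ENNReal.ofReal_div_of_pos (by positivity)]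

theorem measurableSet_slabAngles (v : Plane) (κ : ℝ) : MeasurableSet (slabAngles v κ) :=
  measurableSet_le ((Continuous.inner (𝕜 := ℝ) (continuous_const (y := v))
    continuous_dirVec).measurable.abs) measurable_const

/-- Stochastic equicontinuity of the score. -/
theorem measure_exists_norm_score_sub_gt_le (a : ℕ → Plane) (M : ℕ) (ε : ℕ → Ω → ℝ)
    (hm : ∀ m, Measurable (ε m)) (hind : iIndepFun ε P) (h2 : ∀ m, MemLp (ε m) 2 P)
    (h0 : ∀ m, ∫ ω, ε m ω ∂P = 0) {v : ℝ} (hv : ∀ m, ∫ ω, ε m ω ^ 2 ∂P ≤ v) (p₀ : Plane)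
    {κ : ℝ} (hκ : 0 < κ) {η : ℝ} (hη : 0 < η) :
    P {ω | ∃ p q, ‖p - p₀‖ ≤ κ ∧ ‖q - p₀‖ ≤ κ ∧
        η < ‖score a (fun m => ε m ω) M p - score a (fun m => ε m ω) M q‖} ≤
      ENNReal.ofReal (2000 * v * (∑ m ∈ Finset.range M, κ / (κ + ‖a m - p₀‖)) / η ^ 2) := by
  have hv0 : 0 ≤ v := (integral_nonneg fun ω => sq_nonneg (ε 0 ω)).trans (hv 0)
  set S : ℕ → Set ℝ := fun m => slabAngles (a m - p₀) κ
  have hS : ∀ m, MeasurableSet (S m) := fun m => measurableSet_slabAngles _ _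
  have hmeas := (measurable_cutEnvelope a hS
    M ε hm).lintegral_prod_right' (ν := volume.restrict angles)
  calc P {ω | ∃ p q, ‖p - p₀‖ ≤ κ ∧ ‖q - p₀‖ ≤ κ ∧
        η < ‖score a (fun m => ε m ω) M p - score a (fun m => ε m ω) M q‖}
      ≤ P {ω | ENNReal.ofReal (η ^ 2) ≤
        19 * ∫⁻ φ in angles, cutEnvelope a S M (fun m => ε m ω) φ} := by
        refine measure_mono ?_
        rintro ω ⟨p, q, hp, hq, hpq⟩
        refine le_trans (ENNReal.ofReal_le_ofReal ?_)
          (ofReal_norm_score_sub_score_sq_le a (fun m => ε m ω) M hp hq)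
        exact pow_le_pow_left₀ hη.le hpq.le 2
    _ ≤ (∫⁻ ω, (19 * ∫⁻ φ in angles, cutEnvelope a S M (fun m => ε m ω) φ) ∂P)
          / ENNReal.ofReal (η ^ 2) :=
        meas_ge_le_lintegral_div (hmeas.const_mul 19).aemeasurable
          (by simp [hη.ne']) ENNReal.ofReal_ne_top
    _ ≤ ENNReal.ofReal (2000 * v * ∑ m ∈ Finset.range M, κ / (κ + ‖a m - p₀‖))
          / ENNReal.ofReal (η ^ 2) := by
        refine ENNReal.div_le_div_right ?_ _
        rw [lintegral_const_mul' _ _ (by norm_num)]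
        refine (mul_le_mul_right (lintegral_cutEnvelope_le a hS M ε hm
          hind h2 h0 hv) _).trans ?_
        refine (mul_le_mul_right (mul_le_mul_right (Finset.sum_le_sum fun m _ =>
          volume_abs_inner_dirVec_le (a m - p₀) hκ) _) _).trans ?_
        rw [← ENNReal.ofReal_sum_of_nonneg fun m _ => by positivity,
          show (19 : ℝ≥0∞) = ENNReal.ofReal 19 by norm_num,
          ← ENNReal.ofReal_mul (by positivity), ← ENNReal.ofReal_mul (by positivity),
          ← Finset.mul_sum]
        refine ENNReal.ofReal_le_ofReal ?_
        -- The constant is `19 * 8 * 4 * π < 2000`.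
        have := Real.pi_lt_d2
        have hvM : 0 ≤ v * ∑ m ∈ Finset.range M, κ / (κ + ‖a m - p₀‖) := by positivity
        nlinarith
    _ = _ := by rw [ENNReal.ofReal_div_of_pos (by positivity)]

end Probability

/-! ### Consequences of the weak convergence of the anchors -/

theorem tendsto_average_of_tendsto_empirical {a : ℕ → Plane} {μ : ProbabilityMeasure Plane}
    (hμ : Tendsto (empirical a) atTop (𝓝 μ)) (f : BoundedContinuousFunction Plane ℝ) :
    Tendsto (fun M : ℕ => (M : ℝ)⁻¹ * ∑ m ∈ Finset.range M, f (a m)) atTop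
      (𝓝 (∫ x, f x ∂(μ : Measure Plane))) := by
  -- The measure `empirical a M` averages `M + 1` points.
  rw [← tendsto_add_atTop_iff_nat 1]
  refine ((ProbabilityMeasure.tendsto_iff_forall_integral_tendsto.1 hμ) f).congr fun M => ?_
  change ∫ x, f x ∂(empiricalMeasure a M) = _
  rw [empiricalMeasure, integral_smul_measure, integral_finsetSum_measure fun m _ =>
    integrable_dirac (by simp [enorm])]
  simp only [integral_dirac, ENNReal.toReal_inv, ENNReal.toReal_natCast, smul_eq_mul]

theorem continuous_div_add_norm {κ : ℝ} (hκ : 0 < κ) (p : Plane) :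
    Continuous fun x : Plane => κ / (κ + ‖x - p‖) := by
  refine continuous_const.div (by fun_prop) fun x => ?_
  positivity

/-- Few points are close to a point that is not an atom of the limit of the empirical
distributions. -/
theorem exists_eventually_sum_div_le {a : ℕ → Plane} {μ : ProbabilityMeasure Plane}
    (hμ : Tendsto (empirical a) atTop (𝓝 μ)) {p : Plane} (hp : (μ : Measure Plane) {p} = 0)
    {η : ℝ} (hη : 0 < η) :
    ∃ κ > 0, ∀ᶠ M : ℕ in atTop, ∑ m ∈ Finset.range M, κ / (κ + ‖a m - p‖) ≤ η * M := by
  have hκ : ∀ k : ℕ, (0 : ℝ) < 1 / (k + 1) := fun k => by positivity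
  have hlim : Tendsto (fun k : ℕ => ∫ x, (1 / (k + 1) : ℝ) / (1 / (k + 1) + ‖x - p‖)
      ∂(μ : Measure Plane)) atTop (𝓝 (∫ _, (0 : ℝ) ∂(μ : Measure Plane))) := by
    refine tendsto_integral_of_dominated_convergence (fun _ => 1)
      (fun k => (continuous_div_add_norm (hκ k) p).aestronglyMeasurable) (integrable_const _)
      (fun k => ae_of_all _ fun x => ?_) ?_
    · have := hκ k
      rw [Real.norm_of_nonneg (by positivity), div_le_one (by positivity)]
      linarith [norm_nonneg (x - p)]
    · have hae : ∀ᵐ x ∂(μ : Measure Plane), x ≠ p := by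
        rw [ae_iff]; simpa using hp
      filter_upwards [hae] with x hx
      have hx' : ‖x - p‖ ≠ 0 := norm_ne_zero_iff.2 (sub_ne_zero.2 hx)
      have h1 := tendsto_one_div_add_atTop_nhds_zero_nat (𝕜 := ℝ)
      have h2 := h1.div (h1.add_const ‖x - p‖) (by simpa using hx')
      rw [zero_div] at h2
      exact h2
  rw [integral_zero] at hlim
  -- For `κ = 1 / (k + 1)` the ratio tends to the indicator of `p`, so its integral tends to the
  -- mass of `p`, which is zero. One such `κ` is fixed before `M` grows.
  obtain ⟨k, hk⟩ := (hlim.eventually (gt_mem_nhds hη)).exists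
  refine ⟨1 / (k + 1), hκ k, ?_⟩
  have h3 := tendsto_average_of_tendsto_empirical hμ
    (BoundedContinuousFunction.ofNormedAddCommGroup _ (continuous_div_add_norm (hκ k) p) 1
      fun x => by
        have := hκ k
        rw [Real.norm_of_nonneg (by positivity), div_le_one (by positivity)]
        linarith [norm_nonneg (x - p)])
  filter_upwards [h3.eventually (gt_mem_nhds hk), eventually_gt_atTop 0] with M hM hM0
  have hM' : (0 : ℝ) < M := by exact_mod_cast hM0
  rw [inv_mul_lt_iff₀ hM'] at hM
  simp only [BoundedContinuousFunction.coe_ofNormedAddCommGroup] at hM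
  linarith

/-- A tent function below the indicator of the ball has positive integral, since `b` lies in the
support; its averages converge. -/
theorem exists_eventually_le_card_ball {a : ℕ → Plane} {μ : ProbabilityMeasure Plane}
    (hμ : Tendsto (empirical a) atTop (𝓝 μ)) {b : Plane} (hb : b ∈ (μ : Measure Plane).support)
    {τ : ℝ} (hτ : 0 < τ) :
    ∃ c > 0, ∀ᶠ M : ℕ in atTop,
      c * M ≤ (((Finset.range M).filter fun m => ‖a m - b‖ ≤ τ).card : ℝ) := by
  set f : Plane → ℝ := fun x => max 0 (1 - ‖x - b‖ / τ) with hf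
  have hfc : Continuous f := by fun_prop
  have hf0 : ∀ x, 0 ≤ f x := fun x => le_max_left _ _
  have hf1 : ∀ x, f x ≤ 1 := fun x => max_le zero_le_one (by
    have : 0 ≤ ‖x - b‖ / τ := by positivity
    linarith)
  have hfb : ∀ x, ‖f x‖ ≤ 1 := fun x => by rw [Real.norm_of_nonneg (hf0 x)]; exact hf1 x
  have hpos : 0 < ∫ x, f x ∂(μ : Measure Plane) := by
    rw [integral_pos_iff_support_of_nonneg hf0 (Integrable.of_bound hfc.aestronglyMeasurable 1
      (ae_of_all _ hfb))]
    refine (Measure.mem_support_iff_forall _).1 hb _ ?_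
    refine hfc.isOpen_support.mem_nhds ?_
    simp [hf]
  refine ⟨(∫ x, f x ∂(μ : Measure Plane)) / 2, by positivity, ?_⟩
  have h3 := tendsto_average_of_tendsto_empirical hμ
    (BoundedContinuousFunction.ofNormedAddCommGroup f hfc 1 hfb)
  filter_upwards [h3.eventually (lt_mem_nhds (half_lt_self hpos)), eventually_gt_atTop 0]
    with M hM hM0
  have hM' : (0 : ℝ) < M := by exact_mod_cast hM0
  rw [lt_inv_mul_iff₀ hM'] at hM
  simp only [BoundedContinuousFunction.coe_ofNormedAddCommGroup] at hM
  have h4 : ∑ m ∈ Finset.range M, f (a m) ≤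
      (((Finset.range M).filter fun m => ‖a m - b‖ ≤ τ).card : ℝ) := by
    rw [Finset.card_eq_sum_ones, Nat.cast_sum, Finset.sum_filter]
    refine Finset.sum_le_sum fun m _ => ?_
    split_ifs with h
    · simpa using hf1 (a m)
    · refine max_le le_rfl ?_
      have : 1 ≤ ‖a m - b‖ / τ := by rw [one_le_div hτ]; exact (not_le.1 h).le
      linarith
  linarith

/-- The determinant of two vectors of the plane. -/
def planeDet (u v : Plane) : ℝ := u 0 * v 1 - u 1 * v 0

theorem mem_span_singleton_of_planeDet_eq_zero {u v : Plane} (hu : u ≠ 0)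
    (h : planeDet u v = 0) : v ∈ Submodule.span ℝ {u} := by
  rw [Submodule.mem_span_singleton]
  unfold planeDet at h
  by_cases h0 : u 0 = 0
  · have h1 : u 1 ≠ 0 := by
      intro h1
      refine hu ?_
      ext k
      fin_cases k
      · exact h0
      · exact h1
    refine ⟨v 1 / u 1, ?_⟩
    ext k
    fin_cases k
    · have : v 0 = 0 := by
        rw [h0] at h
        have : u 1 * v 0 = 0 := by linarith
        exact (mul_eq_zero.1 this).resolve_left h1
      simp [h0, this]
    · simp [div_mul_cancel₀ _ h1]
  · refine ⟨v 0 / u 0, ?_⟩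
    ext k
    fin_cases k
    · simp [div_mul_cancel₀ _ h0]
    · simp
      field_simp
      linarith

/-- The support has full measure, so by hypothesis it is contained in no line. -/
theorem exists_support_planeDet_ne_zero {μ : ProbabilityMeasure Plane}
    (hline : ∀ L : AffineSubspace ℝ Plane, Module.finrank ℝ L.direction = 1 →
      (μ : Measure Plane) (L : Set Plane) ≠ 1) :
    ∃ b₀ ∈ (μ : Measure Plane).support, ∃ b₁ ∈ (μ : Measure Plane).support,
      ∃ b₂ ∈ (μ : Measure Plane).support, planeDet (b₁ - b₀) (b₂ - b₀) ≠ 0 := by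
  obtain ⟨b₀, hb₀⟩ := Measure.nonempty_support (μ := (μ : Measure Plane))
    (IsProbabilityMeasure.ne_zero _)
  have key : ∀ u : Plane, u ≠ 0 → ∃ b ∈ (μ : Measure Plane).support,
      b - b₀ ∉ Submodule.span ℝ {u} := by
    intro u hu
    by_contra! hcon
    refine hline (AffineSubspace.mk' b₀ (Submodule.span ℝ {u})) ?_ ?_
    · rw [AffineSubspace.direction_mk', finrank_span_singleton hu]
    · have hsub : (μ : Measure Plane).support ⊆
          (AffineSubspace.mk' b₀ (Submodule.span ℝ {u}) : Set Plane) := by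
        intro b hb
        have := hcon b hb
        simpa [AffineSubspace.mem_mk'] using this
      have h1 : ∀ᵐ x ∂(μ : Measure Plane),
          x ∈ (AffineSubspace.mk' b₀ (Submodule.span ℝ {u}) : Set Plane) :=
        Filter.mem_of_superset Measure.support_mem_ae hsub
      rw [measure_eq_measure_of_null_sdiff (Set.subset_univ _) ?_, measure_univ]
      rw [← Set.compl_eq_univ_sdiff]
      exact h1
  -- Any nonzero vector would do here: the point is only to obtain `b₁ ≠ b₀`.
  obtain ⟨b₁, hb₁, h1⟩ := key (dirVec 0) (by rw [← norm_ne_zero_iff, norm_dirVec]; exact one_ne_zero)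
  have hne : b₁ - b₀ ≠ 0 := fun h => h1 (h ▸ zero_mem _)
  obtain ⟨b₂, hb₂, h2⟩ := key _ hne
  exact ⟨b₀, hb₀, b₁, hb₁, b₂, hb₂, fun h => h2 (mem_span_singleton_of_planeDet_eq_zero hne h)⟩

/-- Cramer's rule recovers `ℓ` from its inner products with `u` and `v`, so both cannot be small
relative to `‖ℓ‖`. -/
theorem exists_le_abs_inner_of_planeDet_ne_zero {u v : Plane} (h : planeDet u v ≠ 0) :
    ∃ κ > 0, ∀ ℓ : Plane, κ * ‖ℓ‖ ≤ |inner ℝ u ℓ| ∨ κ * ‖ℓ‖ ≤ |inner ℝ v ℓ| := by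
  set C : ℝ := |u 0| + |u 1| + |v 0| + |v 1| + 1 with hC
  have hC0 : 0 < C := by positivity
  have hD : 0 < |planeDet u v| := abs_pos.2 h
  refine ⟨|planeDet u v| / C, by positivity, fun ℓ => ?_⟩
  by_contra! hcon
  set X := inner ℝ u ℓ
  set Y := inner ℝ v ℓ
  have hl : ‖ℓ‖ ≤ |ℓ 0| + |ℓ 1| := by
    refine abs_le_of_sq_le_sq' ?_ (by positivity) |>.2
    rw [norm_sq_plane, ← sq_abs (ℓ 0), ← sq_abs (ℓ 1)]
    nlinarith [abs_nonneg (ℓ 0), abs_nonneg (ℓ 1)]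
  have e0 : planeDet u v * ℓ 0 = v 1 * X - u 1 * Y := by
    simp only [X, Y, inner_plane, planeDet]; ring
  have e1 : planeDet u v * ℓ 1 = u 0 * Y - v 0 * X := by
    simp only [X, Y, inner_plane, planeDet]; ring
  have a0 : |planeDet u v| * |ℓ 0| ≤ |v 1| * |X| + |u 1| * |Y| := by
    rw [← abs_mul, e0, ← abs_mul, ← abs_mul]; exact abs_sub _ _
  have a1 : |planeDet u v| * |ℓ 1| ≤ |u 0| * |Y| + |v 0| * |X| := by
    rw [← abs_mul, e1, ← abs_mul, ← abs_mul]; exact abs_sub _ _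
  set T := |planeDet u v| / C * ‖ℓ‖ with hT
  have hT0 : 0 < T := (abs_nonneg X).trans_lt hcon.1
  have hCT : C * T = |planeDet u v| * ‖ℓ‖ := by rw [hT]; field_simp
  have b0 := mul_le_mul_of_nonneg_left hcon.1.le (abs_nonneg (v 1))
  have b1 := mul_le_mul_of_nonneg_left hcon.1.le (abs_nonneg (v 0))
  have b2 := mul_le_mul_of_nonneg_left hcon.2.le (abs_nonneg (u 1))
  have b3 := mul_le_mul_of_nonneg_left hcon.2.le (abs_nonneg (u 0))
  have b4 := mul_le_mul_of_nonneg_left hl hD.le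
  rw [hC] at hCT
  nlinarith

/-- A positive fraction of the points stays away from any given line. -/
theorem exists_eventually_le_card_off_line {a : ℕ → Plane} {μ : ProbabilityMeasure Plane}
    (hμ : Tendsto (empirical a) atTop (𝓝 μ))
    (hline : ∀ L : AffineSubspace ℝ Plane, Module.finrank ℝ L.direction = 1 →
      (μ : Measure Plane) (L : Set Plane) ≠ 1) :
    ∃ τ > 0, ∃ K > 0, ∃ c > 0, ∀ᶠ M : ℕ in atTop, ∀ (ℓ : Plane) (d : ℝ),
      c * M ≤ (((Finset.range M).filter fun m =>
        ‖a m‖ ≤ K ∧ τ * ‖ℓ‖ ≤ |inner ℝ (a m) ℓ - d|).card : ℝ) := by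
  obtain ⟨b₀, hb₀, b₁, hb₁, b₂, hb₂, hdet⟩ := exists_support_planeDet_ne_zero hline
  obtain ⟨κ, hκ, hκℓ⟩ := exists_le_abs_inner_of_planeDet_ne_zero hdet
  obtain ⟨c₀, hc₀, h₀⟩ := exists_eventually_le_card_ball hμ hb₀ (τ := κ / 4) (by positivity)
  obtain ⟨c₁, hc₁, h₁⟩ := exists_eventually_le_card_ball hμ hb₁ (τ := κ / 4) (by positivity)
  obtain ⟨c₂, hc₂, h₂⟩ := exists_eventually_le_card_ball hμ hb₂ (τ := κ / 4) (by positivity)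
  set K := ‖b₀‖ + ‖b₁‖ + ‖b₂‖ + κ / 4
  refine ⟨κ / 4, by positivity, K, by positivity, min c₀ (min c₁ c₂), by positivity, ?_⟩
  filter_upwards [h₀, h₁, h₂] with M h₀ h₁ h₂ ℓ d
  have main : ∀ b : Plane, ∀ c : ℝ, ‖b‖ + κ / 4 ≤ K → κ / 2 * ‖ℓ‖ ≤ |inner ℝ b ℓ - d| →
      c * M ≤ (((Finset.range M).filter fun m => ‖a m - b‖ ≤ κ / 4).card : ℝ) →
      min c₀ (min c₁ c₂) ≤ c →
      min c₀ (min c₁ c₂) * M ≤ (((Finset.range M).filter fun m =>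
        ‖a m‖ ≤ K ∧ κ / 4 * ‖ℓ‖ ≤ |inner ℝ (a m) ℓ - d|).card : ℝ) := by
    intro b c hbK hb hc hmin
    refine (mul_le_mul_of_nonneg_right hmin (Nat.cast_nonneg M)).trans (hc.trans ?_)
    refine Nat.cast_le.2 (Finset.card_le_card fun m hm => ?_)
    rw [Finset.mem_filter] at hm ⊢
    refine ⟨hm.1, ?_, ?_⟩
    · have : ‖a m‖ ≤ ‖b‖ + ‖a m - b‖ := by
        simpa using norm_add_le b (a m - b)
      linarith [hm.2]
    · have h5 : |inner ℝ (a m - b) ℓ| ≤ κ / 4 * ‖ℓ‖ :=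
        (abs_real_inner_le_norm _ _).trans (mul_le_mul_of_nonneg_right hm.2 (norm_nonneg _))
      have h6 : inner ℝ b ℓ - d = (inner ℝ (a m) ℓ - d) - inner ℝ (a m - b) ℓ := by
        rw [inner_sub_left]; ring
      rw [h6] at hb
      have := abs_sub (inner ℝ (a m) ℓ - d) (inner ℝ (a m - b) ℓ)
      linarith
  have n₀ := norm_nonneg b₀
  have n₁ := norm_nonneg b₁
  have n₂ := norm_nonneg b₂
  -- Two values that differ by `κ * ‖ℓ‖` cannot both be within `κ / 2 * ‖ℓ‖` of `d`. Anchors within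
  -- `κ / 4` of the better support point keep the remaining `κ / 4`.
  have split : ∀ b : Plane, κ * ‖ℓ‖ ≤ |inner ℝ (b - b₀) ℓ| →
      κ / 2 * ‖ℓ‖ ≤ |inner ℝ b ℓ - d| ∨ κ / 2 * ‖ℓ‖ ≤ |inner ℝ b₀ ℓ - d| := by
    intro b hb
    by_contra! hcon
    have h6 : inner ℝ (b - b₀) ℓ = (inner ℝ b ℓ - d) - (inner ℝ b₀ ℓ - d) := by
      rw [inner_sub_left]; ring
    rw [h6] at hb
    have := abs_sub (inner ℝ b ℓ - d) (inner ℝ b₀ ℓ - d)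
    linarith [hcon.1, hcon.2]
  have m₀ : min c₀ (min c₁ c₂) ≤ c₀ := min_le_left _ _
  have m₁ : min c₀ (min c₁ c₂) ≤ c₁ := (min_le_right _ _).trans (min_le_left _ _)
  have m₂ : min c₀ (min c₁ c₂) ≤ c₂ := (min_le_right _ _).trans (min_le_right _ _)
  rcases hκℓ ℓ with h | h
  · rcases split b₁ h with h | h
    · exact main b₁ c₁ (by simp only [K]; linarith) h h₁ m₁
    · exact main b₀ c₀ (by simp only [K]; linarith) h h₀ m₀
  · rcases split b₂ h with h | h
    · exact main b₂ c₂ (by simp only [K]; linarith) h h₂ m₂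
    · exact main b₀ c₀ (by simp only [K]; linarith) h h₀ m₀

theorem mul_le_sum_of_card {M : ℕ} {q : ℕ → Prop} [DecidablePred q] {c y : ℝ} {f : ℕ → ℝ}
    (hc : c * M ≤ (((Finset.range M).filter q).card : ℝ)) (hy : 0 ≤ y) (hf : ∀ m, 0 ≤ f m)
    (hq : ∀ m, q m → y ≤ f m) : c * M * y ≤ ∑ m ∈ Finset.range M, f m := by
  calc c * M * y ≤ ((Finset.range M).filter q).card * y := mul_le_mul_of_nonneg_right hc hy
    _ = ((Finset.range M).filter q).card • y := by rw [nsmul_eq_mul]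
    _ ≤ ∑ m ∈ (Finset.range M).filter q, f m :=
        Finset.card_nsmul_le_sum _ _ _ fun m hm => hq m (Finset.mem_filter.1 hm).2
    _ ≤ _ := Finset.sum_le_sum_of_subset_of_nonneg (Finset.filter_subset _ _) fun m _ _ => hf m

/-- Multiplied by the sum of the two distances, the range difference is affine in the anchor and
vanishes on the perpendicular bisector of `p` and `p₀`, which a fraction of the anchors avoids. The
bound is global in `p`, which is what makes consistency automatic. -/
theorem exists_eventually_le_sum_sq_norm_sub_norm {a : ℕ → Plane} {μ : ProbabilityMeasure Plane}
    (hμ : Tendsto (empirical a) atTop (𝓝 μ))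
    (hline : ∀ L : AffineSubspace ℝ Plane, Module.finrank ℝ L.direction = 1 →
      (μ : Measure Plane) (L : Set Plane) ≠ 1) (p₀ : Plane) :
    ∃ c > 0, ∀ᶠ M : ℕ in atTop, ∀ p : Plane,
      c * M * ‖p - p₀‖ ^ 2 ≤ ∑ m ∈ Finset.range M, (‖a m - p‖ - ‖a m - p₀‖) ^ 2 := by
  obtain ⟨τ, hτ, K, hK, c, hc, hM⟩ := exists_eventually_le_card_off_line hμ hline
  set K' := K + ‖p₀‖ with hK'
  have hK'0 : 0 < K' := by positivity
  -- If `‖p - p₀‖ ≥ 4 * K'`, the triangle inequality gives the factor `1 / 2`. Otherwise the sum of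
  -- the distances is at most `6 * K'`, and the bisector identity gives `2 * τ / (6 * K')`.
  set θ := min (1 / 2) (τ / (3 * K')) with hθ
  have hθ0 : 0 < θ := by positivity
  refine ⟨c * θ ^ 2, by positivity, ?_⟩
  filter_upwards [hM] with M hM p
  have h1 := hM (p - p₀) ((‖p‖ ^ 2 - ‖p₀‖ ^ 2) / 2)
  have h2 := mul_le_sum_of_card h1 (y := (θ * ‖p - p₀‖) ^ 2)
    (f := fun m => (‖a m - p‖ - ‖a m - p₀‖) ^ 2) (sq_nonneg _) (fun m => sq_nonneg _) ?_
  · calc c * θ ^ 2 * M * ‖p - p₀‖ ^ 2 = c * M * (θ * ‖p - p₀‖) ^ 2 := by ring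
      _ ≤ _ := h2
  rintro m ⟨hmK, hmτ⟩
  rw [sq_le_sq, abs_of_nonneg (by positivity)]
  have hb0 : ‖a m - p₀‖ ≤ K' := (norm_sub_le _ _).trans (by linarith)
  have hb1 : ‖a m - p‖ ≤ ‖a m - p₀‖ + ‖p - p₀‖ := by
    have := norm_sub_le (a m - p₀) (p - p₀)
    simpa using this
  have hb2 : ‖p - p₀‖ ≤ ‖a m - p‖ + ‖a m - p₀‖ := by
    have := norm_sub_le (a m - p₀) (a m - p)
    simp only [sub_sub_sub_cancel_left] at this
    linarith
  rcases le_or_gt (4 * K') ‖p - p₀‖ with hfar | hnear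
  · have : θ ≤ 1 / 2 := min_le_left _ _
    have h3 : θ * ‖p - p₀‖ ≤ 1 / 2 * ‖p - p₀‖ := by gcongr
    have h4 := le_abs_self (‖a m - p‖ - ‖a m - p₀‖)
    linarith
  · have e : (‖a m - p‖ - ‖a m - p₀‖) * (‖a m - p‖ + ‖a m - p₀‖) =
        -2 * (inner ℝ (a m) (p - p₀) - (‖p‖ ^ 2 - ‖p₀‖ ^ 2) / 2) := by
      have e1 := norm_sub_sq_real (a m) p
      have e2 := norm_sub_sq_real (a m) p₀
      rw [inner_sub_right]
      linear_combination e1 - e2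
    have h3 : |‖a m - p‖ - ‖a m - p₀‖| * (‖a m - p‖ + ‖a m - p₀‖) =
        2 * |inner ℝ (a m) (p - p₀) - (‖p‖ ^ 2 - ‖p₀‖ ^ 2) / 2| := by
      rw [← abs_of_nonneg (show 0 ≤ ‖a m - p‖ + ‖a m - p₀‖ by positivity), ← abs_mul, e, abs_mul]
      simp
    have h4 : θ ≤ τ / (3 * K') := min_le_right _ _
    have h5 : θ * (3 * K') ≤ τ := by rwa [le_div_iff₀ (by positivity)] at h4
    have h6 : 2 * (τ * ‖p - p₀‖) ≤ |‖a m - p‖ - ‖a m - p₀‖| * (6 * K') := by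
      calc 2 * (τ * ‖p - p₀‖) ≤ |‖a m - p‖ - ‖a m - p₀‖| * (‖a m - p‖ + ‖a m - p₀‖) := by
            rw [h3]; linarith
        _ ≤ _ := by
            refine mul_le_mul_of_nonneg_left (by linarith) (abs_nonneg _)
    have h7 := mul_le_mul_of_nonneg_right h5 (norm_nonneg (p - p₀))
    nlinarith

/-- Apply the line estimate to the line through `p` orthogonal to `ℓ`: bounded anchors away from it
see a displacement along `ℓ`. -/
theorem exists_eventually_le_sum_sq_inner_unitVec {a : ℕ → Plane} {μ : ProbabilityMeasure Plane}
    (hμ : Tendsto (empirical a) atTop (𝓝 μ))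
    (hline : ∀ L : AffineSubspace ℝ Plane, Module.finrank ℝ L.direction = 1 →
      (μ : Measure Plane) (L : Set Plane) ≠ 1) (p₀ : Plane) :
    ∃ c > 0, ∀ᶠ M : ℕ in atTop, ∀ p ℓ : Plane, ‖p - p₀‖ ≤ 1 →
      c * M * ‖ℓ‖ ^ 2 ≤ ∑ m ∈ Finset.range M, inner ℝ (unitVec (a m - p)) ℓ ^ 2 := by
  obtain ⟨τ, hτ, K, hK, c, hc, hM⟩ := exists_eventually_le_card_off_line hμ hline
  set K' := K + ‖p₀‖ + 1 with hK'
  have hK'0 : 0 < K' := by positivity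
  refine ⟨c * (τ / K') ^ 2, by positivity, ?_⟩
  filter_upwards [hM] with M hM p ℓ hp
  have h1 := hM ℓ (inner ℝ p ℓ)
  have h2 := mul_le_sum_of_card h1 (y := (τ / K' * ‖ℓ‖) ^ 2)
    (f := fun m => inner ℝ (unitVec (a m - p)) ℓ ^ 2) (sq_nonneg _) (fun m => sq_nonneg _) ?_
  · calc c * (τ / K') ^ 2 * M * ‖ℓ‖ ^ 2 = c * M * (τ / K' * ‖ℓ‖) ^ 2 := by ring
      _ ≤ _ := h2
  rintro m ⟨hmK, hmτ⟩
  rw [sq_le_sq, abs_of_nonneg (by positivity)]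
  have hb : ‖a m - p‖ ≤ K' := by
    have h3 : ‖a m - p‖ ≤ ‖a m‖ + ‖p₀‖ + ‖p - p₀‖ := by
      calc ‖a m - p‖ = ‖a m - p₀ - (p - p₀)‖ := by congr 1; abel
        _ ≤ _ := (norm_sub_le _ _).trans (by linarith [norm_sub_le (a m) p₀])
    linarith
  rw [← inner_sub_left, ← norm_smul_unitVec (a m - p), real_inner_smul_left, abs_mul,
    abs_norm] at hmτ
  rw [div_mul_eq_mul_div, div_le_iff₀ hK'0]
  nlinarith [abs_nonneg (inner ℝ (unitVec (a m - p)) ℓ)]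

/-! ### Rotations and displacements of the pose -/

/-- The vector `s`, rotated by `θ`. -/
def rotVec (θ : ℝ) (s : Plane) : Plane := WithLp.toLp 2 (rot θ *ᵥ s.ofLp)

/-- The derivative of `rotVec` with respect to the angle. -/
def rotVecDeriv (θ : ℝ) (s : Plane) : Plane :=
  WithLp.toLp 2 ((rot θ * !![0, -1; 1, 0]) *ᵥ s.ofLp)

theorem tagPosition_rot (θ : ℝ) (t s : Plane) : tagPosition (rot θ) t s = rotVec θ s + t := rfl

theorem rotVec_zero_apply (θ : ℝ) (s : Plane) :
    rotVec θ s 0 = Real.cos θ * s 0 - Real.sin θ * s 1 := by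
  simp [rotVec, rot, dotProduct, Fin.sum_univ_two]
  ring

theorem rotVec_one_apply (θ : ℝ) (s : Plane) :
    rotVec θ s 1 = Real.sin θ * s 0 + Real.cos θ * s 1 := by
  simp [rotVec, rot, dotProduct, Fin.sum_univ_two]

theorem rotVecDeriv_zero_apply (θ : ℝ) (s : Plane) :
    rotVecDeriv θ s 0 = -Real.sin θ * s 0 - Real.cos θ * s 1 := by
  simp [rotVecDeriv, rot, dotProduct, Fin.sum_univ_two]
  ring

theorem rotVecDeriv_one_apply (θ : ℝ) (s : Plane) :
    rotVecDeriv θ s 1 = Real.cos θ * s 0 - Real.sin θ * s 1 := by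
  simp [rotVecDeriv, rot, dotProduct, Fin.sum_univ_two]
  ring

theorem rotVec_sub (θ : ℝ) (s s' : Plane) : rotVec θ (s - s') = rotVec θ s - rotVec θ s' := by
  rw [rotVec, WithLp.ofLp_sub, Matrix.mulVec_sub, WithLp.toLp_sub]
  rfl

theorem rotVecDeriv_sub (θ : ℝ) (s s' : Plane) :
    rotVecDeriv θ (s - s') = rotVecDeriv θ s - rotVecDeriv θ s' := by
  rw [rotVecDeriv, WithLp.ofLp_sub, Matrix.mulVec_sub, WithLp.toLp_sub]
  rfl

theorem norm_rotVecDeriv (θ : ℝ) (s : Plane) : ‖rotVecDeriv θ s‖ = ‖s‖ := by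
  rw [← sq_eq_sq₀ (norm_nonneg _) (norm_nonneg _), norm_sq_plane, norm_sq_plane,
    rotVecDeriv_zero_apply, rotVecDeriv_one_apply]
  linear_combination (s 0 ^ 2 + s 1 ^ 2) * Real.sin_sq_add_cos_sq θ

theorem norm_sq_rotVec_add_sub (θ α : ℝ) (s : Plane) :
    ‖rotVec (θ + α) s - rotVec θ s‖ ^ 2 = (2 - 2 * Real.cos α) * ‖s‖ ^ 2 := by
  rw [norm_sq_plane, norm_sq_plane]
  simp only [PiLp.sub_apply, rotVec_zero_apply, rotVec_one_apply, Real.cos_add, Real.sin_add]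
  have h1 := Real.sin_sq_add_cos_sq θ
  have h2 := Real.sin_sq_add_cos_sq α
  linear_combination (s 0 ^ 2 + s 1 ^ 2) *
    ((Real.sin α ^ 2 + Real.cos α ^ 2 - 2 * Real.cos α + 1) * h1 + h2)

theorem norm_rotVec_add_sub_le (θ α : ℝ) (s : Plane) :
    ‖rotVec (θ + α) s - rotVec θ s‖ ≤ |α| * ‖s‖ := by
  refine abs_le_of_sq_le_sq' ?_ (by positivity) |>.2
  rw [norm_sq_rotVec_add_sub, mul_pow, sq_abs]
  have := Real.one_sub_sq_div_two_le_cos (x := α)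
  gcongr
  linarith

/-- A chord is comparable to its arc up to half a turn; this is why rotations are written with a
relative angle in `[-π, π]`. -/
theorem le_norm_rotVec_add_sub (θ : ℝ) {α : ℝ} (hα : |α| ≤ Real.pi) (s : Plane) :
    |α| * ‖s‖ ≤ 2 * ‖rotVec (θ + α) s - rotVec θ s‖ := by
  refine abs_le_of_sq_le_sq' ?_ (by positivity) |>.2
  rw [mul_pow, mul_pow, norm_sq_rotVec_add_sub, sq_abs, ← mul_assoc]
  have h := Real.cos_le_one_sub_mul_cos_sq hα
  have hpi := Real.pi_pos
  have h4 := Real.pi_le_four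
  have h5 : (1 : ℝ) / 8 ≤ 2 / Real.pi ^ 2 := by
    rw [div_le_div_iff₀ (by norm_num) (by positivity)]
    nlinarith
  gcongr
  nlinarith [sq_nonneg α]

theorem norm_rotVec_linearization_le (θ : ℝ) {α : ℝ} (hα : |α| ≤ 1) (s : Plane) :
    ‖rotVec (θ + α) s - rotVec θ s - α • rotVecDeriv θ s‖ ≤ α ^ 2 * ‖s‖ := by
  refine abs_le_of_sq_le_sq' ?_ (by positivity) |>.2
  have e : ‖rotVec (θ + α) s - rotVec θ s - α • rotVecDeriv θ s‖ ^ 2 =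
      ((1 - Real.cos α) ^ 2 + (α - Real.sin α) ^ 2) * ‖s‖ ^ 2 := by
    rw [norm_sq_plane, norm_sq_plane]
    simp only [PiLp.sub_apply, PiLp.smul_apply, smul_eq_mul, rotVec_zero_apply, rotVec_one_apply,
      rotVecDeriv_zero_apply, rotVecDeriv_one_apply, Real.cos_add, Real.sin_add]
    have h1 := Real.sin_sq_add_cos_sq θ
    linear_combination (s 0 ^ 2 + s 1 ^ 2) *
      ((1 - Real.cos α) ^ 2 + (α - Real.sin α) ^ 2) * h1
  rw [e, mul_pow]
  have h2 := Real.one_sub_sq_div_two_le_cos (x := α)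
  have h3 := Real.cos_le_one α
  have h4 := Real.abs_sub_sin_le α
  have h5 : |α| ^ 3 / 6 ≤ α ^ 2 / 6 := by
    rw [← sq_abs α]
    have := abs_nonneg α
    nlinarith [mul_le_mul_of_nonneg_left hα (sq_nonneg |α|)]
  have h6 : (1 - Real.cos α) ^ 2 ≤ (α ^ 2 / 2) ^ 2 :=
    pow_le_pow_left₀ (by linarith) (by linarith) 2
  have h7 : (α - Real.sin α) ^ 2 ≤ (α ^ 2 / 6) ^ 2 := by
    rw [← sq_abs (α - Real.sin α)]
    exact pow_le_pow_left₀ (abs_nonneg _) (by linarith) 2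
  gcongr
  nlinarith [sq_nonneg (α ^ 2)]

theorem rot_mem_SO2 (θ : ℝ) : rot θ ∈ SO2 := by
  change rot θ ∈ Matrix.specialOrthogonalGroup (Fin 2) ℝ
  rw [Matrix.mem_specialOrthogonalGroup_iff, Matrix.mem_orthogonalGroup_iff]
  have h := Real.sin_sq_add_cos_sq θ
  constructor
  · ext i j
    fin_cases i <;> fin_cases j <;>
      simp [rot, Matrix.mul_apply, Fin.sum_univ_two] <;> nlinarith
  · rw [rot, Matrix.det_fin_two_of]; nlinarith

theorem exists_eq_rot {R : Matrix (Fin 2) (Fin 2) ℝ} (hR : R ∈ SO2) : ∃ θ, R = rot θ := by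
  have hR' : R ∈ Matrix.specialOrthogonalGroup (Fin 2) ℝ := hR
  rw [Matrix.mem_specialOrthogonalGroup_iff, Matrix.mem_orthogonalGroup_iff'] at hR'
  obtain ⟨h, hdet⟩ := hR'
  have h00 := congrFun (congrFun h 0) 0
  have h01 := congrFun (congrFun h 0) 1
  have h11 := congrFun (congrFun h 1) 1
  rw [Matrix.det_fin_two] at hdet
  simp [Matrix.mul_apply, Fin.sum_univ_two] at h00 h01 h11
  have e1 : R 1 1 = R 0 0 := by
    linear_combination (R 0 0) * hdet - (R 1 1) * h00 + (R 1 0) * h01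
  have e2 : R 0 1 = -R 1 0 := by
    linear_combination -(R 1 0) * hdet - (R 0 1) * h00 + (R 0 0) * h01
  obtain ⟨α, hα⟩ := exists_polar !₂[R 0 0, R 1 0]
  have hn : ‖(!₂[R 0 0, R 1 0] : Plane)‖ = 1 := by
    have h2 : ‖(!₂[R 0 0, R 1 0] : Plane)‖ ^ 2 = 1 := by
      rw [norm_sq_plane]; simp; nlinarith
    nlinarith [norm_nonneg (!₂[R 0 0, R 1 0] : Plane)]
  rw [hn, one_smul] at hα
  have c0 := congrArg (fun v : Plane => v 0) hα
  have c1 := congrArg (fun v : Plane => v 1) hα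
  simp [dirVec] at c0 c1
  refine ⟨α, ?_⟩
  ext i j
  fin_cases i <;> fin_cases j <;> simp [rot, e1, e2, c0, c1]

theorem exists_eq_rot_add {R : Matrix (Fin 2) (Fin 2) ℝ} (hR : R ∈ SO2) (θ : ℝ) :
    ∃ α, R = rot (θ + α) ∧ |α| ≤ Real.pi := by
  obtain ⟨ψ, rfl⟩ := exists_eq_rot hR
  have hmem := toIocMod_mem_Ioc Real.two_pi_pos (-Real.pi) (ψ - θ)
  refine ⟨toIocMod Real.two_pi_pos (-Real.pi) (ψ - θ), ?_, abs_le.2 ⟨hmem.1.le, by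
    linarith [hmem.2]⟩⟩
  have : θ + toIocMod Real.two_pi_pos (-Real.pi) (ψ - θ) =
      ψ - (toIocDiv Real.two_pi_pos (-Real.pi) (ψ - θ) : ℤ) * (2 * Real.pi) := by
    rw [toIocMod, zsmul_eq_mul]; ring
  rw [this, rot, rot, Real.cos_sub_int_mul_two_pi, Real.sin_sub_int_mul_two_pi]

theorem abs_rot_sub_rot_apply_le (θ θ' : ℝ) (k l : Fin 2) :
    |rot θ k l - rot θ' k l| ≤ |θ - θ'| := by
  have hc := Real.abs_cos_sub_cos_le θ θ'
  have hs := Real.abs_sin_sub_sin_le θ θ'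
  fin_cases k <;> fin_cases l <;> simp only [rot, Matrix.of_apply, Matrix.cons_val', Fin.zero_eta,
    Fin.mk_one, Matrix.cons_val_zero, Matrix.cons_val_one, Matrix.cons_val_fin_one]
  · exact hc
  · rw [neg_sub_neg, abs_sub_comm]; exact hs
  · exact hs
  · exact hc

/-- The first-order change of the position of a tag when its pose changes by `(α, τ)`. -/
def poseShift (θ : ℝ) (s : Plane) (α : ℝ) (τ : Plane) : Plane := α • rotVecDeriv θ s + τ

theorem poseShift_sub (θ : ℝ) (s : Plane) (α β : ℝ) (τ τ' : Plane) :
    poseShift θ s (α - β) (τ - τ') = poseShift θ s α τ - poseShift θ s β τ' := by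
  simp only [poseShift, sub_smul]; abel

theorem norm_poseShift_le (θ : ℝ) (s : Plane) (α : ℝ) (τ : Plane) :
    ‖poseShift θ s α τ‖ ≤ |α| * ‖s‖ + ‖τ‖ := by
  refine (norm_add_le _ _).trans ?_
  rw [norm_smul, norm_rotVecDeriv, Real.norm_eq_abs]

theorem norm_tagPosition_add_sub_le (θ α : ℝ) (t τ s : Plane) :
    ‖tagPosition (rot (θ + α)) (t + τ) s - tagPosition (rot θ) t s‖ ≤ |α| * ‖s‖ + ‖τ‖ := by
  rw [tagPosition_rot, tagPosition_rot, show rotVec (θ + α) s + (t + τ) - (rotVec θ s + t) =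
    (rotVec (θ + α) s - rotVec θ s) + τ by abel]
  exact (norm_add_le _ _).trans (add_le_add_left (norm_rotVec_add_sub_le _ _ _) _)

theorem norm_tagPosition_linearization_le (θ : ℝ) {α : ℝ} (hα : |α| ≤ 1) (t τ s : Plane) :
    ‖tagPosition (rot (θ + α)) (t + τ) s - tagPosition (rot θ) t s - poseShift θ s α τ‖ ≤
      α ^ 2 * ‖s‖ := by
  rw [tagPosition_rot, tagPosition_rot, poseShift,
    show rotVec (θ + α) s + (t + τ) - (rotVec θ s + t) - (α • rotVecDeriv θ s + τ) =
      rotVec (θ + α) s - rotVec θ s - α • rotVecDeriv θ s by abel]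
  exact norm_rotVec_linearization_le θ hα s

/-- Subtracting the shifts of two tags eliminates the translation and isolates the angle. Distinct
tags therefore suffice to recover the pose. -/
theorem abs_mul_le_of_norm_poseShift_le {θ α ρ : ℝ} {s s' τ : Plane}
    (h : ‖poseShift θ s α τ‖ ≤ ρ) (h' : ‖poseShift θ s' α τ‖ ≤ ρ) :
    |α| * ‖s - s'‖ ≤ 2 * ρ := by
  have e : poseShift θ s α τ - poseShift θ s' α τ = α • rotVecDeriv θ (s - s') := by
    rw [poseShift, poseShift, rotVecDeriv_sub, smul_sub]; abel
  have := norm_sub_le (poseShift θ s α τ) (poseShift θ s' α τ)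
  rw [e, norm_smul, norm_rotVecDeriv, Real.norm_eq_abs] at this
  linarith

theorem norm_le_of_norm_poseShift_le {θ α ρ : ℝ} {s τ : Plane}
    (h : ‖poseShift θ s α τ‖ ≤ ρ) : ‖τ‖ ≤ ρ + |α| * ‖s‖ := by
  have := norm_sub_le (poseShift θ s α τ) (α • rotVecDeriv θ s)
  rw [norm_smul, norm_rotVecDeriv, Real.norm_eq_abs] at this
  simp only [poseShift, add_sub_cancel_left] at this
  exact this.trans (add_le_add_left h _)

theorem abs_mul_le_of_norm_tagPosition_le {θ α ρ : ℝ} {t τ s s' : Plane} (hα : |α| ≤ Real.pi)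
    (h : ‖tagPosition (rot (θ + α)) (t + τ) s - tagPosition (rot θ) t s‖ ≤ ρ)
    (h' : ‖tagPosition (rot (θ + α)) (t + τ) s' - tagPosition (rot θ) t s'‖ ≤ ρ) :
    |α| * ‖s - s'‖ ≤ 4 * ρ := by
  have e : (tagPosition (rot (θ + α)) (t + τ) s - tagPosition (rot θ) t s) -
      (tagPosition (rot (θ + α)) (t + τ) s' - tagPosition (rot θ) t s') =
      rotVec (θ + α) (s - s') - rotVec θ (s - s') := by
    simp only [tagPosition_rot, rotVec_sub]; abel
  have h1 := norm_sub_le (tagPosition (rot (θ + α)) (t + τ) s - tagPosition (rot θ) t s)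
    (tagPosition (rot (θ + α)) (t + τ) s' - tagPosition (rot θ) t s')
  rw [e] at h1
  linarith [le_norm_rotVec_add_sub θ hα (s - s')]

theorem norm_le_of_norm_tagPosition_le {θ α ρ : ℝ} {t τ s : Plane}
    (h : ‖tagPosition (rot (θ + α)) (t + τ) s - tagPosition (rot θ) t s‖ ≤ ρ) :
    ‖τ‖ ≤ ρ + |α| * ‖s‖ := by
  have e : τ = (tagPosition (rot (θ + α)) (t + τ) s - tagPosition (rot θ) t s) -
      (rotVec (θ + α) s - rotVec θ s) := by
    simp only [tagPosition_rot]; abel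
  rw [e]
  exact (norm_sub_le _ _).trans (add_le_add h (norm_rotVec_add_sub_le _ _ _))

/-! ### The Gauss-Newton step through its normal equations -/

section GaussNewton

variable {N : ℕ} (a : ℕ → Plane) (s : Fin N → Plane) (σ d : Fin N → ℕ → ℝ) (M : ℕ) (θ : ℝ)
  (t : Plane)

/-- The zero row at `f = 0` agrees with `unitVec 0 = 0`, so no case distinction is needed. -/
theorem rangeJacobian_mulVec (z : Fin 3 → ℝ) (p : Fin N × Fin M) :
    (rangeJacobian a s M θ t *ᵥ z) p =
      -inner ℝ (unitVec (a p.2 - tagPosition (rot θ) t (s p.1)))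
        (poseShift θ (s p.1) (z 0) !₂[z 1, z 2]) := by
  set f : Plane := a p.2 - tagPosition (rot θ) t (s p.1) with hf
  have e : (rangeJacobian a s M θ t *ᵥ z) p =
      -inner ℝ f (rotVecDeriv θ (s p.1)) / ‖f‖ * z 0 + -f 0 / ‖f‖ * z 1 + -f 1 / ‖f‖ * z 2 := by
    simp [rangeJacobian, Matrix.mulVec, dotProduct, Fin.sum_univ_three, hf, rotVecDeriv]
  rw [e, poseShift, unitVec, real_inner_smul_left, inner_add_right, real_inner_smul_right,
    inner_plane f !₂[z 1, z 2]]
  simp only [Matrix.cons_val_zero, Matrix.cons_val_one]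
  ring

variable {σ}

theorem noiseCov_inv (hσ : ∀ i m, 0 < σ i m) :
    (noiseCov σ M)⁻¹ = Matrix.diagonal fun p : Fin N × Fin M => 1 / σ p.1 p.2 ^ 2 := by
  refine Matrix.inv_eq_right_inv ?_
  rw [noiseCov, Matrix.diagonal_mul_diagonal, ← Matrix.diagonal_one]
  congr 1
  ext p
  have := (hσ p.1 p.2).ne'
  field_simp

theorem dotProduct_transpose_rangeJacobian_mulVec (hσ : ∀ i m, 0 < σ i m) (z : Fin 3 → ℝ)
    (x : Fin N × Fin M → ℝ) :
    z ⬝ᵥ ((rangeJacobian a s M θ t)ᵀ *ᵥ ((noiseCov σ M)⁻¹ *ᵥ x)) =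
      ∑ p : Fin N × Fin M, -inner ℝ (unitVec (a p.2 - tagPosition (rot θ) t (s p.1)))
        (poseShift θ (s p.1) (z 0) !₂[z 1, z 2]) * (x p / σ p.1 p.2 ^ 2) := by
  rw [Matrix.dotProduct_mulVec, Matrix.vecMul_transpose, noiseCov_inv M hσ, dotProduct]
  refine Finset.sum_congr rfl fun p _ => ?_
  rw [rangeJacobian_mulVec, Matrix.mulVec_diagonal, one_div_mul_eq_div]

theorem dotProduct_gnNormalMatrix_mulVec (hσ : ∀ i m, 0 < σ i m) (z y : Fin 3 → ℝ) :
    z ⬝ᵥ (gnNormalMatrix a s σ M θ t *ᵥ y) =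
      ∑ p : Fin N × Fin M, inner ℝ (unitVec (a p.2 - tagPosition (rot θ) t (s p.1)))
        (poseShift θ (s p.1) (z 0) !₂[z 1, z 2]) *
        (inner ℝ (unitVec (a p.2 - tagPosition (rot θ) t (s p.1)))
        (poseShift θ (s p.1) (y 0) !₂[y 1, y 2]) / σ p.1 p.2 ^ 2) := by
  rw [gnNormalMatrix, ← Matrix.mulVec_mulVec, ← Matrix.mulVec_mulVec,
    dotProduct_transpose_rangeJacobian_mulVec a s M θ t hσ]
  refine Finset.sum_congr rfl fun p _ => ?_
  rw [rangeJacobian_mulVec]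
  ring

theorem sum_prod_eq_sum_range (f : Fin N → ℕ → ℝ) :
    ∑ p : Fin N × Fin M, f p.1 p.2 = ∑ i, ∑ m ∈ Finset.range M, f i m := by
  rw [Fintype.sum_prod_type]
  exact Finset.sum_congr rfl fun i _ => Fin.sum_univ_eq_sum_range (f i) M

theorem isUnit_det_gnNormalMatrix (hσ : ∀ i m, 0 < σ i m)
    (hpos : ∀ α τ, (α ≠ 0 ∨ τ ≠ 0) → 0 < ∑ i, ∑ m ∈ Finset.range M,
      inner ℝ (unitVec (a m - tagPosition (rot θ) t (s i))) (poseShift θ (s i) α τ) ^ 2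
        / σ i m ^ 2) :
    IsUnit (gnNormalMatrix a s σ M θ t).det := by
  rw [isUnit_iff_ne_zero]
  intro hdet
  obtain ⟨z, hz, hHz⟩ := Matrix.exists_mulVec_eq_zero_iff.2 hdet
  have h1 := dotProduct_gnNormalMatrix_mulVec a s M θ t hσ z z
  rw [hHz, dotProduct_zero] at h1
  have h2 := hpos (z 0) !₂[z 1, z 2] ?_
  · rw [← sum_prod_eq_sum_range M fun i m => inner ℝ (unitVec (a m - tagPosition (rot θ) t (s i)))
      (poseShift θ (s i) (z 0) !₂[z 1, z 2]) ^ 2 / σ i m ^ 2] at h2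
    refine h2.ne' (h1.trans (Finset.sum_congr rfl fun p _ => ?_)).symm
    ring
  · by_contra! hcon
    refine hz ?_
    have h3 := congrArg (fun v : Plane => v 0) hcon.2
    have h4 := congrArg (fun v : Plane => v 1) hcon.2
    simp at h3 h4
    ext k
    fin_cases k
    · exact hcon.1
    · exact h3
    · exact h4

/-- The matrix equation for the step, tested against an arbitrary pose direction `(α, τ)`: the
linearized cost is stationary at `(β, υ)`. In this form no matrices occur in the later estimates. -/
theorem exists_gnStep_normal_equations (hσ : ∀ i m, 0 < σ i m)
    (hdet : IsUnit (gnNormalMatrix a s σ M θ t).det) :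
    ∃ (β : ℝ) (υ : Plane), gnRotation a s σ d M θ t = rot (θ + β) ∧
      gnTranslation a s σ d M θ t = t + υ ∧
      ∀ (α : ℝ) (τ : Plane), ∑ i, ∑ m ∈ Finset.range M,
        inner ℝ (unitVec (a m - tagPosition (rot θ) t (s i))) (poseShift θ (s i) α τ) *
        (d i m - ‖a m - tagPosition (rot θ) t (s i)‖ +
          inner ℝ (unitVec (a m - tagPosition (rot θ) t (s i))) (poseShift θ (s i) β υ))
          / σ i m ^ 2 = 0 := by
  set g : Fin 3 → ℝ := (rangeJacobian a s M θ t)ᵀ *ᵥ ((noiseCov σ M)⁻¹ *ᵥ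
      ((fun p : Fin N × Fin M => d p.1 p.2) - predictedRange a s M θ t)) with hg
  set y : Fin 3 → ℝ := (gnNormalMatrix a s σ M θ t)⁻¹ *ᵥ g with hy
  have hHy : gnNormalMatrix a s σ M θ t *ᵥ y = g := by
    rw [hy, Matrix.mulVec_mulVec, Matrix.mul_nonsing_inv _ hdet, Matrix.one_mulVec]
  refine ⟨y 0, !₂[y 1, y 2], ?_, ?_, fun α τ => ?_⟩
  · simp [gnRotation, gnStep, hy, hg]
  · ext k
    fin_cases k <;> simp [gnTranslation, gnStep, hy, hg]
  · have h1 := dotProduct_gnNormalMatrix_mulVec a s M θ t hσ ![α, τ 0, τ 1] y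
    rw [hHy, hg, dotProduct_transpose_rangeJacobian_mulVec a s M θ t hσ, ← sub_eq_zero,
      ← Finset.sum_sub_distrib] at h1
    have hτ : (!₂[τ 0, τ 1] : Plane) = τ := by ext k; fin_cases k <;> rfl
    rw [← sum_prod_eq_sum_range M fun i m =>
      inner ℝ (unitVec (a m - tagPosition (rot θ) t (s i))) (poseShift θ (s i) α τ) *
        (d i m - ‖a m - tagPosition (rot θ) t (s i)‖ +
          inner ℝ (unitVec (a m - tagPosition (rot θ) t (s i)))
            (poseShift θ (s i) (y 0) !₂[y 1, y 2])) / σ i m ^ 2, ← neg_eq_zero,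
      ← Finset.sum_neg_distrib]
    rw [← h1]
    refine Finset.sum_congr rfl fun p _ => ?_
    simp only [Matrix.cons_val, hτ, Pi.sub_apply, predictedRange]
    ring

end GaussNewton

/-! ### Cost of a single tag and its linearization -/

/-- The weighted sum of distance differences is minus the integral of the score along the segment.
With `z = 0` this gives a global Lipschitz bound, and with `z` the score at `p` a first-order
expansion whose error is the oscillation of the score. -/
theorem abs_sum_norm_sub_norm_add_inner_le (a : ℕ → Plane) (ε : ℕ → ℝ) (M : ℕ) (p q z : Plane)
    {K : ℝ} (h : ∀ t ∈ Set.Icc (0 : ℝ) 1, ‖score a ε M (p + t • (q - p)) - z‖ ≤ K) :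
    |∑ m ∈ Finset.range M, ε m * (‖a m - q‖ - ‖a m - p‖) + inner ℝ z (q - p)| ≤
      K * ‖q - p‖ := by
  have hi := fun m => intervalIntegrable_inner_unitVec (a m) p q (q - p)
  have e : ∑ m ∈ Finset.range M, ε m * (‖a m - q‖ - ‖a m - p‖) + inner ℝ z (q - p) =
      ∫ t in (0 : ℝ)..1, -inner ℝ (score a ε M (p + t • (q - p)) - z) (q - p) := by
    simp only [norm_sub_norm_eq_integral, score, inner_sub_left, sum_inner, neg_sub,
      real_inner_smul_left]
    have hsum : IntervalIntegrable (fun t : ℝ => ∑ m ∈ Finset.range M,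
        ε m * inner ℝ (unitVec (a m - (p + t • (q - p)))) (q - p)) volume 0 1 := by
      rw [intervalIntegrable_iff]
      exact integrable_finsetSum _ fun m _ => (intervalIntegrable_iff.1 (hi m)).const_mul _
    rw [intervalIntegral.integral_sub intervalIntegrable_const hsum, intervalIntegral.integral_finsetSum fun m _ => (hi m).const_mul _]
    simp only [intervalIntegral.integral_neg, intervalIntegral.integral_const_mul, mul_neg,
      Finset.sum_neg_distrib, intervalIntegral.integral_const, sub_zero, one_smul]
    ring
  rw [e]
  have := intervalIntegral.norm_integral_le_of_norm_le_const (a := (0 : ℝ)) (b := 1)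
    (f := fun t => -inner ℝ (score a ε M (p + t • (q - p)) - z) (q - p)) (C := K * ‖q - p‖)
    fun t ht => by
      rw [Set.uIoc_of_le zero_le_one] at ht
      rw [norm_neg]
      exact (norm_inner_le_norm _ _).trans
        (mul_le_mul_of_nonneg_right (h t ⟨ht.1.le, ht.2⟩) (norm_nonneg _))
  simpa using this

theorem abs_sum_mul_norm_sub_norm_le (a : ℕ → Plane) (ε : ℕ → ℝ) (M : ℕ) (p q : Plane) {A : ℝ}
    (h : ∀ p, ‖score a ε M p‖ ≤ A) :
    |∑ m ∈ Finset.range M, ε m * (‖a m - q‖ - ‖a m - p‖)| ≤ A * ‖q - p‖ := by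
  simpa using abs_sum_norm_sub_norm_add_inner_le a ε M p q 0 (K := A) fun t _ => by simpa using h _

theorem sum_mul_inner_unitVec (a : ℕ → Plane) (ε : ℕ → ℝ) (M : ℕ) (p ℓ : Plane) :
    ∑ m ∈ Finset.range M, ε m * inner ℝ (unitVec (a m - p)) ℓ = inner ℝ (score a ε M p) ℓ := by
  simp [score, sum_inner, real_inner_smul_left]

theorem norm_segment_sub_le {p q p₀ : Plane} {κ : ℝ} (hp : ‖p - p₀‖ ≤ κ) (hq : ‖q - p₀‖ ≤ κ)
    {t : ℝ} (ht : t ∈ Set.Icc (0 : ℝ) 1) : ‖p + t • (q - p) - p₀‖ ≤ κ := by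
  have h := (convex_closedBall p₀ κ).add_smul_sub_mem (mem_closedBall_iff_norm.2 hp)
    (mem_closedBall_iff_norm.2 hq) ht
  exact mem_closedBall_iff_norm.1 h

/-- The error of the linearization of the distance to `a` at `p`, for the displacement `ℓ`. -/
def rangeError (a p q ℓ : Plane) : ℝ := ‖a - q‖ - ‖a - p‖ + inner ℝ (unitVec (a - p)) ℓ

theorem abs_sum_mul_rangeError_le (a : ℕ → Plane) (ε : ℕ → ℝ) (M : ℕ) {p q p₀ ℓ : Plane}
    {κ A B lam : ℝ} (hp : ‖p - p₀‖ ≤ κ) (hq : ‖q - p₀‖ ≤ κ) (hl : ‖q - p - ℓ‖ ≤ lam)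
    (hA : ‖score a ε M p‖ ≤ A)
    (hB : ∀ x, ‖x - p₀‖ ≤ κ → ‖score a ε M x - score a ε M p‖ ≤ B) :
    |∑ m ∈ Finset.range M, ε m * rangeError (a m) p q ℓ| ≤ B * ‖q - p‖ + A * lam := by
  have h1 := abs_sum_norm_sub_norm_add_inner_le a ε M p q (score a ε M p) (K := B)
    fun t ht => hB _ (norm_segment_sub_le hp hq ht)
  have h2 : |inner ℝ (score a ε M p) (q - p - ℓ)| ≤ A * lam :=
    (abs_real_inner_le_norm _ _).trans (mul_le_mul hA hl (norm_nonneg _)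
      ((norm_nonneg _).trans hA))
  have e : ∑ m ∈ Finset.range M, ε m * rangeError (a m) p q ℓ =
      (∑ m ∈ Finset.range M, ε m * (‖a m - q‖ - ‖a m - p‖) + inner ℝ (score a ε M p) (q - p)) -
        inner ℝ (score a ε M p) (q - p - ℓ) := by
    simp only [rangeError, mul_add, Finset.sum_add_distrib, sum_mul_inner_unitVec,
      inner_sub_right]
    ring
  rw [e]
  exact (abs_sub _ _).trans (add_le_add h1 h2)

theorem abs_rangeError_le (a : Plane) {p q p₀ ℓ : Plane} {κ lam : ℝ} (hκ : 0 < κ)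
    (hp : ‖p - p₀‖ ≤ κ) (hq : ‖q - p₀‖ ≤ κ) (hl : ‖q - p - ℓ‖ ≤ lam) :
    |rangeError a p q ℓ| ≤ 8 * (κ / (κ + ‖a - p₀‖)) * ‖q - p‖ + lam := by
  -- A single anchor of weight one is a special case of the weighted estimate, its score being the
  -- unit vector itself.
  have hs : ∀ x, score (fun _ => a) (fun _ => 1) 1 x = unitVec (a - x) := fun x => by simp [score]
  have hu : ∀ x, ‖x - p₀‖ ≤ κ → ‖unitVec (a - x) - unitVec (a - p₀)‖ ≤
      4 * (κ / (κ + ‖a - p₀‖)) := fun x hx => by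
    have := norm_unitVec_sub_unitVec_le (a - p₀) (x - p₀) hκ hx
    rwa [sub_sub_sub_cancel_right] at this
  have h := abs_sum_mul_rangeError_le (fun _ => a) (fun _ => 1) 1 (A := 1)
    (B := 8 * (κ / (κ + ‖a - p₀‖))) hp hq hl (by rw [hs]; exact norm_unitVec_le _) fun x hx => by
      rw [hs, hs, ← sub_sub_sub_cancel_right _ _ (unitVec (a - p₀))]
      exact (norm_sub_le _ _).trans (by linarith [hu x hx, hu p hp])
  simpa using h

/-- A quadratic term bounded by a linear one forces size `1 / T`; Cauchy-Schwarz passes between the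
two sums. This turns each basic inequality into a root-n rate. -/
theorem sq_sum_norm_bound {N : ℕ} (x : Fin N → ℝ) (hx : ∀ i, 0 ≤ x i) {k T B : ℝ} (hk : 0 < k)
    (hT : 0 < T) (hB : 0 ≤ B) (h : k * T ^ 2 * ∑ i, x i ^ 2 ≤ B * T * ∑ i, x i) (i : Fin N) :
    x i ≤ N * B / k / T := by
  have h1 : (∑ i, x i) ^ 2 ≤ N * ∑ i, x i ^ 2 := by
    simpa using sq_sum_le_card_mul_sum_sq (s := Finset.univ) (f := x)
  have h0 : 0 ≤ ∑ i, x i := Finset.sum_nonneg fun i _ => hx i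
  have hi : x i ≤ ∑ i, x i := Finset.single_le_sum (fun i _ => hx i) (Finset.mem_univ i)
  refine hi.trans ?_
  rw [div_div, le_div_iff₀ (by positivity)]
  rcases h0.eq_or_lt with h2 | h2
  · rw [← h2, zero_mul]; positivity
  · have h3 : k * T ^ 2 * (∑ i, x i) ^ 2 ≤ N * (B * T * ∑ i, x i) := by
      calc k * T ^ 2 * (∑ i, x i) ^ 2 ≤ k * T ^ 2 * (N * ∑ i, x i ^ 2) := by gcongr
        _ = N * (k * T ^ 2 * ∑ i, x i ^ 2) := by ring
        _ ≤ _ := by gcongr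
    have h4 : (T * ∑ i, x i) * ((∑ i, x i) * (k * T)) ≤ (T * ∑ i, x i) * (N * B) := by
      linarith
    exact le_of_mul_le_mul_left h4 (by positivity)

section Tag

variable (a : ℕ → Plane) (w r : ℕ → ℝ) (M : ℕ)

/-- The basic inequality of least squares: the excess cost is the squared range differences minus
twice the noise term, which the uniform score bound makes at most linear in `‖p - p₀‖`. -/
theorem le_sum_sq_sub_sq_of_score_le {u A c : ℝ} {p p₀ : Plane} (hu : 0 ≤ u)
    (hw : ∀ m, u ≤ w m)
    (hA : ∀ p, ‖score a (fun m => w m * r m) M p‖ ≤ A)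
    (hc : c * ‖p - p₀‖ ^ 2 ≤ ∑ m ∈ Finset.range M, (‖a m - p‖ - ‖a m - p₀‖) ^ 2) :
    u * c * ‖p - p₀‖ ^ 2 - 2 * A * ‖p - p₀‖ ≤
      ∑ m ∈ Finset.range M, (‖a m - p₀‖ + r m - ‖a m - p‖) ^ 2 * w m -
        ∑ m ∈ Finset.range M, (‖a m - p₀‖ + r m - ‖a m - p₀‖) ^ 2 * w m := by
  have h1 := (abs_le.1 (abs_sum_mul_norm_sub_norm_le a (fun m => w m * r m) M p₀ p hA)).2
  have h2 : u * ∑ m ∈ Finset.range M, (‖a m - p‖ - ‖a m - p₀‖) ^ 2 ≤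
      ∑ m ∈ Finset.range M, w m * (‖a m - p‖ - ‖a m - p₀‖) ^ 2 := by
    rw [Finset.mul_sum]
    exact Finset.sum_le_sum fun m _ => mul_le_mul_of_nonneg_right (hw m) (sq_nonneg _)
  have h3 := mul_le_mul_of_nonneg_left hc hu
  have e : ∑ m ∈ Finset.range M, (‖a m - p₀‖ + r m - ‖a m - p‖) ^ 2 * w m -
        ∑ m ∈ Finset.range M, (‖a m - p₀‖ + r m - ‖a m - p₀‖) ^ 2 * w m =
      ∑ m ∈ Finset.range M, w m * (‖a m - p‖ - ‖a m - p₀‖) ^ 2 -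
        2 * ∑ m ∈ Finset.range M, w m * r m * (‖a m - p‖ - ‖a m - p₀‖) := by
    rw [Finset.mul_sum, ← Finset.sum_sub_distrib, ← Finset.sum_sub_distrib]
    exact Finset.sum_congr rfl fun m _ => by ring
  rw [e]
  linarith

theorem le_sum_inner_mul_of_score_le {u v A c : ℝ} {p p₀ ℓ : Plane} (hu : 0 ≤ u)
    (hw : ∀ m, u ≤ w m ∧ w m ≤ v)
    (hA : ‖score a (fun m => w m * r m) M p‖ ≤ A)
    (hc : c * ‖ℓ‖ ^ 2 ≤ ∑ m ∈ Finset.range M, inner ℝ (unitVec (a m - p)) ℓ ^ 2) :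
    u * c * ‖ℓ‖ ^ 2 - (A + v * ‖p - p₀‖ * M) * ‖ℓ‖ ≤
      ∑ m ∈ Finset.range M, inner ℝ (unitVec (a m - p)) ℓ *
        (‖a m - p₀‖ + r m - ‖a m - p‖ + inner ℝ (unitVec (a m - p)) ℓ) * w m := by
  have h1 : -(A * ‖ℓ‖) ≤ inner ℝ (score a (fun m => w m * r m) M p) ℓ :=
    (abs_le.1 ((abs_real_inner_le_norm _ _).trans
      (mul_le_mul_of_nonneg_right hA (norm_nonneg _)))).1
  rw [← sum_mul_inner_unitVec] at h1
  have h2 : u * ∑ m ∈ Finset.range M, inner ℝ (unitVec (a m - p)) ℓ ^ 2 ≤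
      ∑ m ∈ Finset.range M, w m * inner ℝ (unitVec (a m - p)) ℓ ^ 2 := by
    rw [Finset.mul_sum]
    exact Finset.sum_le_sum fun m _ => mul_le_mul_of_nonneg_right (hw m).1 (sq_nonneg _)
  have h3 := mul_le_mul_of_nonneg_left hc hu
  have h4 : ∑ m ∈ Finset.range M, -(v * ‖p - p₀‖ * ‖ℓ‖) ≤
      ∑ m ∈ Finset.range M, w m * inner ℝ (unitVec (a m - p)) ℓ * (‖a m - p₀‖ - ‖a m - p‖) := by
    refine Finset.sum_le_sum fun m _ => (abs_le.1 ?_).1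
    have e1 : |inner ℝ (unitVec (a m - p)) ℓ| ≤ ‖ℓ‖ := by
      refine (abs_real_inner_le_norm _ _).trans ?_
      exact mul_le_of_le_one_left (norm_nonneg _) (norm_unitVec_le _)
    have e2 : |‖a m - p₀‖ - ‖a m - p‖| ≤ ‖p - p₀‖ := by
      have := abs_norm_sub_norm_le (a m - p₀) (a m - p)
      rwa [sub_sub_sub_cancel_left] at this
    have hw0 := hu.trans (hw m).1
    rw [abs_mul, abs_mul, abs_of_nonneg hw0, mul_right_comm]
    exact mul_le_mul (mul_le_mul (hw m).2 e2 (abs_nonneg _) (hw0.trans (hw m).2)) e1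
      (abs_nonneg _) (mul_nonneg (hw0.trans (hw m).2) (norm_nonneg _))
  rw [Finset.sum_const, Finset.card_range, nsmul_eq_mul] at h4
  have e : ∑ m ∈ Finset.range M, inner ℝ (unitVec (a m - p)) ℓ *
        (‖a m - p₀‖ + r m - ‖a m - p‖ + inner ℝ (unitVec (a m - p)) ℓ) * w m =
      ∑ m ∈ Finset.range M, w m * inner ℝ (unitVec (a m - p)) ℓ ^ 2 +
        ∑ m ∈ Finset.range M, w m * r m * inner ℝ (unitVec (a m - p)) ℓ +
        ∑ m ∈ Finset.range M, w m * inner ℝ (unitVec (a m - p)) ℓ * (‖a m - p₀‖ - ‖a m - p‖) := by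
    rw [← Finset.sum_add_distrib, ← Finset.sum_add_distrib]
    exact Finset.sum_congr rfl fun m _ => by ring
  rw [e]
  linarith

/-- The weighted sum of squares and its linearization agree up to a small error near the true
position. -/
theorem abs_sum_sq_sub_linearized_le {v A η κ lam : ℝ} {p q p₀ ℓ : Plane} (hκ : 0 < κ)
    (hw : ∀ m, 0 ≤ w m ∧ w m ≤ v)
    (hA : ∀ p, ‖score a (fun m => w m * r m) M p‖ ≤ A)
    {B : ℝ} (hB : ∀ x, ‖x - p₀‖ ≤ κ →
      ‖score a (fun m => w m * r m) M x - score a (fun m => w m * r m) M p‖ ≤ B)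
    (hη : ∑ m ∈ Finset.range M, κ / (κ + ‖a m - p₀‖) ≤ η)
    (hp : ‖p - p₀‖ ≤ κ) (hq : ‖q - p₀‖ ≤ κ) (hℓ : ‖ℓ‖ ≤ κ) (hl : ‖q - p - ℓ‖ ≤ lam) :
    |∑ m ∈ Finset.range M, (‖a m - p₀‖ + r m - ‖a m - q‖) ^ 2 * w m -
      ∑ m ∈ Finset.range M,
        (‖a m - p₀‖ + r m - ‖a m - p‖ + inner ℝ (unitVec (a m - p)) ℓ) ^ 2 * w m| ≤
      2 * (B * (2 * κ) + A * lam) + v * (20 * κ + lam) * (16 * κ * η + M * lam) := by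
  set e : ℕ → ℝ := fun m => rangeError (a m) p q ℓ with he
  have hlam : 0 ≤ lam := (norm_nonneg _).trans hl
  have hv0 : 0 ≤ v := (hw 0).1.trans (hw 0).2
  have hqp : ‖q - p‖ ≤ 2 * κ := by
    rw [← sub_sub_sub_cancel_right q p p₀]
    exact (norm_sub_le _ _).trans (by linarith)
  have hB0 : 0 ≤ B := (norm_nonneg _).trans (hB p hp)
  have h1 : |∑ m ∈ Finset.range M, w m * r m * e m| ≤ B * (2 * κ) + A * lam :=
    (abs_sum_mul_rangeError_le a _ M hp hq hl (hA p) hB).trans (by gcongr)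
  have h2 : ∀ m, |e m| ≤ 8 * (κ / (κ + ‖a m - p₀‖)) * (2 * κ) + lam := fun m =>
    (abs_rangeError_le (a m) hκ hp hq hl).trans (by gcongr)
  have h3 : ∑ m ∈ Finset.range M, |e m| ≤ 16 * κ * η + M * lam := by
    refine (Finset.sum_le_sum fun m _ => h2 m).trans ?_
    rw [Finset.sum_add_distrib, ← Finset.sum_mul, ← Finset.mul_sum]
    simp only [Finset.sum_const, Finset.card_range, nsmul_eq_mul]
    nlinarith
  have h4 : ∀ m, |e m| ≤ 16 * κ + lam := fun m => by
    refine (h2 m).trans ?_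
    have : κ / (κ + ‖a m - p₀‖) ≤ 1 := by
      rw [div_le_one (by positivity)]; linarith [norm_nonneg (a m - p₀)]
    nlinarith
  set h : ℕ → ℝ := fun m => ‖a m - p₀‖ - ‖a m - p‖ + inner ℝ (unitVec (a m - p)) ℓ with hh
  have h5 : ∀ m, |h m| ≤ 2 * κ := fun m => by
    have e1 : |inner ℝ (unitVec (a m - p)) ℓ| ≤ ‖ℓ‖ := by
      refine (abs_real_inner_le_norm _ _).trans ?_
      exact mul_le_of_le_one_left (norm_nonneg _) (norm_unitVec_le _)
    have e2 : |‖a m - p₀‖ - ‖a m - p‖| ≤ ‖p - p₀‖ := by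
      have := abs_norm_sub_norm_le (a m - p₀) (a m - p)
      rwa [sub_sub_sub_cancel_left] at this
    exact (abs_add_le _ _).trans (by linarith)
  -- The linearized residual is `r + h` and the true one `r + h - e`. Their squares differ by `-2 *
  -- r * e`, handled by the oscillation of the score, and by the noise-free `(e - 2 * h) * e`, small
  -- because few anchors are near `p₀`.
  have key : ∑ m ∈ Finset.range M, (‖a m - p₀‖ + r m - ‖a m - q‖) ^ 2 * w m -
      ∑ m ∈ Finset.range M,
        (‖a m - p₀‖ + r m - ‖a m - p‖ + inner ℝ (unitVec (a m - p)) ℓ) ^ 2 * w m =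
      -(2 * ∑ m ∈ Finset.range M, w m * r m * e m) +
        ∑ m ∈ Finset.range M, w m * ((e m - 2 * h m) * e m) := by
    rw [Finset.mul_sum, ← Finset.sum_neg_distrib, ← Finset.sum_sub_distrib,
      ← Finset.sum_add_distrib]
    refine Finset.sum_congr rfl fun m _ => ?_
    simp only [he, hh, rangeError]
    ring
  have h6 : |∑ m ∈ Finset.range M, w m * ((e m - 2 * h m) * e m)| ≤
      v * (20 * κ + lam) * ∑ m ∈ Finset.range M, |e m| := by
    rw [Finset.mul_sum]
    refine (Finset.abs_sum_le_sum_abs _ _).trans (Finset.sum_le_sum fun m _ => ?_)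
    rw [abs_mul, abs_mul, abs_of_nonneg (hw m).1, mul_assoc]
    refine mul_le_mul (hw m).2 (mul_le_mul_of_nonneg_right ?_ (abs_nonneg _)) (by positivity) hv0
    refine (abs_sub _ _).trans ?_
    rw [abs_mul, abs_two]
    linarith [h4 m, h5 m]
  rw [key]
  refine (abs_add_le _ _).trans (add_le_add ?_ (h6.trans (by gcongr)))
  rw [abs_neg, abs_mul, abs_two]
  gcongr

end Tag

/-! ### Deterministic comparison on a regular sample -/

/-- The measurements from the first `T ^ 2` anchors are non-degenerate and their scores are bounded
at the root rate. -/
structure RegularSample {N : ℕ} (a : ℕ → Plane) (p₀ : Fin N → Plane) (σ r : Fin N → ℕ → ℝ)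
    (M : ℕ) (T A c : ℝ) : Prop where
  one_le : 1 ≤ T
  sq_eq : (M : ℝ) = T ^ 2
  score_le : ∀ i p, ‖score a (fun m => 1 / σ i m ^ 2 * r i m) M p‖ ≤ A * T
  dist_le : ∀ i p, c * M * ‖p - p₀ i‖ ^ 2 ≤
    ∑ m ∈ Finset.range M, (‖a m - p‖ - ‖a m - p₀ i‖) ^ 2
  normal_le : ∀ i p ℓ, ‖p - p₀ i‖ ≤ 1 →
    c * M * ‖ℓ‖ ^ 2 ≤ ∑ m ∈ Finset.range M, inner ℝ (unitVec (a m - p)) ℓ ^ 2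

section Deterministic

variable {N : ℕ} {a : ℕ → Plane} {s p₀ : Fin N → Plane} {σ r : Fin N → ℕ → ℝ} {M : ℕ}
  {σlo σhi T A c : ℝ}

theorem weight_bounds (hσlo : 0 < σlo) (hσ : ∀ i m, σlo ≤ σ i m ∧ σ i m ≤ σhi) (i : Fin N)
    (m : ℕ) : 1 / σhi ^ 2 ≤ 1 / σ i m ^ 2 ∧ 1 / σ i m ^ 2 ≤ 1 / σlo ^ 2 := by
  have h := hσ i m
  have h0 : 0 < σ i m := hσlo.trans_le h.1
  constructor
  · exact one_div_le_one_div_of_le (by positivity) (pow_le_pow_left₀ h0.le h.2 2)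
  · exact one_div_le_one_div_of_le (by positivity) (pow_le_pow_left₀ hσlo.le h.1 2)

/-- Compare the cost of the minimizer with that of the true pose and sum the basic inequality over
the tags. -/
theorem norm_tagPosition_sub_le_of_isMLEstimate {d : Fin N → ℕ → ℝ}
    {R₀ R : Matrix (Fin 2) (Fin 2) ℝ} {t₀ t : Plane} (hR₀ : R₀ ∈ SO2)
    (hσlo : 0 < σlo) (hσ : ∀ i m, σlo ≤ σ i m ∧ σ i m ≤ σhi)
    (hd : ∀ i m, d i m = ‖a m - tagPosition R₀ t₀ (s i)‖ + r i m)
    (hc : 0 < c) (hA : 0 ≤ A)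
    (h : RegularSample a (fun i => tagPosition R₀ t₀ (s i)) σ r M T A c)
    (hML : IsMLEstimate a s σ d M R t) (i : Fin N) :
    ‖tagPosition R t (s i) - tagPosition R₀ t₀ (s i)‖ ≤ N * (2 * A) / (1 / σhi ^ 2 * c) / T := by
  have hσhi : 0 < σhi := hσlo.trans_le ((hσ i 0).1.trans (hσ i 0).2)
  have hT : 0 < T := one_pos.trans_le h.one_le
  refine sq_sum_norm_bound (fun i => ‖tagPosition R t (s i) - tagPosition R₀ t₀ (s i)‖)
    (fun i => norm_nonneg _) (by positivity) hT (by positivity) ?_ i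
  have hQ : mlObjective a s σ d M (R, t) ≤ mlObjective a s σ d M (R₀, t₀) :=
    hML.2 (Set.mk_mem_prod hR₀ (Set.mem_univ t₀))
  simp only [mlObjective, hd, div_eq_mul_one_div (_ ^ 2 : ℝ)] at hQ
  rw [← sub_nonpos, ← Finset.sum_sub_distrib] at hQ
  have h1 := (Finset.sum_le_sum fun i (_ : i ∈ Finset.univ) =>
    le_sum_sq_sub_sq_of_score_le a (fun m => 1 / σ i m ^ 2) (r i) M (u := 1 / σhi ^ 2)
      (by positivity) (fun m => (weight_bounds hσlo hσ i m).1) (h.score_le i)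
      (h.dist_le i (tagPosition R t (s i)))).trans hQ
  rw [Finset.sum_sub_distrib, ← Finset.mul_sum, ← Finset.mul_sum, h.sq_eq] at h1
  linarith

theorem exists_pose_of_isMLEstimate {R₀ : Matrix (Fin 2) (Fin 2) ℝ} {t₀ : Plane} (hR₀ : R₀ ∈ SO2)
    (hσlo : 0 < σlo) (hσ : ∀ i m, σlo ≤ σ i m ∧ σ i m ≤ σhi)
    {C₁ : ℝ} (hC₁ : 0 ≤ C₁) (hc : 0 < c) (hA : 0 ≤ A) {i j : Fin N} (hij : s i ≠ s j) :
    ∃ C > 0, ∀ (M : ℕ) (T θ : ℝ) (t : Plane) (r d : Fin N → ℕ → ℝ)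
      (R : Matrix (Fin 2) (Fin 2) ℝ) (t' : Plane),
      (∀ i m, d i m = ‖a m - tagPosition R₀ t₀ (s i)‖ + r i m) →
      RegularSample a (fun i => tagPosition R₀ t₀ (s i)) σ r M T A c →
      (∀ i, ‖tagPosition (rot θ) t (s i) - tagPosition R₀ t₀ (s i)‖ ≤ C₁ / T) →
      IsMLEstimate a s σ d M R t' →
      ∃ α τ, R = rot (θ + α) ∧ t' = t + τ ∧ |α| ≤ C / T ∧ ‖τ‖ ≤ C / T := by
  have hσhi : 0 < σhi := hσlo.trans_le ((hσ i 0).1.trans (hσ i 0).2)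
  set C₂ : ℝ := N * (2 * A) / (1 / σhi ^ 2 * c) with hC₂
  have hC₂0 : 0 ≤ C₂ := by positivity
  have hg : 0 < ‖s i - s j‖ := norm_pos_iff.2 (sub_ne_zero.2 hij)
  set C₃ : ℝ := 4 * (C₁ + C₂) / ‖s i - s j‖ with hC₃
  have hC₃0 : 0 ≤ C₃ := by positivity
  refine ⟨C₁ + C₂ + C₃ * ‖s i‖ + C₃ + 1, by positivity, ?_⟩
  intro M T θ t r d R t' hd h hinit hML
  have hT : 0 < T := one_pos.trans_le h.one_le
  obtain ⟨α, hα, hαπ⟩ := exists_eq_rot_add hML.1 θ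
  have ht' : t' = t + (t' - t) := by abel
  have hρ : ∀ k, ‖tagPosition (rot (θ + α)) (t + (t' - t)) (s k) - tagPosition (rot θ) t (s k)‖ ≤
      (C₁ + C₂) / T := by
    intro k
    have h1 := norm_tagPosition_sub_le_of_isMLEstimate hR₀ hσlo hσ hd hc hA h hML k
    rw [← ht', ← hα, add_div, ← sub_sub_sub_cancel_right _ _ (tagPosition R₀ t₀ (s k))]
    exact (norm_sub_le _ _).trans (by linarith [hinit k])
  have hα' : |α| ≤ C₃ / T := by
    have h1 := abs_mul_le_of_norm_tagPosition_le hαπ (hρ i) (hρ j)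
    rw [hC₃, div_div, le_div_iff₀ (by positivity)]
    have h2 : 4 * ((C₁ + C₂) / T) * T = 4 * (C₁ + C₂) := by field_simp
    nlinarith [mul_le_mul_of_nonneg_right h1 hT.le]
  refine ⟨α, t' - t, hα, ht', hα'.trans ?_, ?_⟩
  · have : 0 ≤ C₃ * ‖s i‖ := by positivity
    exact div_le_div_of_nonneg_right (by linarith) hT.le
  · refine (norm_le_of_norm_tagPosition_le (hρ i)).trans ?_
    have : |α| * ‖s i‖ ≤ C₃ / T * ‖s i‖ := by gcongr
    calc (C₁ + C₂) / T + |α| * ‖s i‖ ≤ (C₁ + C₂) / T + C₃ / T * ‖s i‖ := by linarith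
      _ = (C₁ + C₂ + C₃ * ‖s i‖) / T := by ring
      _ ≤ _ := div_le_div_of_nonneg_right (by linarith) hT.le

theorem RegularSample.isUnit_det_gnNormalMatrix (hσlo : 0 < σlo)
    (hσ : ∀ i m, σlo ≤ σ i m ∧ σ i m ≤ σhi) (hc : 0 < c)
    (h : RegularSample a p₀ σ r M T A c) {i j : Fin N} (hij : s i ≠ s j) {θ : ℝ} {t : Plane}
    (hinit : ∀ i, ‖tagPosition (rot θ) t (s i) - p₀ i‖ ≤ 1) :
    IsUnit (gnNormalMatrix a s σ M θ t).det := by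
  have hσ0 : ∀ i m, 0 < σ i m := fun i m => hσlo.trans_le (hσ i m).1
  have hσhi : 0 < σhi := (hσ0 i 0).trans_le (hσ i 0).2
  have hM : (0 : ℝ) < M := by rw [h.sq_eq]; nlinarith [h.one_le]
  refine _root_.isUnit_det_gnNormalMatrix a s M θ t hσ0 fun α τ hne => ?_
  by_contra! hcon
  have hle : ∀ k, c * M * ‖poseShift θ (s k) α τ‖ ^ 2 * (1 / σhi ^ 2) ≤
      ∑ m ∈ Finset.range M, inner ℝ (unitVec (a m - tagPosition (rot θ) t (s k)))
        (poseShift θ (s k) α τ) ^ 2 / σ k m ^ 2 := by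
    intro k
    refine (mul_le_mul_of_nonneg_right (h.normal_le k _ _ (hinit k)) (by positivity)).trans ?_
    rw [Finset.sum_mul]
    refine Finset.sum_le_sum fun m _ => ?_
    rw [div_eq_mul_one_div (_ ^ 2 : ℝ)]
    exact mul_le_mul_of_nonneg_left (weight_bounds hσlo hσ k m).1 (sq_nonneg _)
  have hzero : ∀ k, ‖poseShift θ (s k) α τ‖ ≤ 0 := by
    intro k
    have h1 := Finset.single_le_sum (f := fun k => ∑ m ∈ Finset.range M,
      inner ℝ (unitVec (a m - tagPosition (rot θ) t (s k))) (poseShift θ (s k) α τ) ^ 2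
        / σ k m ^ 2) (fun k _ => Finset.sum_nonneg fun m _ => by positivity) (Finset.mem_univ k)
    have h2 := ((hle k).trans h1).trans hcon
    by_contra! hpos
    have : 0 < c * M * ‖poseShift θ (s k) α τ‖ ^ 2 * (1 / σhi ^ 2) := by positivity
    linarith
  have hg : 0 < ‖s i - s j‖ := norm_pos_iff.2 (sub_ne_zero.2 hij)
  have hα := abs_mul_le_of_norm_poseShift_le (hzero i) (hzero j)
  have hα0 : |α| ≤ 0 := by nlinarith
  have hα1 : α = 0 := abs_nonpos_iff.1 hα0
  have hτ := norm_le_of_norm_poseShift_le (hzero i)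
  rw [hα1, abs_zero, zero_mul, add_zero, norm_le_zero_iff] at hτ
  exact hne.elim (fun h => h hα1) fun h => h hτ

/-- The step is itself `O(1 / T)`: test the normal equations on it. Curvature gives `T ^ 2 * ‖ℓ‖ ^
2`, against `O(T) * ‖ℓ‖` from the noise and from the error of the initial pose. -/
theorem exists_pose_of_gnStep (hσlo : 0 < σlo)
    (hσ : ∀ i m, σlo ≤ σ i m ∧ σ i m ≤ σhi) {C₁ : ℝ} (hC₁ : 0 ≤ C₁) (hc : 0 < c) (hA : 0 ≤ A)
    {i j : Fin N} (hij : s i ≠ s j) :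
    ∃ C > 0, ∀ (M : ℕ) (T θ : ℝ) (t : Plane) (r d : Fin N → ℕ → ℝ),
      (∀ i m, d i m = ‖a m - p₀ i‖ + r i m) →
      RegularSample a p₀ σ r M T A c → C₁ ≤ T →
      (∀ i, ‖tagPosition (rot θ) t (s i) - p₀ i‖ ≤ C₁ / T) →
      IsUnit (gnNormalMatrix a s σ M θ t).det ∧
      ∃ β υ, gnRotation a s σ d M θ t = rot (θ + β) ∧ gnTranslation a s σ d M θ t = t + υ ∧
        |β| ≤ C / T ∧ ‖υ‖ ≤ C / T ∧
      ∀ (α : ℝ) (τ : Plane), ∑ i, ∑ m ∈ Finset.range M,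
        inner ℝ (unitVec (a m - tagPosition (rot θ) t (s i))) (poseShift θ (s i) α τ) *
        (‖a m - p₀ i‖ + r i m - ‖a m - tagPosition (rot θ) t (s i)‖ +
          inner ℝ (unitVec (a m - tagPosition (rot θ) t (s i))) (poseShift θ (s i) β υ))
          * (1 / σ i m ^ 2) = 0 := by
  have hσ0 : ∀ i m, 0 < σ i m := fun i m => hσlo.trans_le (hσ i m).1
  have hσhi : 0 < σhi := (hσ0 i 0).trans_le (hσ i 0).2
  set v : ℝ := 1 / σlo ^ 2 with hv
  have hv0 : 0 < v := by positivity
  set C₅ : ℝ := N * (A + v * C₁) / (1 / σhi ^ 2 * c) with hC₅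
  have hC₅0 : 0 ≤ C₅ := by positivity
  have hg : 0 < ‖s i - s j‖ := norm_pos_iff.2 (sub_ne_zero.2 hij)
  set C₆ : ℝ := 2 * C₅ / ‖s i - s j‖ with hC₆
  have hC₆0 : 0 ≤ C₆ := by positivity
  refine ⟨C₅ + C₆ * ‖s i‖ + C₆ + 1, by positivity, ?_⟩
  intro M T θ t r d hd h hCT hinit
  have hT : 0 < T := one_pos.trans_le h.one_le
  have hinit1 : ∀ i, ‖tagPosition (rot θ) t (s i) - p₀ i‖ ≤ 1 := fun i =>
    (hinit i).trans ((div_le_one hT).2 hCT)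
  have hdet := h.isUnit_det_gnNormalMatrix hσlo hσ hc hij hinit1
  refine ⟨hdet, ?_⟩
  obtain ⟨β, υ, hβ, hυ, hne'⟩ := exists_gnStep_normal_equations a s d M θ t hσ0 hdet
  have hne : ∀ (α : ℝ) (τ : Plane), ∑ i, ∑ m ∈ Finset.range M,
        inner ℝ (unitVec (a m - tagPosition (rot θ) t (s i))) (poseShift θ (s i) α τ) *
        (‖a m - p₀ i‖ + r i m - ‖a m - tagPosition (rot θ) t (s i)‖ +
          inner ℝ (unitVec (a m - tagPosition (rot θ) t (s i))) (poseShift θ (s i) β υ))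
          * (1 / σ i m ^ 2) = 0 := by
    intro α τ
    rw [← hne' α τ]
    refine Finset.sum_congr rfl fun k _ => Finset.sum_congr rfl fun m _ => ?_
    rw [hd, mul_one_div]
  have hshift : ∀ k, ‖poseShift θ (s k) β υ‖ ≤ C₅ / T := by
    refine sq_sum_norm_bound (fun k => ‖poseShift θ (s k) β υ‖)
      (fun k => norm_nonneg _) (by positivity) hT (by positivity) ?_
    have h1 := (Finset.sum_le_sum fun i (_ : i ∈ Finset.univ) =>
      le_sum_inner_mul_of_score_le a (fun m => 1 / σ i m ^ 2) (r i) M (u := 1 / σhi ^ 2) (v := v)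
        (p₀ := p₀ i) (by positivity) (fun m => weight_bounds hσlo hσ i m) (h.score_le i _)
        (h.normal_le i (tagPosition (rot θ) t (s i)) (poseShift θ (s i) β υ)
          (hinit1 i))).trans (hne β υ).le
    have h2 : ∀ k, (A * T + v * ‖tagPosition (rot θ) t (s k) - p₀ k‖ * M) *
        ‖poseShift θ (s k) β υ‖ ≤ (A + v * C₁) * T * ‖poseShift θ (s k) β υ‖ := by
      intro k
      refine mul_le_mul_of_nonneg_right ?_ (norm_nonneg _)
      have h3 : v * ‖tagPosition (rot θ) t (s k) - p₀ k‖ * M ≤ v * (C₁ / T) * M := by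
        gcongr; exact hinit k
      have h4 : v * (C₁ / T) * M = v * C₁ * T := by rw [h.sq_eq]; field_simp
      linarith
    have h5 := Finset.sum_le_sum fun k (_ : k ∈ Finset.univ) => h2 k
    rw [Finset.sum_sub_distrib, ← Finset.mul_sum, h.sq_eq] at h1
    rw [← Finset.mul_sum, h.sq_eq] at h5
    linarith
  have hβ' : |β| ≤ C₆ / T := by
    have h1 := abs_mul_le_of_norm_poseShift_le (hshift i) (hshift j)
    rw [hC₆, div_div, le_div_iff₀ (by positivity)]
    have h2 : 2 * (C₅ / T) * T = 2 * C₅ := by field_simp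
    nlinarith [mul_le_mul_of_nonneg_right h1 hT.le]
  refine ⟨β, υ, hβ, hυ, hβ'.trans ?_, ?_, hne⟩
  · have : 0 ≤ C₆ * ‖s i‖ := by positivity
    exact div_le_div_of_nonneg_right (by linarith) hT.le
  · refine (norm_le_of_norm_poseShift_le (hshift i)).trans ?_
    have : |β| * ‖s i‖ ≤ C₆ / T * ‖s i‖ := by gcongr
    calc C₅ / T + |β| * ‖s i‖ ≤ C₅ / T + C₆ / T * ‖s i‖ := by linarith
      _ = (C₅ + C₆ * ‖s i‖) / T := by ring
      _ ≤ _ := div_le_div_of_nonneg_right (by linarith) hT.le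

/-- The linearization error evaluated at radius `B / T`, second-order remainder `Λ / T ^ 2`, score
`A * T`, oscillation `η * T` and proximity sum `η * T ^ 2`: every term is `O(η + 1 / T)`. -/
theorem linearization_bound_le {A B Λ v η T : ℝ} (hA : 0 ≤ A) (hB : 0 ≤ B) (hΛ : 0 ≤ Λ)
    (hv : 0 ≤ v) (hη : 0 ≤ η) (hT : 1 ≤ T) :
    2 * (η * T * (2 * (B / T)) + A * T * (Λ / T ^ 2)) +
      v * (20 * (B / T) + Λ / T ^ 2) * (16 * (B / T) * (η * T ^ 2) + T ^ 2 * (Λ / T ^ 2)) ≤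
    (4 * B + 2 * A * Λ + v * (20 * B + Λ) * (16 * B + Λ)) * (η + 1 / T) := by
  have hT0 : 0 < T := one_pos.trans_le hT
  have e1 : 2 * (η * T * (2 * (B / T)) + A * T * (Λ / T ^ 2)) = 4 * B * η + 2 * A * Λ * (1 / T) := by
    field_simp; ring
  have e2 : (20 * (B / T) + Λ / T ^ 2) * (16 * (B / T) * (η * T ^ 2) + T ^ 2 * (Λ / T ^ 2)) =
      (20 * B + Λ * (1 / T)) * (16 * B * η + Λ * (1 / T)) := by
    field_simp
  have h1 : 1 / T ≤ 1 := (div_le_one hT0).2 hT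
  have h0 : 0 ≤ 1 / T := by positivity
  rw [e1, mul_assoc v, e2]
  generalize 1 / T = x at *
  have h2 : 20 * B + Λ * x ≤ 20 * B + Λ := by nlinarith
  have h3 : 16 * B * η + Λ * x ≤ (16 * B + Λ) * (η + x) := by
    nlinarith [mul_nonneg hB h0, mul_nonneg hΛ hη]
  have h4 : (20 * B + Λ * x) * (16 * B * η + Λ * x) ≤
      (20 * B + Λ) * ((16 * B + Λ) * (η + x)) := by gcongr
  have h5 := mul_le_mul_of_nonneg_left h4 hv
  have h6 : 4 * B * η + 2 * A * Λ * x ≤ (4 * B + 2 * A * Λ) * (η + x) := by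
    have := mul_nonneg (mul_nonneg hA hΛ) hη
    nlinarith [mul_nonneg hB h0]
  linarith

/-- The weighted sum of squared residuals of one tag at the position `q`. -/
def rangeCost (a : ℕ → Plane) (w r : ℕ → ℝ) (M : ℕ) (p₀ q : Plane) : ℝ :=
  ∑ m ∈ Finset.range M, (‖a m - p₀‖ + r m - ‖a m - q‖) ^ 2 * w m

/-- The weighted sum of squared residuals of one tag, linearized at the position `p`. -/
def linearCost (a : ℕ → Plane) (w r : ℕ → ℝ) (M : ℕ) (p₀ p ℓ : Plane) : ℝ :=
  ∑ m ∈ Finset.range M,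
    (‖a m - p₀‖ + r m - ‖a m - p‖ + inner ℝ (unitVec (a m - p)) ℓ) ^ 2 * w m

theorem linearCost_sub (a : ℕ → Plane) (w r : ℕ → ℝ) (M : ℕ) (p₀ p ℓ ℓ' : Plane) :
    linearCost a w r M p₀ p ℓ - linearCost a w r M p₀ p ℓ' =
      ∑ m ∈ Finset.range M, inner ℝ (unitVec (a m - p)) (ℓ - ℓ') ^ 2 * w m +
      2 * ∑ m ∈ Finset.range M, inner ℝ (unitVec (a m - p)) (ℓ - ℓ') *
        (‖a m - p₀‖ + r m - ‖a m - p‖ + inner ℝ (unitVec (a m - p)) ℓ') * w m := by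
  rw [linearCost, linearCost, Finset.mul_sum, ← Finset.sum_sub_distrib, ← Finset.sum_add_distrib]
  refine Finset.sum_congr rfl fun m _ => ?_
  rw [inner_sub_right]
  ring

theorem RegularSample.abs_rangeCost_sub_linearCost_le (hσlo : 0 < σlo)
    (hσ : ∀ i m, σlo ≤ σ i m ∧ σ i m ≤ σhi) (h : RegularSample a p₀ σ r M T A c)
    {C₁ C S B Λ θ η : ℝ} (hA : 0 ≤ A) (hC₁ : 0 ≤ C₁) (hC : 0 < C) (hS : 0 ≤ S) {t : Plane}
    {k : Fin N} (hSk : ‖s k‖ ≤ S) (hB : C₁ + C * S + C = B) (hΛ : C ^ 2 * S = Λ)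
    (hCT : C ≤ T) (hη : 0 ≤ η) (hinit : ‖tagPosition (rot θ) t (s k) - p₀ k‖ ≤ C₁ / T)
    (hmod : ∀ p q, ‖p - p₀ k‖ ≤ B / T → ‖q - p₀ k‖ ≤ B / T →
      ‖score a (fun m => 1 / σ k m ^ 2 * r k m) M p -
        score a (fun m => 1 / σ k m ^ 2 * r k m) M q‖ ≤ η * T)
    (hclose : ∑ m ∈ Finset.range M, B / T / (B / T + ‖a m - p₀ k‖) ≤ η * M)
    {x : ℝ} {y : Plane} (hx : |x| ≤ C / T) (hy : ‖y‖ ≤ C / T) :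
    |rangeCost a (fun m => 1 / σ k m ^ 2) (r k) M (p₀ k)
        (tagPosition (rot (θ + x)) (t + y) (s k)) -
      linearCost a (fun m => 1 / σ k m ^ 2) (r k) M (p₀ k) (tagPosition (rot θ) t (s k))
        (poseShift θ (s k) x y)| ≤
      (4 * B + 2 * A * Λ + 1 / σlo ^ 2 * (20 * B + Λ) * (16 * B + Λ)) * (η + 1 / T) := by
  have hT : 0 < T := one_pos.trans_le h.one_le
  have hB0 : 0 < B := by rw [← hB]; positivity
  have hΛ0 : 0 ≤ Λ := by rw [← hΛ]; positivity
  have hxS : |x| * ‖s k‖ + ‖y‖ ≤ (C * S + C) / T := by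
    calc |x| * ‖s k‖ + ‖y‖ ≤ C / T * S + C / T := by gcongr
      _ = _ := by ring
  have hxB : (C * S + C) / T ≤ B / T := div_le_div_of_nonneg_right (by linarith) hT.le
  have hx1 : |x| ≤ 1 := hx.trans ((div_le_one hT).2 hCT)
  have hqp0 : ‖tagPosition (rot (θ + x)) (t + y) (s k) - p₀ k‖ ≤ B / T := by
    rw [← sub_add_sub_cancel _ (tagPosition (rot θ) t (s k))]
    refine (norm_add_le _ _).trans ?_
    calc _ ≤ (C * S + C) / T + C₁ / T :=
          add_le_add ((norm_tagPosition_add_sub_le θ x t y (s k)).trans hxS) hinit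
      _ = B / T := by rw [← hB]; ring
  have hlam : ‖tagPosition (rot (θ + x)) (t + y) (s k) - tagPosition (rot θ) t (s k) -
      poseShift θ (s k) x y‖ ≤ Λ / T ^ 2 := by
    refine (norm_tagPosition_linearization_le θ hx1 t y (s k)).trans ?_
    rw [← sq_abs]
    calc |x| ^ 2 * ‖s k‖ ≤ (C / T) ^ 2 * S := by gcongr
      _ = _ := by rw [← hΛ]; ring
  have hp : ‖tagPosition (rot θ) t (s k) - p₀ k‖ ≤ B / T :=
    hinit.trans (div_le_div_of_nonneg_right (by nlinarith) hT.le)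
  have h1 := abs_sum_sq_sub_linearized_le a (fun m => 1 / σ k m ^ 2) (r k) M (v := 1 / σlo ^ 2)
    (κ := B / T) (p₀ := p₀ k) (p := tagPosition (rot θ) t (s k))
    (q := tagPosition (rot (θ + x)) (t + y) (s k))
    (ℓ := poseShift θ (s k) x y) (lam := Λ / T ^ 2) (A := A * T) (B := η * T) (η := η * M)
    (by positivity) (fun m => ⟨by positivity, (weight_bounds hσlo hσ k m).2⟩) (h.score_le k)
    (fun z hz => hmod z _ hz hp) hclose hp hqp0
    (((norm_poseShift_le _ _ _ _).trans hxS).trans hxB) hlam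
  rw [h.sq_eq] at h1
  exact h1.trans (linearization_bound_le hA hB0.le hΛ0 (by positivity) hη h.one_le)

/-- In the exact second-order expansion around the Gauss-Newton step, the gradient term vanishes by
the normal equations and the curvature remains. -/
theorem RegularSample.le_sum_linearCost_sub (hσlo : 0 < σlo)
    (hσ : ∀ i m, σlo ≤ σ i m ∧ σ i m ≤ σhi) (h : RegularSample a p₀ σ r M T A c)
    {θ α β : ℝ} {t τ υ : Plane}
    (hinit : ∀ k, ‖tagPosition (rot θ) t (s k) - p₀ k‖ ≤ 1)
    (hne : ∑ i, ∑ m ∈ Finset.range M,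
        inner ℝ (unitVec (a m - tagPosition (rot θ) t (s i)))
          (poseShift θ (s i) (α - β) (τ - υ)) *
        (‖a m - p₀ i‖ + r i m - ‖a m - tagPosition (rot θ) t (s i)‖ +
          inner ℝ (unitVec (a m - tagPosition (rot θ) t (s i))) (poseShift θ (s i) β υ))
          * (1 / σ i m ^ 2) = 0) :
    ∑ k, 1 / σhi ^ 2 * (c * M * ‖poseShift θ (s k) (α - β) (τ - υ)‖ ^ 2) ≤
      ∑ k, (linearCost a (fun m => 1 / σ k m ^ 2) (r k) M (p₀ k) (tagPosition (rot θ) t (s k))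
        (poseShift θ (s k) α τ) -
      linearCost a (fun m => 1 / σ k m ^ 2) (r k) M (p₀ k) (tagPosition (rot θ) t (s k))
        (poseShift θ (s k) β υ)) := by
  simp only [linearCost_sub, ← poseShift_sub]
  conv_rhs => rw [Finset.sum_add_distrib, ← Finset.mul_sum, hne, mul_zero, add_zero]
  refine Finset.sum_le_sum fun k _ => ?_
  refine (mul_le_mul_of_nonneg_left (h.normal_le k _ _ (hinit k)) (by positivity)).trans ?_
  rw [Finset.mul_sum]
  refine Finset.sum_le_sum fun m _ => ?_
  rw [mul_comm]
  exact mul_le_mul_of_nonneg_left (weight_bounds hσlo hσ k m).1 (sq_nonneg _)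

theorem abs_sub_le_of_sum_norm_poseShift_sq_le {N : ℕ} {s : Fin N → Plane} {θ K ρ T S α : ℝ}
    {τ : Plane} (hK : 0 < K) (hT : 0 < T) (hρ : 0 ≤ ρ) {i j : Fin N} (hS : ‖s i‖ ≤ S)
    (hij : s i ≠ s j)
    (h : ∑ k, K * T ^ 2 * ‖poseShift θ (s k) α τ‖ ^ 2 ≤ ρ) :
    |α| ≤ 2 / ‖s i - s j‖ * (√(ρ / K) / T) ∧
      ‖τ‖ ≤ √(ρ / K) / T + 2 / ‖s i - s j‖ * (√(ρ / K) / T) * S := by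
  have hg : 0 < ‖s i - s j‖ := norm_pos_iff.2 (sub_ne_zero.2 hij)
  have hshift : ∀ k, ‖poseShift θ (s k) α τ‖ ≤ √(ρ / K) / T := by
    intro k
    have h2 := (Finset.single_le_sum (f := fun k => K * T ^ 2 * ‖poseShift θ (s k) α τ‖ ^ 2)
      (fun k _ => by positivity) (Finset.mem_univ k)).trans h
    refine abs_le_of_sq_le_sq' ?_ (by positivity) |>.2
    rw [div_pow, Real.sq_sqrt (by positivity), le_div_iff₀ (by positivity), le_div_iff₀ hK]
    linarith
  have hα : |α| ≤ 2 / ‖s i - s j‖ * (√(ρ / K) / T) := by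
    rw [div_mul_eq_mul_div, le_div_iff₀ hg]
    exact abs_mul_le_of_norm_poseShift_le (hshift i) (hshift j)
  refine ⟨hα, (norm_le_of_norm_poseShift_le (hshift i)).trans ?_⟩
  gcongr

/-- On a regular sample, and up to the modulus of continuity of the scores, the Gauss-Newton step
from a root-n-consistent pose agrees with the maximum likelihood estimate to first order. -/
theorem exists_gn_sub_ml_bound
    {R₀ : Matrix (Fin 2) (Fin 2) ℝ} {t₀ : Plane} (hR₀ : R₀ ∈ SO2) (hσlo : 0 < σlo)
    (hσ : ∀ i m, σlo ≤ σ i m ∧ σ i m ≤ σhi) {C₁ : ℝ} (hC₁ : 0 ≤ C₁) (hc : 0 < c) (hA : 0 ≤ A)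
    {i j : Fin N} (hij : s i ≠ s j) :
    ∃ B > 0, ∃ D > 0, ∃ T₀, ∀ (M : ℕ) (T θ η : ℝ) (t : Plane) (r d : Fin N → ℕ → ℝ)
      (R : Matrix (Fin 2) (Fin 2) ℝ) (t' : Plane),
      (∀ i m, d i m = ‖a m - tagPosition R₀ t₀ (s i)‖ + r i m) →
      RegularSample a (fun i => tagPosition R₀ t₀ (s i)) σ r M T A c → T₀ ≤ T →
      (∀ i, ‖tagPosition (rot θ) t (s i) - tagPosition R₀ t₀ (s i)‖ ≤ C₁ / T) →
      IsMLEstimate a s σ d M R t' → 0 ≤ η →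
      (∀ i p q, ‖p - tagPosition R₀ t₀ (s i)‖ ≤ B / T → ‖q - tagPosition R₀ t₀ (s i)‖ ≤ B / T →
        ‖score a (fun m => 1 / σ i m ^ 2 * r i m) M p -
          score a (fun m => 1 / σ i m ^ 2 * r i m) M q‖ ≤ η * T) →
      (∀ i, ∑ m ∈ Finset.range M, B / T / (B / T + ‖a m - tagPosition R₀ t₀ (s i)‖) ≤ η * M) →
      IsUnit (gnNormalMatrix a s σ M θ t).det ∧
      (∀ k l, |gnRotation a s σ d M θ t k l - R k l| ≤ D * √(η + 1 / T) / T) ∧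
      (∀ k, |gnTranslation a s σ d M θ t k - t' k| ≤ D * √(η + 1 / T) / T) := by
  have hσ0 : ∀ i m, 0 < σ i m := fun i m => hσlo.trans_le (hσ i m).1
  have hσhi : 0 < σhi := (hσ0 i 0).trans_le (hσ i 0).2
  obtain ⟨C₃, hC₃, hpML⟩ := exists_pose_of_isMLEstimate (a := a) (s := s) (t₀ := t₀)
    hR₀ hσlo hσ hC₁ hc hA hij
  obtain ⟨C₄, hC₄, hpGN⟩ := exists_pose_of_gnStep (a := a) (s := s)
    (p₀ := fun i => tagPosition R₀ t₀ (s i)) hσlo hσ hC₁ hc hA hij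
  obtain ⟨C, hC⟩ : ∃ C, C = C₃ + C₄ := ⟨_, rfl⟩
  have hC0 : 0 < C := by rw [hC]; positivity
  obtain ⟨S, hS⟩ : ∃ S, S = ∑ k, ‖s k‖ := ⟨_, rfl⟩
  have hSk : ∀ k, ‖s k‖ ≤ S := fun k => hS ▸
    Finset.single_le_sum (f := fun k => ‖s k‖) (fun k _ => norm_nonneg _) (Finset.mem_univ k)
  have hS0 : 0 ≤ S := (norm_nonneg _).trans (hSk i)
  obtain ⟨B, hB⟩ : ∃ B, C₁ + C * S + C = B := ⟨_, rfl⟩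
  have hB0 : 0 < B := by rw [← hB]; positivity
  obtain ⟨Λ, hΛ⟩ : ∃ Λ, C ^ 2 * S = Λ := ⟨_, rfl⟩
  have hΛ0 : 0 ≤ Λ := by rw [← hΛ]; positivity
  obtain ⟨E, hE⟩ : ∃ E, 4 * B + 2 * A * Λ + 1 / σlo ^ 2 * (20 * B + Λ) * (16 * B + Λ) = E :=
    ⟨_, rfl⟩
  have hE0 : 0 < E := by rw [← hE]; positivity
  have hg : 0 < ‖s i - s j‖ := norm_pos_iff.2 (sub_ne_zero.2 hij)
  obtain ⟨K, hK⟩ : ∃ K, 1 / σhi ^ 2 * c = K := ⟨_, rfl⟩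
  have hK0 : 0 < K := by rw [← hK]; positivity
  obtain ⟨D₀, hD₀⟩ : ∃ D₀, √(2 * N * E / K) = D₀ := ⟨_, rfl⟩
  have hD₀0 : 0 ≤ D₀ := by rw [← hD₀]; positivity
  obtain ⟨G, hG⟩ : ∃ G, 2 / ‖s i - s j‖ = G := ⟨_, rfl⟩
  have hG0 : 0 < G := by rw [← hG]; positivity
  -- The `+ 1` makes the constant positive. The threshold `C + C₁` makes both `C / T` and `C₁ / T`
  -- at most one.
  refine ⟨B, hB0, D₀ * (1 + G * (1 + S)) + 1, by positivity, C + C₁, ?_⟩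
  intro M T θ η t r d R t' hd h hT₀ hinit hML hη0 hmod hclose
  have hT : 0 < T := one_pos.trans_le h.one_le
  obtain ⟨α, τ, rfl, rfl, hα, hτ⟩ := hpML M T θ t r d R t' hd h hinit hML
  obtain ⟨hdet, β, υ, hβ, hυ, hβC, hυC, hne⟩ := hpGN M T θ t r d hd h (by linarith) hinit
  refine ⟨hdet, ?_⟩
  have hαC : |α| ≤ C / T := hα.trans (div_le_div_of_nonneg_right (by linarith) hT.le)
  have hτC : ‖τ‖ ≤ C / T := hτ.trans (div_le_div_of_nonneg_right (by linarith) hT.le)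
  replace hβC : |β| ≤ C / T := hβC.trans (div_le_div_of_nonneg_right (by linarith) hT.le)
  replace hυC : ‖υ‖ ≤ C / T := hυC.trans (div_le_div_of_nonneg_right (by linarith) hT.le)
  have hcost := fun k (x : ℝ) (y : Plane) (hx : |x| ≤ C / T) (hy : ‖y‖ ≤ C / T) =>
    h.abs_rangeCost_sub_linearCost_le hσlo hσ hA hC₁ hC0 hS0 (hSk k) hB hΛ (by linarith) hη0
      (hinit k) (hmod k) (hclose k) hx hy
  rw [hE] at hcost
  have hquad := (h.le_sum_linearCost_sub hσlo hσ (fun k => (hinit k).trans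
    ((div_le_one hT).2 (by linarith))) (hne (α - β) (τ - υ)))
  have hmin : mlObjective a s σ d M (rot (θ + α), t + τ) ≤
        mlObjective a s σ d M (rot (θ + β), t + υ) :=
    hML.2 (Set.mk_mem_prod (rot_mem_SO2 _) (Set.mem_univ _))
  simp only [mlObjective, hd, div_eq_mul_one_div (_ ^ 2 : ℝ)] at hmin
  have hsum : ∑ k, K * T ^ 2 * ‖poseShift θ (s k) (α - β) (τ - υ)‖ ^ 2 ≤
      2 * N * E * (η + 1 / T) := by
    calc ∑ k, K * T ^ 2 * ‖poseShift θ (s k) (α - β) (τ - υ)‖ ^ 2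
        = ∑ k, 1 / σhi ^ 2 * (c * M * ‖poseShift θ (s k) (α - β) (τ - υ)‖ ^ 2) := by
          simp only [h.sq_eq, ← hK, mul_assoc]
      _ ≤ _ := hquad
      -- Exchange the linearized cost for the true one at both poses, at a price of one
      -- linearization error each. The difference of true costs is then nonpositive by minimality.
      _ ≤ ∑ k, (rangeCost a (fun m => 1 / σ k m ^ 2) (r k) M (tagPosition R₀ t₀ (s k))
            (tagPosition (rot (θ + α)) (t + τ) (s k)) -
          rangeCost a (fun m => 1 / σ k m ^ 2) (r k) M (tagPosition R₀ t₀ (s k))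
            (tagPosition (rot (θ + β)) (t + υ) (s k)) + 2 * (E * (η + 1 / T))) := by
          refine Finset.sum_le_sum fun k _ => ?_
          have h1 := (abs_le.1 (hcost k α τ hαC hτC)).1
          have h2 := (abs_le.1 (hcost k β υ hβC hυC)).2
          linarith
      _ ≤ 0 + ∑ _k : Fin N, 2 * (E * (η + 1 / T)) := by
          rw [Finset.sum_add_distrib, Finset.sum_sub_distrib]
          exact add_le_add_left (sub_nonpos.2 hmin) _
      _ = _ := by simp; ring
  have hηT : 0 ≤ η + 1 / T := by positivity
  obtain ⟨h1, h2⟩ := abs_sub_le_of_sum_norm_poseShift_sq_le hK0 hT (by positivity) (hSk i) hij hsum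
  rw [mul_div_right_comm, Real.sqrt_mul (by positivity), hD₀, hG] at h1 h2
  obtain ⟨ρ, hρ⟩ : ∃ ρ, D₀ * √(η + 1 / T) / T = ρ := ⟨_, rfl⟩
  have hρ0 : 0 ≤ ρ := by rw [← hρ]; positivity
  have hfin : (D₀ * (1 + G * (1 + S)) + 1) * √(η + 1 / T) / T =
      ρ + G * ρ + G * ρ * S + √(η + 1 / T) / T := by
    rw [← hρ]; ring
  rw [hρ] at h1 h2
  have n1 : 0 ≤ G * ρ := by positivity
  have n2 : 0 ≤ G * ρ * S := by positivity
  have n3 : 0 ≤ √(η + 1 / T) / T := by positivity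
  refine ⟨fun k l => ?_, fun k => ?_⟩
  · rw [hβ, hfin]
    refine (abs_rot_sub_rot_apply_le _ _ k l).trans ?_
    rw [add_sub_add_left_eq_sub, abs_sub_comm]
    linarith
  · rw [hυ, hfin, ← PiLp.sub_apply, add_sub_add_left_eq_sub]
    refine (PiLp.norm_apply_le (υ - τ) k).trans ?_
    rw [norm_sub_rev]
    linarith

end Deterministic

/-! ### Initial estimate, noise moments and uniformity over the tags -/

/-- Since `R₀` competes in the projection, `X` is within Frobenius distance `2 * x` of `rot θ`;
hence the entries of `rot θ` and `R₀` differ by at most `3 * x`. -/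
theorem norm_tagPosition_sub_le_of_projection {R₀ X : Matrix (Fin 2) (Fin 2) ℝ} {t₀ t : Plane}
    {θ x : ℝ} (hR₀ : R₀ ∈ SO2) (hθ : IsSO2Projection X (rot θ))
    (hX : ∀ k l, |X k l - R₀ k l| ≤ x) (ht : ∀ k, |t k - t₀ k| ≤ x) (s : Plane) :
    ‖tagPosition (rot θ) t s - tagPosition R₀ t₀ s‖ ≤ (12 * ‖s‖ + 2) * x := by
  have hx : 0 ≤ x := (abs_nonneg _).trans (ht 0)
  have habs : ∀ v : Plane, ‖v‖ ≤ |v 0| + |v 1| := fun v => by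
    refine abs_le_of_sq_le_sq' ?_ (by positivity) |>.2
    rw [norm_sq_plane, ← sq_abs (v 0), ← sq_abs (v 1)]
    nlinarith [abs_nonneg (v 0), abs_nonneg (v 1)]
  have hF : frobeniusSq (X - rot θ) ≤ frobeniusSq (X - R₀) := hθ.2 hR₀
  have hF' : frobeniusSq (X - R₀) ≤ 4 * x ^ 2 := by
    have h1 : ∀ k l, (X k l - R₀ k l) ^ 2 ≤ x ^ 2 := fun k l => by
      rw [← sq_abs]; exact pow_le_pow_left₀ (abs_nonneg _) (hX k l) 2
    simp only [frobeniusSq, Fin.sum_univ_two, Matrix.sub_apply]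
    linarith [h1 0 0, h1 0 1, h1 1 0, h1 1 1]
  have hW : ∀ k l, |rot θ k l - R₀ k l| ≤ 3 * x := by
    intro k l
    have h1 : (X k l - rot θ k l) ^ 2 ≤ (2 * x) ^ 2 := by
      have h2 : (X k l - rot θ k l) ^ 2 ≤ frobeniusSq (X - rot θ) := by
        unfold frobeniusSq
        refine le_trans ?_ (Finset.single_le_sum (f := fun i => ∑ j, (X - rot θ) i j ^ 2)
          (fun i _ => Finset.sum_nonneg fun j _ => sq_nonneg _) (Finset.mem_univ k))
        exact Finset.single_le_sum (f := fun j => (X - rot θ) k j ^ 2)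
          (fun j _ => sq_nonneg _) (Finset.mem_univ l)
      linarith
    have h3 := abs_le_of_sq_le_sq h1 (by positivity)
    have h4 : |rot θ k l - R₀ k l| ≤ |X k l - R₀ k l| + |X k l - rot θ k l| := by
      have := abs_sub (X k l - R₀ k l) (X k l - rot θ k l)
      rwa [sub_sub_sub_cancel_left] at this
    linarith [hX k l]
  have hs : ∀ k, |s k| ≤ ‖s‖ := fun k => PiLp.norm_apply_le s k
  set e : Plane := WithLp.toLp 2 ((rot θ - R₀) *ᵥ s.ofLp) with he
  have hek : ∀ k, |e k| ≤ 6 * x * ‖s‖ := by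
    intro k
    have h1 : e k = (rot θ k 0 - R₀ k 0) * s 0 + (rot θ k 1 - R₀ k 1) * s 1 := by
      fin_cases k <;> simp [he]
    rw [h1]
    refine (abs_add_le _ _).trans ?_
    rw [abs_mul, abs_mul]
    have h2 := mul_le_mul (hW k 0) (hs 0) (abs_nonneg _) (by positivity)
    have h3 := mul_le_mul (hW k 1) (hs 1) (abs_nonneg _) (by positivity)
    linarith
  have hsplit : tagPosition (rot θ) t s - tagPosition R₀ t₀ s = e + (t - t₀) := by
    rw [he, Matrix.sub_mulVec, WithLp.toLp_sub, tagPosition, tagPosition]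
    abel
  rw [hsplit]
  refine (norm_add_le _ _).trans ?_
  have h1 := habs e
  have h2 := habs (t - t₀)
  simp only [PiLp.sub_apply] at h2
  linarith [hek 0, hek 1, ht 0, ht 1]

section Noise

variable {Ω : Type*} [MeasurableSpace Ω] {P : Measure Ω} {N : ℕ} {σ : Fin N → ℕ → ℝ}
  {r : Fin N → ℕ → Ω → ℝ}

theorem memLp_of_map_eq_gaussianReal {X : Ω → ℝ} (hX : Measurable X) {v : NNReal}
    (h : P.map X = gaussianReal 0 v) : MemLp X 2 P := by
  have h1 : MemLp id 2 (P.map X) := by rw [h]; exact memLp_id_gaussianReal 2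
  exact (memLp_map_measure_iff measurable_id.aestronglyMeasurable hX.aemeasurable).1 h1

theorem integral_eq_zero_of_map_eq_gaussianReal {X : Ω → ℝ} (hX : Measurable X) {v : NNReal}
    (h : P.map X = gaussianReal 0 v) : ∫ ω, X ω ∂P = 0 := by
  have h1 := integral_map (μ := P) hX.aemeasurable (f := fun x : ℝ => x)
    measurable_id.aestronglyMeasurable
  rw [← h1, h, integral_id_gaussianReal]

theorem integral_sq_of_map_eq_gaussianReal {X : Ω → ℝ} (hX : Measurable X) {v : NNReal}
    (h : P.map X = gaussianReal 0 v) : ∫ ω, X ω ^ 2 ∂P = v := by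
  have h1 := integral_map (μ := P) hX.aemeasurable (f := fun x : ℝ => x ^ 2)
    (measurable_id.pow_const 2).aestronglyMeasurable
  rw [← h1, h]
  have h2 := variance_fun_id_gaussianReal (μ := 0) (v := v)
  rw [variance_of_integral_eq_zero measurable_id'.aemeasurable integral_id_gaussianReal] at h2
  exact h2

theorem iIndepFun_scaled_noise
    (hr_indep : iIndepFun (fun p : Fin N × ℕ => r p.1 p.2) P) (i : Fin N) :
    iIndepFun (fun m ω => 1 / σ i m ^ 2 * r i m ω) P :=
  (hr_indep.precomp (g := fun m : ℕ => (i, m)) fun _ _ h => (Prod.mk.inj h).2).comp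
    (fun m x => 1 / σ i m ^ 2 * x) fun _ => measurable_const_mul _

theorem integral_scaled_noise_sq_le {σlo : ℝ} (hσlo : 0 < σlo) (hσ : ∀ i m, σlo ≤ σ i m)
    (hr_meas : ∀ i m, Measurable (r i m))
    (hr_law : ∀ i m, P.map (r i m) = gaussianReal 0 (σ i m ^ 2).toNNReal) (i : Fin N) (m : ℕ) :
    ∫ ω, (1 / σ i m ^ 2 * r i m ω) ^ 2 ∂P ≤ 1 / σlo ^ 2 := by
  have h0 : 0 < σ i m := hσlo.trans_le (hσ i m)
  simp only [mul_pow]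
  rw [integral_const_mul, integral_sq_of_map_eq_gaussianReal (hr_meas i m) (hr_law i m),
    Real.coe_toNNReal _ (by positivity)]
  have e : (1 / σ i m ^ 2) ^ 2 * σ i m ^ 2 = 1 / σ i m ^ 2 := by field_simp
  rw [e]
  exact one_div_le_one_div_of_le (by positivity) (pow_le_pow_left₀ hσlo.le (hσ i m) 2)

end Noise

theorem exists_pos_le_of_finite {ι : Type*} [Finite ι] (f : ι → ℝ) (hf : ∀ i, 0 < f i) :
    ∃ c > 0, ∀ i, c ≤ f i := by
  cases isEmpty_or_nonempty ι
  · exact ⟨1, one_pos, fun i => isEmptyElim i⟩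
  · obtain ⟨i, hi⟩ := Finite.exists_min f
    exact ⟨f i, hf i, hi⟩

theorem exists_eventually_nondegenerate {N : ℕ} {a : ℕ → Plane} {μ : ProbabilityMeasure Plane}
    (hμ : Tendsto (empirical a) atTop (𝓝 μ))
    (hline : ∀ L : AffineSubspace ℝ Plane, Module.finrank ℝ L.direction = 1 →
      (μ : Measure Plane) (L : Set Plane) ≠ 1) (p₀ : Fin N → Plane) :
    ∃ c > 0, ∀ᶠ M : ℕ in atTop, (∀ i p, c * M * ‖p - p₀ i‖ ^ 2 ≤
        ∑ m ∈ Finset.range M, (‖a m - p‖ - ‖a m - p₀ i‖) ^ 2) ∧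
      ∀ i p ℓ, ‖p - p₀ i‖ ≤ 1 →
        c * M * ‖ℓ‖ ^ 2 ≤ ∑ m ∈ Finset.range M, inner ℝ (unitVec (a m - p)) ℓ ^ 2 := by
  choose c hc h using fun i => exists_eventually_le_sum_sq_norm_sub_norm hμ hline (p₀ i)
  choose c' hc' h' using fun i => exists_eventually_le_sum_sq_inner_unitVec hμ hline (p₀ i)
  obtain ⟨b, hb, hbc⟩ := exists_pos_le_of_finite (fun i => min (c i) (c' i))
    fun i => lt_min (hc i) (hc' i)
  refine ⟨b, hb, ?_⟩
  filter_upwards [eventually_all.2 h, eventually_all.2 h'] with M h h'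
  refine ⟨fun i p => le_trans ?_ (h i p), fun i p ℓ hp => le_trans ?_ (h' i p ℓ hp)⟩
  · have := (hbc i).trans (min_le_left _ _)
    gcongr
  · have := (hbc i).trans (min_le_right _ _)
    gcongr

theorem div_add_norm_le_div_add_norm {κ κ' x : ℝ} (hκ : 0 < κ) (h : κ ≤ κ') (hx : 0 ≤ x) :
    κ / (κ + x) ≤ κ' / (κ' + x) := by
  rw [div_le_div_iff₀ (by positivity) (by linarith)]
  nlinarith

/-- The radius `B / √M` eventually falls below the fixed `κ` of the no-atom estimate, and the ratio
is increasing in `κ`. -/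
theorem exists_eventually_forall_sum_div_le {N : ℕ} {a : ℕ → Plane} {μ : ProbabilityMeasure Plane}
    (hμ : Tendsto (empirical a) atTop (𝓝 μ)) {p₀ : Fin N → Plane}
    (hp : ∀ i, (μ : Measure Plane) {p₀ i} = 0) {B η : ℝ} (hB : 0 < B) (hη : 0 < η) :
    ∀ᶠ M : ℕ in atTop, ∀ i,
      ∑ m ∈ Finset.range M, B / √(M : ℝ) / (B / √(M : ℝ) + ‖a m - p₀ i‖) ≤ η * M := by
  refine eventually_all.2 fun i => ?_
  obtain ⟨κ, hκ, h⟩ := exists_eventually_sum_div_le hμ (hp i) hη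
  have hsqrt : Tendsto (fun M : ℕ => B / √(M : ℝ)) atTop (𝓝 0) :=
    (Real.tendsto_sqrt_atTop.comp tendsto_natCast_atTop_atTop).const_div_atTop B
  filter_upwards [h, hsqrt.eventually (ge_mem_nhds hκ), eventually_gt_atTop 0] with M h hM hM0
  have hM' : (0 : ℝ) < M := by exact_mod_cast hM0
  refine le_trans (Finset.sum_le_sum fun m _ => ?_) h
  exact div_add_norm_le_div_add_norm (by positivity) hM (norm_nonneg _)

theorem abs_le_of_div_rootRate_le {N M : ℕ} (hN : 0 < N) (hM : 0 < M) {x C : ℝ}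
    (h : |x / rootRate N M| ≤ C) : |x| ≤ C / √(M : ℝ) := by
  have hN' : (1 : ℝ) ≤ N := by exact_mod_cast hN
  have hM' : (0 : ℝ) < M := by exact_mod_cast hM
  rw [rootRate, div_div_eq_mul_div, div_one, abs_mul, abs_of_nonneg (Real.sqrt_nonneg _),
    Nat.cast_mul, Real.sqrt_mul (by positivity)] at h
  rw [le_div_iff₀ (by positivity)]
  refine le_trans ?_ h
  have h1 : 1 ≤ √(N : ℝ) := Real.one_le_sqrt.2 hN'
  have h2 : 0 ≤ |x| * √(M : ℝ) := by positivity
  nlinarith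

theorem measure_iUnion_le_card_mul {Ω ι : Type*} [MeasurableSpace Ω] (P : Measure Ω) [Fintype ι]
    (E : ι → Set Ω) {e : ℝ} (h : ∀ i, P (E i) ≤ ENNReal.ofReal e) :
    P (⋃ i, E i) ≤ ENNReal.ofReal (Fintype.card ι * e) := by
  refine (measure_iUnion_fintype_le P E).trans ((Finset.sum_le_sum fun i _ => h i).trans ?_)
  rw [Finset.sum_const, Finset.card_univ, ENNReal.ofReal_mul (by positivity),
    ENNReal.ofReal_natCast, nsmul_eq_mul]

/-! ### Assembling the exceptional events -/

/-- With probability close to one, the Gauss-Newton step is well posed and agrees with the maximum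
likelihood estimate up to a small multiple of the root rate. -/
theorem eventually_measure_gn_sub_ml_le
    {Ω : Type*} [MeasurableSpace Ω] (P : Measure Ω) [IsProbabilityMeasure P]
    {N : ℕ} (a : ℕ → Plane) (s : Fin N → Plane)
    (R₀ : Matrix (Fin 2) (Fin 2) ℝ) (hR₀ : R₀ ∈ SO2) (t₀ : Plane)
    (σ : Fin N → ℕ → ℝ) (σlo σhi : ℝ) (hσlo : 0 < σlo)
    (hσ : ∀ i m, σlo ≤ σ i m ∧ σ i m ≤ σhi)
    (r : Fin N → ℕ → Ω → ℝ) (hr_meas : ∀ i m, Measurable (r i m))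
    (hr_indep : iIndepFun (fun p : Fin N × ℕ => r p.1 p.2) P)
    (hr_law : ∀ i m, P.map (r i m) = gaussianReal 0 (σ i m ^ 2).toNNReal)
    (μ : ProbabilityMeasure Plane) (hμ : Tendsto (empirical a) atTop (𝓝 μ))
    {i j : Fin N} (hij : s i ≠ s j)
    (hline : ∀ L : AffineSubspace ℝ Plane, Module.finrank ℝ L.direction = 1 →
      (μ : Measure Plane) (L : Set Plane) ≠ 1)
    (hatom : ∀ i, (μ : Measure Plane) {tagPosition R₀ t₀ (s i)} = 0)
    (RML : ℕ → Ω → Matrix (Fin 2) (Fin 2) ℝ) (tML : ℕ → Ω → Plane)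
    (hML : ∀ M, ∀ᵐ ω ∂P,
      IsMLEstimate a s σ (rangeMeasurement a s R₀ t₀ r ω) M (RML M ω) (tML M ω))
    (Rhat : ℕ → Ω → Matrix (Fin 2) (Fin 2) ℝ) (that : ℕ → Ω → Plane)
    (hRhat : ∀ k l, IsBigOp P (fun M ω => Rhat M ω k l - R₀ k l) (rootRate N))
    (hthat : ∀ k, IsBigOp P (fun M ω => that M ω k - t₀ k) (rootRate N))
    (θhat : ℕ → Ω → ℝ)
    (hθhat : ∀ M, ∀ᵐ ω ∂P, IsSO2Projection (Rhat M ω) (rot (θhat M ω)))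
    {tol e : ℝ} (htol : 0 < tol) (he : 0 < e) :
    ∀ᶠ M : ℕ in atTop, P {ω | ¬ (IsUnit (gnNormalMatrix a s σ M (θhat M ω) (that M ω)).det ∧
      (∀ k l, |gnRotation a s σ (rangeMeasurement a s R₀ t₀ r ω) M (θhat M ω) (that M ω) k l
        - RML M ω k l| ≤ tol / √(M : ℝ)) ∧
      (∀ k, |gnTranslation a s σ (rangeMeasurement a s R₀ t₀ r ω) M (θhat M ω) (that M ω) k
        - tML M ω k| ≤ tol / √(M : ℝ)))} ≤ ENNReal.ofReal e := by
  have hN : 0 < N := i.pos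
  set p₀ : Fin N → Plane := fun i => tagPosition R₀ t₀ (s i) with hp₀
  set ε : Fin N → ℕ → Ω → ℝ := fun i m ω => 1 / σ i m ^ 2 * r i m ω with hε
  have hεm : ∀ i m, Measurable (ε i m) := fun i m => (hr_meas i m).const_mul _
  have hεind : ∀ i, iIndepFun (ε i) P := fun i => iIndepFun_scaled_noise hr_indep i
  have hε2 : ∀ i m, MemLp (ε i m) 2 P := fun i m =>
    (memLp_of_map_eq_gaussianReal (hr_meas i m) (hr_law i m)).const_mul _
  have hε0 : ∀ i m, ∫ ω, ε i m ω ∂P = 0 := fun i m => by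
    rw [hε, integral_const_mul, integral_eq_zero_of_map_eq_gaussianReal (hr_meas i m) (hr_law i m),
      mul_zero]
  obtain ⟨v, hv⟩ : ∃ v, v = 1 / σlo ^ 2 := ⟨_, rfl⟩
  have hv0 : 0 < v := by rw [hv]; positivity
  have hεv : ∀ i m, ∫ ω, ε i m ω ^ 2 ∂P ≤ v := fun i m => by
    rw [hv]
    exact integral_scaled_noise_sq_le hσlo (fun i m => (hσ i m).1) hr_meas hr_law i m
  -- The budget `e` is shared by the four entries of the rotation, the two of the translation, and
  -- for each tag one score bound and one oscillation bound.
  obtain ⟨e₁, he₁, hee⟩ : ∃ e₁ : ℝ, 0 < e₁ ∧ 4 * e₁ + 2 * e₁ + N * e₁ + N * e₁ = e :=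
    ⟨e / (6 + 2 * N), by positivity, by field_simp; ring⟩
  have he₁' : 0 < ENNReal.ofReal e₁ := ENNReal.ofReal_pos.2 he₁
  choose CR hCR using fun k l => hRhat k l (ENNReal.ofReal e₁) he₁'
  choose Ct hCt using fun k => hthat k (ENNReal.ofReal e₁) he₁'
  obtain ⟨C₀, hC₀, hCR', hCt'⟩ : ∃ C₀ : ℝ, 0 ≤ C₀ ∧ (∀ k l, CR k l ≤ C₀) ∧ ∀ k, Ct k ≤ C₀ := by
    refine ⟨∑ k, ∑ l, |CR k l| + ∑ k, |Ct k|, by positivity, fun k l => ?_, fun k => ?_⟩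
    · refine (le_abs_self _).trans (le_add_of_le_of_nonneg ?_ (by positivity))
      exact (Finset.single_le_sum (f := fun l => |CR k l|) (fun _ _ => abs_nonneg _)
        (Finset.mem_univ l)).trans (Finset.single_le_sum (f := fun k => ∑ l, |CR k l|)
          (fun _ _ => by positivity) (Finset.mem_univ k))
    · refine (le_abs_self _).trans (le_add_of_nonneg_of_le (by positivity) ?_)
      exact Finset.single_le_sum (f := fun k => |Ct k|) (fun _ _ => abs_nonneg _)
        (Finset.mem_univ k)
  obtain ⟨S, hS⟩ : ∃ S, ∀ k, ‖s k‖ ≤ S := ⟨∑ k, ‖s k‖, fun k =>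
    Finset.single_le_sum (f := fun k => ‖s k‖) (fun _ _ => norm_nonneg _) (Finset.mem_univ k)⟩
  have hS0 : 0 ≤ S := (norm_nonneg _).trans (hS i)
  obtain ⟨A, hA, hAe⟩ : ∃ A : ℝ, 0 < A ∧ 1000 * v / A ^ 2 ≤ e₁ := by
    refine ⟨√(1000 * v / e₁), by positivity, ?_⟩
    rw [Real.sq_sqrt (by positivity)]
    field_simp
    exact le_rfl
  obtain ⟨c, hc, hnondeg⟩ := exists_eventually_nondegenerate hμ hline p₀
  obtain ⟨B, hB, D, hD, T₀, hmain⟩ := exists_gn_sub_ml_bound (a := a) (s := s) (t₀ := t₀) hR₀ hσlo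
    hσ (C₁ := (12 * S + 2) * C₀) (by positivity) hc hA.le hij
  -- Once `1 / T ≤ η`, the deterministic error `D * √(η + 1 / T)` is at most `tol`.
  obtain ⟨η, hη, hηtol⟩ : ∃ η : ℝ, 0 < η ∧ D * √(2 * η) = tol := by
    refine ⟨(tol / D) ^ 2 / 2, by positivity, ?_⟩
    rw [mul_div_cancel₀ _ two_ne_zero, Real.sqrt_sq (by positivity), mul_div_cancel₀ _ hD.ne']
  -- Markov's inequality at level `η * T` needs a finer proximity level `η'`; `η' ≤ η` lets the same
  -- proximity bound serve in the deterministic part.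
  obtain ⟨η', hη', hη'η, hη'e⟩ : ∃ η' : ℝ, 0 < η' ∧ η' ≤ η ∧ 2000 * v * η' / η ^ 2 ≤ e₁ := by
    refine ⟨min η (e₁ * η ^ 2 / (2000 * v)), by positivity, min_le_left _ _, ?_⟩
    rw [div_le_iff₀ (by positivity), ← le_div_iff₀' (by positivity)]
    exact min_le_right _ _
  have hclose := exists_eventually_forall_sum_div_le (p₀ := p₀) hμ hatom hB hη'
  have hTlim : Tendsto (fun M : ℕ => √(M : ℝ)) atTop atTop :=
    Real.tendsto_sqrt_atTop.comp tendsto_natCast_atTop_atTop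
  filter_upwards [eventually_all.2 fun k => eventually_all.2 (hCR k), eventually_all.2 hCt,
    hnondeg, hclose, hTlim.eventually_ge_atTop T₀, hTlim.eventually_ge_atTop 1,
    hTlim.eventually_ge_atTop (1 / η), eventually_gt_atTop 0]
    with M hCR hCt hnondeg hclose hT₀ hT1 hTη hM0
  have hM' : (0 : ℝ) < M := by exact_mod_cast hM0
  obtain ⟨T, hT⟩ : ∃ T, T = √(M : ℝ) := ⟨_, rfl⟩
  have hTsq : (M : ℝ) = T ^ 2 := by rw [hT, Real.sq_sqrt hM'.le]
  rw [← hT] at hT₀ hT1 hTη hclose ⊢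
  have hTpos : 0 < T := one_pos.trans_le hT1
  set E₁ : Fin 2 × Fin 2 → Set Ω := fun k =>
    {ω | CR k.1 k.2 < |(Rhat M ω k.1 k.2 - R₀ k.1 k.2) / rootRate N M|} with hE₁
  set E₂ : Fin 2 → Set Ω := fun k => {ω | Ct k < |(that M ω k - t₀ k) / rootRate N M|} with hE₂
  set E₃ : Fin N → Set Ω := fun k => {ω | ∃ p, A * T < ‖score a (fun m => ε k m ω) M p‖} with hE₃
  set E₄ : Fin N → Set Ω := fun k => {ω | ∃ p q, ‖p - p₀ k‖ ≤ B / T ∧ ‖q - p₀ k‖ ≤ B / T ∧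
    η * T < ‖score a (fun m => ε k m ω) M p - score a (fun m => ε k m ω) M q‖} with hE₄
  set E₅ : Set Ω := {ω | ¬ (IsMLEstimate a s σ (rangeMeasurement a s R₀ t₀ r ω) M (RML M ω)
    (tML M ω) ∧ IsSO2Projection (Rhat M ω) (rot (θhat M ω)))} with hE₅
  have hP₁ : P (⋃ k, E₁ k) ≤ ENNReal.ofReal (4 * e₁) := by
    have := measure_iUnion_le_card_mul P E₁ fun k => hCR k.1 k.2
    convert this using 2
    norm_num
  have hP₂ : P (⋃ k, E₂ k) ≤ ENNReal.ofReal (2 * e₁) := by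
    have := measure_iUnion_le_card_mul P E₂ hCt
    convert this using 2
    norm_num
  have hP₃ : P (⋃ k, E₃ k) ≤ ENNReal.ofReal (N * e₁) := by
    have := measure_iUnion_le_card_mul P E₃ fun k =>
      (measure_exists_norm_score_gt_le a M (ε k) (hεm k) (hεind k) (hε2 k) (hε0 k) (hεv k)
        (η := A * T) (by positivity)).trans (ENNReal.ofReal_le_ofReal (by
          refine le_trans (le_of_eq ?_) hAe
          rw [hTsq]; field_simp))
    rwa [Fintype.card_fin] at this
  have hP₄ : P (⋃ k, E₄ k) ≤ ENNReal.ofReal (N * e₁) := by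
    have := measure_iUnion_le_card_mul P E₄ fun k =>
      (measure_exists_norm_score_sub_gt_le a M (ε k) (hεm k) (hεind k) (hε2 k) (hε0 k) (hεv k)
        (p₀ k) (κ := B / T) (by positivity) (η := η * T) (by positivity)).trans
        (ENNReal.ofReal_le_ofReal (by
          refine le_trans ?_ hη'e
          calc _ ≤ 2000 * v * (η' * M) / (η * T) ^ 2 := by
                gcongr
                exact hclose k
            _ = _ := by rw [hTsq]; field_simp))
    rwa [Fintype.card_fin] at this
  have hP₅ : P E₅ = 0 := by
    have := (hML M).and (hθhat M)
    rwa [ae_iff] at this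
  have hsub : {ω | ¬ (IsUnit (gnNormalMatrix a s σ M (θhat M ω) (that M ω)).det ∧
      (∀ k l, |gnRotation a s σ (rangeMeasurement a s R₀ t₀ r ω) M (θhat M ω) (that M ω) k l
        - RML M ω k l| ≤ tol / T) ∧
      (∀ k, |gnTranslation a s σ (rangeMeasurement a s R₀ t₀ r ω) M (θhat M ω) (that M ω) k
        - tML M ω k| ≤ tol / T))} ⊆
      ((((⋃ k, E₁ k) ∪ ⋃ k, E₂ k) ∪ ⋃ k, E₃ k) ∪ ⋃ k, E₄ k) ∪ E₅ := by
    intro ω hω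
    by_contra hout
    simp only [Set.mem_union, Set.mem_iUnion, not_or, not_exists] at hout
    obtain ⟨⟨⟨⟨h₁, h₂⟩, h₃⟩, h₄⟩, h₅⟩ := hout
    obtain ⟨hml, hproj⟩ := not_not.1 h₅
    have h₁' : ∀ k l, |Rhat M ω k l - R₀ k l| ≤ C₀ / T := fun k l => by
      rw [hT]
      exact abs_le_of_div_rootRate_le hN hM0 ((not_lt.1 (h₁ (k, l))).trans (hCR' k l))
    have h₂' : ∀ k, |that M ω k - t₀ k| ≤ C₀ / T := fun k => by
      rw [hT]
      exact abs_le_of_div_rootRate_le hN hM0 ((not_lt.1 (h₂ k)).trans (hCt' k))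
    have hinit : ∀ k, ‖tagPosition (rot (θhat M ω)) (that M ω) (s k) -
        tagPosition R₀ t₀ (s k)‖ ≤ (12 * S + 2) * C₀ / T := fun k => by
      refine (norm_tagPosition_sub_le_of_projection hR₀ hproj h₁' h₂' (s k)).trans ?_
      rw [mul_div_assoc]
      have := hS k
      gcongr
    have hreg : RegularSample a p₀ σ (fun i m => r i m ω) M T A c :=
      { one_le := hT1
        sq_eq := hTsq
        score_le := fun k p => not_lt.1 fun h => h₃ k ⟨p, h⟩
        dist_le := hnondeg.1
        normal_le := hnondeg.2 }
    have hfinal := hmain M T (θhat M ω) η (that M ω) (fun i m => r i m ω)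
      (rangeMeasurement a s R₀ t₀ r ω) (RML M ω) (tML M ω) (fun _ _ => rfl) hreg hT₀ hinit hml
      hη.le (fun k p q hp hq => not_lt.1 fun h => h₄ k ⟨p, q, hp, hq, h⟩)
      fun k => (hclose k).trans (by gcongr)
    have hle : D * √(η + 1 / T) / T ≤ tol / T := by
      rw [← hηtol]
      have : 1 / T ≤ η := by
        rw [div_le_iff₀ hTpos]
        rw [div_le_iff₀ hη] at hTη
        linarith
      gcongr
      linarith
    exact hω ⟨hfinal.1, fun k l => (hfinal.2.1 k l).trans hle, fun k =>
      (hfinal.2.2 k).trans hle⟩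
  calc P _ ≤ P (((((⋃ k, E₁ k) ∪ ⋃ k, E₂ k) ∪ ⋃ k, E₃ k) ∪ ⋃ k, E₄ k) ∪ E₅) := measure_mono hsub
    _ ≤ ENNReal.ofReal (4 * e₁) + ENNReal.ofReal (2 * e₁) + ENNReal.ofReal (N * e₁) +
        ENNReal.ofReal (N * e₁) + 0 := by
        refine (measure_union_le _ _).trans (add_le_add ?_ hP₅.le)
        refine (measure_union_le _ _).trans (add_le_add ?_ hP₄)
        refine (measure_union_le _ _).trans (add_le_add ?_ hP₃)
        exact (measure_union_le _ _).trans (add_le_add hP₁ hP₂)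
    _ = ENNReal.ofReal e := by
        rw [add_zero, ← ENNReal.ofReal_add (by positivity) (by positivity),
          ← ENNReal.ofReal_add (by positivity) (by positivity),
          ← ENNReal.ofReal_add (by positivity) (by positivity), hee]

theorem tendsto_measure_zero_of_forall_ofReal {Ω : Type*} [MeasurableSpace Ω] {P : Measure Ω}
    {E : ℕ → Set Ω} (h : ∀ e : ℝ, 0 < e → ∀ᶠ M in atTop, P (E M) ≤ ENNReal.ofReal e) :
    Tendsto (fun M => P (E M)) atTop (𝓝 0) := by
  rw [ENNReal.tendsto_nhds_zero]
  intro ε hε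
  obtain ⟨x, hx0, hx⟩ := ENNReal.lt_iff_exists_nnreal_btwn.1 hε
  filter_upwards [h x (by exact_mod_cast hx0)] with M hM
  rw [ENNReal.ofReal_coe_nnreal] at hM
  exact hM.trans hx.le

/-- A sequence that is within every multiple of `1 / √M` of zero, with probability tending to one,
is `o_p` of the root rate. -/
theorem isLittleOp_rootRate {Ω : Type*} [MeasurableSpace Ω] {P : Measure Ω} {X : ℕ → Ω → ℝ}
    (N : ℕ) (h : ∀ tol : ℝ, 0 < tol → ∀ e : ℝ, 0 < e →
      ∀ᶠ M : ℕ in atTop, P {ω | ¬ |X M ω| ≤ tol / √(M : ℝ)} ≤ ENNReal.ofReal e) :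
    IsLittleOp P X (rootRate N) := by
  rw [IsLittleOp, tendstoInMeasure_iff_norm]
  intro ε hε
  refine tendsto_measure_zero_of_forall_ofReal fun e he => ?_
  -- Passing from `√M` to `√(N * M)` costs `√N`; the `+ 1` keeps the tolerance defined when `N = 0`,
  -- and the factor 2 makes the final inequality strict.
  filter_upwards [h (ε / (2 * (√(N : ℝ) + 1))) (by positivity) e he, eventually_gt_atTop 0]
    with M hM hM0
  have hM' : (0 : ℝ) < M := by exact_mod_cast hM0
  refine (measure_mono fun ω hω hle => ?_).trans hM
  have hω' : ε ≤ ‖X M ω / rootRate N M - 0‖ := hω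
  rw [sub_zero, Real.norm_eq_abs, rootRate, div_div_eq_mul_div, div_one, abs_mul,
    abs_of_nonneg (Real.sqrt_nonneg _), Nat.cast_mul, Real.sqrt_mul (by positivity)] at hω'
  rw [le_div_iff₀ (by positivity)] at hle
  have h1 := mul_le_mul_of_nonneg_right hle (Real.sqrt_nonneg (N : ℝ))
  have h2 : ε / (2 * (√(N : ℝ) + 1)) * √(N : ℝ) < ε := by
    rw [div_mul_eq_mul_div, div_lt_iff₀ (by positivity)]
    nlinarith [Real.sqrt_nonneg (N : ℝ)]
  linarith

theorem tendstoInMeasure_zero_of_root_bound {Ω : Type*} [MeasurableSpace Ω] {P : Measure Ω}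
    {X : ℕ → Ω → ℝ} (h : ∀ tol : ℝ, 0 < tol → ∀ e : ℝ, 0 < e →
      ∀ᶠ M : ℕ in atTop, P {ω | ¬ |X M ω| ≤ tol / √(M : ℝ)} ≤ ENNReal.ofReal e) :
    TendstoInMeasure P X atTop fun _ => 0 := by
  rw [tendstoInMeasure_iff_norm]
  intro ε hε
  refine tendsto_measure_zero_of_forall_ofReal fun e he => ?_
  filter_upwards [h (ε / 2) (by positivity) e he, eventually_gt_atTop 0] with M hM hM0
  refine (measure_mono fun ω hω hle => ?_).trans hM
  have hω' : ε ≤ ‖X M ω - 0‖ := hω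
  rw [sub_zero, Real.norm_eq_abs] at hω'
  have h1 : (1 : ℝ) ≤ √(M : ℝ) := Real.one_le_sqrt.2 (by exact_mod_cast hM0)
  have h2 : ε / 2 / √(M : ℝ) ≤ ε / 2 := div_le_self (by positivity) h1
  linarith

end

theorem theorem1
    {Ω : Type*} [MeasurableSpace Ω] (P : Measure Ω) [IsProbabilityMeasure P]
    {N : ℕ} (a : ℕ → Plane) (s : Fin N → Plane)
    -- true pose
    (R₀ : Matrix (Fin 2) (Fin 2) ℝ) (hR₀ : R₀ ∈ SO2) (t₀ : Plane)
    -- independent centred Gaussian noise, with known standard deviations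
    (σ : Fin N → ℕ → ℝ) (σlo σhi : ℝ) (hσlo : 0 < σlo)
    (hσ : ∀ i m, σlo ≤ σ i m ∧ σ i m ≤ σhi)
    (r : Fin N → ℕ → Ω → ℝ) (hr_meas : ∀ i m, Measurable (r i m))
    (hr_indep : iIndepFun (fun p : Fin N × ℕ => r p.1 p.2) P)
    (hr_law : ∀ i m, P.map (r i m) = gaussianReal 0 (σ i m ^ 2).toNNReal)
    -- the empirical distribution of the anchors converges weakly
    (μ : ProbabilityMeasure Plane) (hμ : Tendsto (empirical a) atTop (𝓝 μ))
    -- two tags are not collinear with the origin of the local frame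
    (hs : ∃ i j, LinearIndependent ℝ ![s i, s j])
    -- the limit distribution is not carried by a line
    (hline : ∀ L : AffineSubspace ℝ Plane, Module.finrank ℝ L.direction = 1 →
      (μ : Measure Plane) (L : Set Plane) ≠ 1)
    -- the limit distribution has no atom at the true position of a tag
    (hatom : ∀ i, (μ : Measure Plane) {tagPosition R₀ t₀ (s i)} = 0)
    -- maximum likelihood estimates
    (RML : ℕ → Ω → Matrix (Fin 2) (Fin 2) ℝ) (tML : ℕ → Ω → Plane)
    (hML : ∀ M, ∀ᵐ ω ∂P,
      IsMLEstimate a s σ (rangeMeasurement a s R₀ t₀ r ω) M (RML M ω) (tML M ω))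
    -- root-n-consistent initial estimates
    (Rhat : ℕ → Ω → Matrix (Fin 2) (Fin 2) ℝ) (that : ℕ → Ω → Plane)
    (hRhat : ∀ k l, IsBigOp P (fun M ω => Rhat M ω k l - R₀ k l) (rootRate N))
    (hthat : ∀ k, IsBigOp P (fun M ω => that M ω k - t₀ k) (rootRate N))
    -- an angle of the projection of the initial rotation estimate onto SO(2)
    (θhat : ℕ → Ω → ℝ)
    (hθhat : ∀ M, ∀ᵐ ω ∂P, IsSO2Projection (Rhat M ω) (rot (θhat M ω))) :
    -- the Gauss-Newton step is well posed with probability tending to one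
    Tendsto (fun M => P {ω | ¬ IsUnit (gnNormalMatrix a s σ M (θhat M ω) (that M ω)).det})
      atTop (𝓝 0) ∧
    -- differences of order o_p(1/√n)
    (∀ k l, IsLittleOp P (fun M ω =>
      gnRotation a s σ (rangeMeasurement a s R₀ t₀ r ω) M (θhat M ω) (that M ω) k l
        - RML M ω k l) (rootRate N)) ∧
    (∀ k, IsLittleOp P (fun M ω =>
      gnTranslation a s σ (rangeMeasurement a s R₀ t₀ r ω) M (θhat M ω) (that M ω) k
        - tML M ω k) (rootRate N)) ∧
    -- convergence in probability
    (∀ k l, TendstoInMeasure P (fun M ω =>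
      gnRotation a s σ (rangeMeasurement a s R₀ t₀ r ω) M (θhat M ω) (that M ω) k l
        - RML M ω k l) atTop fun _ => 0) ∧
    (∀ k, TendstoInMeasure P (fun M ω =>
      gnTranslation a s σ (rangeMeasurement a s R₀ t₀ r ω) M (θhat M ω) (that M ω) k
        - tML M ω k) atTop fun _ => 0) := by
  obtain ⟨i, j, hij⟩ := hs
  -- Linear independence enters through distinctness: the vector `s i - s j` reveals the rotation.
  have hne : s i ≠ s j := fun h => by
    have := hij.injective.ne (show (0 : Fin 2) ≠ 1 by decide)
    exact this h
  have key := fun (tol : ℝ) (htol : 0 < tol) (e : ℝ) (he : 0 < e) =>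
    eventually_measure_gn_sub_ml_le P a s R₀ hR₀ t₀ σ σlo σhi hσlo hσ r hr_meas hr_indep hr_law μ
      hμ hne hline hatom RML tML hML Rhat that hRhat hthat θhat hθhat htol he
  have hrot : ∀ k l, ∀ tol : ℝ, 0 < tol → ∀ e : ℝ, 0 < e → ∀ᶠ M : ℕ in atTop,
      P {ω | ¬ |gnRotation a s σ (rangeMeasurement a s R₀ t₀ r ω) M (θhat M ω) (that M ω) k l
        - RML M ω k l| ≤ tol / √(M : ℝ)} ≤ ENNReal.ofReal e := by
    intro k l tol htol e he
    filter_upwards [key tol htol e he] with M hM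
    refine le_trans (measure_mono ?_) hM
    exact fun ω hω h => hω (h.2.1 k l)
  have htrans : ∀ k, ∀ tol : ℝ, 0 < tol → ∀ e : ℝ, 0 < e → ∀ᶠ M : ℕ in atTop,
      P {ω | ¬ |gnTranslation a s σ (rangeMeasurement a s R₀ t₀ r ω) M (θhat M ω) (that M ω) k
        - tML M ω k| ≤ tol / √(M : ℝ)} ≤ ENNReal.ofReal e := by
    intro k tol htol e he
    filter_upwards [key tol htol e he] with M hM
    refine le_trans (measure_mono ?_) hM
    exact fun ω hω h => hω (h.2.2 k)
  refine ⟨tendsto_measure_zero_of_forall_ofReal fun e he => ?_,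
    fun k l => isLittleOp_rootRate N (hrot k l), fun k => isLittleOp_rootRate N (htrans k),
    fun k l => tendstoInMeasure_zero_of_root_bound (hrot k l),
    fun k => tendstoInMeasure_zero_of_root_bound (htrans k)⟩
  filter_upwards [key 1 one_pos e he] with M hM
  refine le_trans (measure_mono ?_) hM
  exact fun ω hω h => hω h.1
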